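/- **Jet Isomorphism Theorem (strong version).** Let $(V,\langle\cdot,\cdot\rangle)$ be a pseudo-Euclidean space, i.e. a finite-dimensional real vector space with a non-degenerate symmetric bilinear form, and let $k\ge 0$. *Definitions.* For $\ell\ge 1$ let $$\mathcal N_\ell=\{h\in \mathrm{Sym}^\ell V^*\otimes\mathrm{Sym}^2V^* : h(\xi,\dots,\xi;\xi,\cdot)=0 \text{ for all } \xi\in V\}.$$ An algebraic curvature tensor is an $R\in\otimes^4V^*$ with $R(x_1,x_2,y_1,y_2)=-R(x_2,x_1,y_1,y_2)=R(y_1,y_2,x_1,x_2)$ and $R(x_1,x_2,x_3,y)+R(x_2,x_3,x_1,y)+R(x_3,x_1,x_2,y)=0$. An algebraic curvature $k$-jet is a sequence $(R,\nabla R,\dots,\nabla^{k)}R)$ with $\nabla^{i)}R\in\otimes^{i+4}V^*$ such that * for all $0\le i\le k$ and all $x_1,\dots,x_i\in V$ the tensor $\nabla^{i)}_{x_1,\dots,x_i}R$ is an algebraic curvature tensor; * for all $0\le i<k$ and all $u_1,\dots,u_i,x_1,x_2,x_3,y_1,y_2\in V$ the second Bianchi identity holds: the cyclic sum over $x_1,x_2,x_3$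 of $\nabla^{i+1)}_{u_1,\dots,u_i,x_1}R(x_2,x_3,y_1,y_2)$ vanishes; * for all $s,m\ge0$ with $s+2+m\le k$ the (higher) Ricci identities hold: $$\nabla^{s+2+m)}_{x_1,\dots,x_s,y,z,w_1,\dots,w_m}R-\nabla^{s+2+m)}_{x_1,\dots,x_s,z,y,w_1,\dots,w_m}R=\sum_{S\subseteq\{1,\dots,s\}}\Big(\nabla^{|S|)}_{x_S}R(y,z)\cdot\nabla^{|S^c|+m)}_{x_{S^c},\,\cdot}R\Big)_{w_1,\dots,w_m},$$ where $x_S$ lists the $x_i$ with $i\in S$ in increasing order, $\nabla^{|S|)}_{x_S}R(y,z)$ is the endomorphism $A$ of $V$ with $\langle Au,v\rangle=\nabla^{|S|)}_{x_S}R(y,z,u,v)$, and $A\cdot T=-\sum_j T(\dots,A\,\cdot\,,\dots)$ is the derivation action, here on the $m+4$ slots other than $x_{S^c}$. Let $\mathrm{Jet}^k\mathcal C$ be the set of algebraic curvature $k$-jets, $\mathrm{Jet}^{-1}\mathcal C$ a point, and $\mathcal C_k=\{T\in\otimes^{k+4}V^* : (0,\dots,0,T)\in\mathrm{Jet}^k\mathcal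 C\}$, a linear space. An affine vector bundle modelled on a vector space $F$ is a smooth fibre bundle whose fibres are (non-empty) affine spaces with direction space $F$, with local trivializations that are fibrewise affine isomorphisms; an isomorphism of such bundles is a diffeomorphism of the total spaces that covers a diffeomorphism of the bases and is an affine isomorphism on each fibre. The projection $\bigoplus_{\ell=2}^{k+2}\mathcal N_\ell\to\bigoplus_{\ell=2}^{k+1}\mathcal N_\ell$ is an affine vector bundle modelled on $\mathcal N_{k+2}$. Consider the following three maps. * $\mathrm R:\bigoplus_{\ell=2}^{k+2}\mathcal N_\ell\to\mathrm{Jet}^k\mathcal C$ sends $(h_2,\dots,h_{k+2})$ to the jet $(R,\nabla R,\dots,\nabla^{k)}R)$ at the origin of the curvature tensor of the metric $g_\xi=\langle\cdot,\cdot\rangle+\sum_{\ell}h_\ell(\xi,\dots,\xi;\cdot,\cdot)$. Here $R(x,y,z,w)=g(R(x,y)z,w)$ with $R(x,y)=[\nabla_x,\nabla_y]-\nabla_{[x,y]}$, $\nabla$ is the Levi-Civita connection, and the outermost derivative is put into the first slot. * $\mathcal R:\mathrm{Jet}^k\mathcal C\to\bigoplus_{\ell=2}^{k+2}\mathcal N_\ell$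 sends a jet to $(\mathcal R^{0)},\dots,\mathcal R^{k)})$, where $\mathcal R^{i)}\in\mathcal N_{i+2}$ is the polarization of $\mathcal R^{i)}(\xi;x,y)=\nabla^{i)}_{\xi,\dots,\xi}R(x,\xi,\xi,y)$. * $\mathrm Q:\bigoplus_{\ell=2}^{k+2}\mathcal N_\ell\to\bigoplus_{\ell=2}^{k+2}\mathcal N_\ell$ sends $(\mathcal R^{0)},\dots,\mathcal R^{k)})$ to $\sum_{\ell=2}^{k+2}\frac1{\ell!}Q_\ell(\mathcal R^{0)},\dots,\mathcal R^{k)})$. Here symmetric bilinear forms are identified with symmetric endomorphisms by $\langle\cdot,\cdot\rangle$, $Q_\ell$ is the element $Q_\ell=\sum_{j=0}^\ell\binom \ell j\tilde Q_j^*\tilde Q_{\ell-j}$ of the free associative algebra $\mathbb R\langle X_2,X_3,\dots\rangle$ into which one substitutes $X_{i+2}=\mathcal R^{i)}(\xi)$, ${}^*$ is the anti-automorphism fixing the $X_i$, and $\tilde Q_0=1$, $\tilde Q_m=-\frac1{m(m+1)}\sum_{j=2}^m\binom mj(j-1)j\,X_j\tilde Q_{m-j}$ for $m\ge1$. *Theorem.*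 (a) With respect to the natural projection $\mathrm{Jet}^k\mathcal C\to\mathrm{Jet}^{k-1}\mathcal C$, the space $\mathrm{Jet}^k\mathcal C$ is an affine vector bundle over $\mathrm{Jet}^{k-1}\mathcal C$ modelled on $\mathcal C_k$. In particular, every algebraic curvature $(k-1)$-jet extends to an algebraic curvature $k$-jet. (b) The maps $\mathrm R$, $\mathcal R$ and $\mathrm Q$ are well defined and are isomorphisms of affine vector bundles, covering the corresponding maps with $k-1$ in place of $k$. They satisfy $\mathrm Q\circ\mathcal R\circ\mathrm R=\mathrm{Id}$. Further, they commute with the natural actions of the orthogonal group $\mathrm O(V,\langle\cdot,\cdot\rangle)$, in particular of $\mathrm{SO}(V,\langle\cdot,\cdot\rangle)$, on the total spaces. -/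

import Mathlib

set_option maxSynthPendingDepth 3

open scoped ContDiff Topology

namespace JetIso

/-! ## Smooth maps and submanifolds, fibre bundles of affine spaces -/

section Smooth

variable {W W' : Type*} [NormedAddCommGroup W] [NormedSpace ℝ W]
  [NormedAddCommGroup W'] [NormedSpace ℝ W']

/-- A map is smooth on an arbitrary subset `S` of a normed space if near each point of `S` it is the
restriction to `S` of a smooth map defined on an open set. -/
def SmoothOnSet (f : W → W') (S : Set W) : Prop :=
  ∀ x ∈ S, ∃ U : Set W, IsOpen U ∧ x ∈ U ∧
    ∃ F : W → W', ContDiffOn ℝ ∞ F U ∧ Set.EqOn f F (S ∩ U)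

/-- `f` restricts to a diffeomorphism of the subset `S` onto the subset `S'`. -/
def IsDiffeoOn (f : W → W') (S : Set W) (S' : Set W') : Prop :=
  SmoothOnSet f S ∧ Set.MapsTo f S S' ∧
    ∃ f' : W' → W, SmoothOnSet f' S' ∧ Set.MapsTo f' S' S ∧
      Set.LeftInvOn f' f S ∧ Set.RightInvOn f' f S'

/-- `S` is an (embedded) smooth submanifold of the ambient space `W`: every point of `S` has a
relatively open neighbourhood that is diffeomorphic to an open subset of some fixed `ℝ^m`. -/
def IsSubmanifold (S : Set W) : Prop :=
  ∃ m : ℕ, ∀ x ∈ S, ∃ U : Set W, IsOpen U ∧ x ∈ U ∧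
    ∃ (φ : W → EuclideanSpace ℝ (Fin m)) (O : Set (EuclideanSpace ℝ (Fin m))),
      IsOpen O ∧ IsDiffeoOn φ (S ∩ U) O

end Smooth

/-- The data of a fibration `proj : total → base` between subsets of normed spaces, together with a
linear map `dir : F → W` by which the vector space `F` acts on the ambient space through the
translations `e ↦ e + dir v`. -/
structure BundleData (W W₀ F : Type*) [NormedAddCommGroup W] [NormedSpace ℝ W]
    [NormedAddCommGroup W₀] [NormedSpace ℝ W₀] [NormedAddCommGroup F] [NormedSpace ℝ F] where
  proj : W → W₀
  total : Set W
  base : Set W₀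
  dir : F →L[ℝ] W

section Bundles

variable {W W₀ F W' W₀' F' : Type*} [NormedAddCommGroup W] [NormedSpace ℝ W]
  [NormedAddCommGroup W₀] [NormedSpace ℝ W₀] [NormedAddCommGroup F] [NormedSpace ℝ F]
  [NormedAddCommGroup W'] [NormedSpace ℝ W']
  [NormedAddCommGroup W₀'] [NormedSpace ℝ W₀'] [NormedAddCommGroup F'] [NormedSpace ℝ F']

/-- `proj : total → base` is a smooth affine vector bundle modelled on the vector space `F`: base
and total space are smooth submanifolds, the projection is smooth, each fibre is a (non-empty) affine
space with direction space `F`, and there are smooth local trivializations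
`(base ∩ U) × F ≅ proj⁻¹ (base ∩ U)` which are affine isomorphisms on each fibre. -/
structure BundleData.IsAffineBundle (B : BundleData W W₀ F) : Prop where
  base_manifold : IsSubmanifold B.base
  total_manifold : IsSubmanifold B.total
  proj_mapsTo : Set.MapsTo B.proj B.total B.base
  proj_smooth : SmoothOnSet B.proj B.total
  fibre_nonempty : ∀ b ∈ B.base, ∃ e ∈ B.total, B.proj e = b
  dir_injective : Function.Injective B.dir
  fibre_affine : ∀ e ∈ B.total,
    {e' | e' ∈ B.total ∧ B.proj e' = B.proj e} = Set.range fun v : F => e + B.dir v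
  locally_trivial : ∀ b₀ ∈ B.base, ∃ U : Set W₀, IsOpen U ∧ b₀ ∈ U ∧
    ∃ Φ : W₀ × F → W,
      IsDiffeoOn Φ ((B.base ∩ U) ×ˢ Set.univ) {e | e ∈ B.total ∧ B.proj e ∈ U} ∧
      ∀ b ∈ B.base ∩ U, (∀ v : F, B.proj (Φ (b, v)) = b) ∧
        ∃ L : F ≃ₗ[ℝ] F, ∀ v : F, Φ (b, v) = Φ (b, 0) + B.dir (L v)

/-- `f : total → total'` is an isomorphism of affine vector bundles over `f₀ : base → base'`:
both maps are diffeomorphisms, they commute with the projections, and `f` is an affine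
isomorphism from each fibre onto its image fibre. -/
structure IsAffineBundleIso (B : BundleData W W₀ F) (B' : BundleData W' W₀' F')
    (f : W → W') (f₀ : W₀ → W₀') : Prop where
  diffeo_total : IsDiffeoOn f B.total B'.total
  diffeo_base : IsDiffeoOn f₀ B.base B'.base
  covers : ∀ e ∈ B.total, B'.proj (f e) = f₀ (B.proj e)
  fibrewise_affine : ∀ b ∈ B.base, ∃ L : F ≃ₗ[ℝ] F', ∀ e ∈ B.total, B.proj e = b →
    ∀ v : F, f (e + B.dir v) = f e + B'.dir (L v)

end Bundles

/-! ## Tensors -/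

/-- `⊗ⁿ V*`, as `n`-linear forms on `V`. -/
abbrev Tensor (V : Type*) [NormedAddCommGroup V] [NormedSpace ℝ V] (n : ℕ) : Type _ :=
  V [×n]→L[ℝ] ℝ

/-- Bilinear forms on `V`. -/
abbrev BForm (V : Type*) [NormedAddCommGroup V] [NormedSpace ℝ V] : Type _ :=
  V →L[ℝ] V →L[ℝ] ℝ

variable {V : Type*} [NormedAddCommGroup V] [NormedSpace ℝ V]

/-- The derivation action of an endomorphism `A` on covariant tensors,
`(A · T)(v₁, …, vₙ) = - ∑ⱼ T(v₁, …, A vⱼ, …, vₙ)`. -/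
noncomputable def derivAct {n : ℕ} (A : V →L[ℝ] V) (T : Tensor V n) : Tensor V n :=
  -∑ j : Fin n, T.compContinuousLinearMap
    (Function.update (fun _ => ContinuousLinearMap.id ℝ V) j A)

theorem derivAct_apply {n : ℕ} (A : V →L[ℝ] V) (T : Tensor V n) (v : Fin n → V) :
    derivAct A T v = -∑ j : Fin n, T (Function.update v j (A (v j))) := by
  simp only [derivAct, neg_apply, sum_apply,
    ContinuousMultilinearMap.compContinuousLinearMap_apply]
  congr 1
  refine Finset.sum_congr rfl fun j _ => ?_
  congr 1
  funext i
  by_cases h : i = j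
  · subst h; simp
  · simp [h]

theorem derivAct_add {n : ℕ} (A B : V →L[ℝ] V) (T : Tensor V n) :
    derivAct (A + B) T = derivAct A T + derivAct B T := by
  ext v
  simp only [derivAct_apply, add_apply,
    ContinuousMultilinearMap.map_update_add, Finset.sum_add_distrib, neg_add]

theorem derivAct_smul {n : ℕ} (c : ℝ) (A : V →L[ℝ] V) (T : Tensor V n) :
    derivAct (c • A) T = c • derivAct A T := by
  ext v
  simp only [derivAct_apply, smul_apply,
    ContinuousMultilinearMap.map_update_smul, smul_neg, Finset.smul_sum]

/-! ## The curvature jet of a metric at the origin -/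

section Metric

/-- The Christoffel symbols with all indices lowered:
`(x, y, z) ↦ ½ (∂ₓ g(y,z) + ∂_y g(x,z) - ∂_z g(x,y))` at the point `ξ`. -/
noncomputable def koszul (g : V → BForm V) (ξ : V) : V →L[ℝ] V →L[ℝ] V →L[ℝ] ℝ :=
  (1 / 2 : ℝ) • (fderiv ℝ g ξ + (fderiv ℝ g ξ).flip -
    (ContinuousLinearMap.flipₗᵢ ℝ V V ℝ : BForm V →L[ℝ] BForm V).comp (fderiv ℝ g ξ).flip)

theorem koszul_apply (g : V → BForm V) (ξ x y z : V) :
    koszul g ξ x y z =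
      1 / 2 * (fderiv ℝ g ξ x y z + fderiv ℝ g ξ y x z - fderiv ℝ g ξ z x y) := rfl

/-- The Levi-Civita connection of the metric `g` on (a neighbourhood of the origin in) `V`:
`Γ_ξ(x, y)` is the value at `ξ` of the covariant derivative, in direction `x`, of the constant vector
field `y`, that is `g_ξ(Γ_ξ(x, y), ·)` is the lowered Christoffel symbol. -/
noncomputable def christoffel (g : V → BForm V) (ξ : V) : V →L[ℝ] V →L[ℝ] V :=
  (ContinuousLinearMap.compL ℝ V (V →L[ℝ] ℝ) V (ContinuousLinearMap.inverse (g ξ))).comp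
    (koszul g ξ)

theorem christoffel_apply (g : V → BForm V) (ξ x y : V) :
    christoffel g ξ x y = ContinuousLinearMap.inverse (g ξ) (koszul g ξ x y) := rfl

/-- The curvature endomorphism `R(x, y) z = ∇ₓ∇_y z - ∇_y∇ₓ z` for constant vector fields
`x, y, z`, at the point `ξ`. -/
noncomputable def curvEnd (g : V → BForm V) (ξ x y z : V) : V :=
  fderiv ℝ (christoffel g) ξ x y z - fderiv ℝ (christoffel g) ξ y x z
    + christoffel g ξ x (christoffel g ξ y z) - christoffel g ξ y (christoffel g ξ x z)

theorem fin4_ne :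
    ((0 : Fin 4) = 1) = False ∧ ((0 : Fin 4) = 2) = False ∧ ((0 : Fin 4) = 3) = False ∧
    ((1 : Fin 4) = 0) = False ∧ ((1 : Fin 4) = 2) = False ∧ ((1 : Fin 4) = 3) = False ∧
    ((2 : Fin 4) = 0) = False ∧ ((2 : Fin 4) = 1) = False ∧ ((2 : Fin 4) = 3) = False ∧
    ((3 : Fin 4) = 0) = False ∧ ((3 : Fin 4) = 1) = False ∧ ((3 : Fin 4) = 2) = False := by
  refine ⟨?_, ?_, ?_, ?_, ?_, ?_, ?_, ?_, ?_, ?_, ?_, ?_⟩ <;> exact eq_false (by decide)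

/-- The curvature tensor `R(x₁, x₂, y₁, y₂) = g(R(x₁, x₂) y₁, y₂)`, as a tensor field. -/
noncomputable def curvTensor (g : V → BForm V) (ξ : V) : Tensor V 4 where
  toFun v := g ξ (curvEnd g ξ (v 0) (v 1) (v 2)) (v 3)
  map_update_add' := by
    intro inst v i x y
    rw [Subsingleton.elim inst (instDecidableEqFin 4)]
    match i with
    | 0 | 1 | 2 | 3 =>
      simp only [Function.update_self, fin4_ne, Function.update_of_ne, ne_eq, not_false_eq_true,
        curvEnd, map_add, map_sub, add_apply, sub_apply] <;> ring
  map_update_smul' := by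
    intro inst v i c x
    rw [Subsingleton.elim inst (instDecidableEqFin 4)]
    match i with
    | 0 | 1 | 2 | 3 =>
      simp only [Function.update_self, fin4_ne, Function.update_of_ne, ne_eq, not_false_eq_true,
        curvEnd, map_add, map_sub, map_smul, add_apply, sub_apply, smul_apply, smul_eq_mul] <;> ring
  cont := by
    unfold curvEnd
    fun_prop

variable [FiniteDimensional ℝ V]

/-- The covariant derivative of a tensor field; the direction of differentiation is put into the
first slot: `(∇T)(x, v) = ∂ₓ T (v) - ∑ⱼ T(…, Γ(x, vⱼ), …)`. -/
noncomputable def covDeriv {n : ℕ} (g : V → BForm V) (T : V → Tensor V n) (ξ : V) :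
    Tensor V (n + 1) :=
  ContinuousLinearMap.uncurryLeft (LinearMap.toContinuousLinearMap
    { toFun := fun x : V => fderiv ℝ T ξ x + derivAct (christoffel g ξ x) (T ξ)
      map_add' := by
        intro x y
        rw [map_add, map_add, derivAct_add]
        abel
      map_smul' := by
        intro c x
        rw [map_smul, map_smul, derivAct_smul, RingHom.id_apply, smul_add] })

theorem covDeriv_apply {n : ℕ} (g : V → BForm V) (T : V → Tensor V n) (ξ : V)
    (v : Fin (n + 1) → V) :
    covDeriv g T ξ v = fderiv ℝ T ξ (v 0) (Fin.tail v)
      + derivAct (christoffel g ξ (v 0)) (T ξ) (Fin.tail v) := rfl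

/-- The iterated covariant derivative `∇^{i)} R` of the curvature tensor, as a tensor field; the
outermost derivative comes first. -/
noncomputable def nablaCurv (g : V → BForm V) : (i : ℕ) → V → Tensor V (i + 4)
  | 0 => curvTensor g
  | i + 1 => covDeriv g (nablaCurv g i)

end Metric

/-! ## Algebraic curvature jets -/

/-- Sequences `(T₀, …, T_{N-1})` with `Tᵢ ∈ ⊗^{i+4} V*`. -/
abbrev JetAmb (V : Type*) [NormedAddCommGroup V] [NormedSpace ℝ V] (N : ℕ) : Type _ :=
  (i : Fin N) → Tensor V (i + 4)

/-- The component of order `i` (zero if the sequence has no such component). -/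
noncomputable def comp {N : ℕ} (J : JetAmb V N) (i : ℕ) : Tensor V (i + 4) :=
  if h : i < N then J ⟨i, h⟩ else 0

/-- The identities of an algebraic curvature tensor. -/
structure IsAlgCurv (R : V → V → V → V → ℝ) : Prop where
  skew : ∀ x₁ x₂ y₁ y₂, R x₁ x₂ y₁ y₂ = -R x₂ x₁ y₁ y₂
  pair : ∀ x₁ x₂ y₁ y₂, R x₁ x₂ y₁ y₂ = R y₁ y₂ x₁ x₂
  bianchi : ∀ x₁ x₂ x₃ y, R x₁ x₂ x₃ y + R x₂ x₃ x₁ y + R x₃ x₁ x₂ y = 0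

/-- The vector `A u = R(y, z) u`, where `R(y, z)` is the endomorphism of `V` with
`⟨R(y, z) u, v⟩ = T(x₁, …, xₛ, y, z, u, v)`. -/
noncomputable def curvOp (gg : BForm V) {s : ℕ} (T : Tensor V (s + 4)) (x : Fin s → V)
    (y z u : V) : V :=
  ContinuousLinearMap.inverse gg (T.curryRight (Fin.append x ![y, z, u]))

theorem curvOp_spec [FiniteDimensional ℝ V] (gg : BForm V)
    (hnd : ∀ x, (∀ y, gg x y = 0) → x = 0) {s : ℕ} (T : Tensor V (s + 4)) (x : Fin s → V)
    (y z u v : V) : gg (curvOp gg T x y z u) v = T (Fin.append x ![y, z, u, v]) := by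
  have hinj : Function.Injective (gg : V →ₗ[ℝ] V →L[ℝ] ℝ) := by
    rw [injective_iff_map_eq_zero]
    intro a ha
    exact hnd a fun b => by
      have := congrArg (fun f : V →L[ℝ] ℝ => f b) ha
      simpa using this
  have hdim : Module.finrank ℝ V = Module.finrank ℝ (V →L[ℝ] ℝ) := by
    rw [← (LinearMap.toContinuousLinearMap : (V →ₗ[ℝ] ℝ) ≃ₗ[ℝ] (V →L[ℝ] ℝ)).finrank_eq]
    exact (Subspace.dual_finrank_eq (K := ℝ) (V := V)).symm
  let E : V ≃L[ℝ] (V →L[ℝ] ℝ) :=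
    (LinearEquiv.ofInjectiveOfFinrankEq (gg : V →ₗ[ℝ] V →L[ℝ] ℝ) hinj hdim).toContinuousLinearEquiv
  have hE : gg = (E : V →L[ℝ] V →L[ℝ] ℝ) := by ext; rfl
  have h1 : gg (curvOp gg T x y z u) = T.curryRight (Fin.append x ![y, z, u]) := by
    unfold curvOp
    rw [hE, ContinuousLinearMap.inverse_equiv]
    exact E.apply_symm_apply _
  rw [h1]
  change T (Fin.snoc (Fin.append x ![y, z, u] : Fin (s + 3) → V) v : Fin (s + 4) → V) = _
  congr 1
  rw [← Fin.append_snoc]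
  congr 1
  funext j
  match j with
  | 0 | 1 | 2 | 3 => rfl

/-- The subsequence of `x₁, …, xₛ` of those `xᵢ` with `i ∈ S`, in the same order. -/
def sel {s : ℕ} (x : Fin s → V) (S : Finset (Fin s)) : Fin S.card → V :=
  fun j => x (S.orderEmbOfFin rfl j)

/-- The right hand side of the Ricci identity, differentiated covariantly `s` times in the directions
`x₁, …, xₛ` according to the Leibniz rule,
`∑_S (∇_{x_S} R)(y, z) · (∇_{x_{Sᶜ}} ∇^{m)} R)`, and evaluated on the arguments
`w₁, …, wₘ` (the remaining directions of differentiation) and `r₁, …, r₄`. -/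
noncomputable def ricciRHS (gg : BForm V) {N : ℕ} (J : JetAmb V N) {s m : ℕ} (x : Fin s → V)
    (y z : V) (w : Fin m → V) (r : Fin 4 → V) : ℝ :=
  ∑ S : Finset (Fin s),
    -(∑ j : Fin m, comp J (Sᶜ.card + m) (Fin.append (Fin.append (sel x Sᶜ)
          (Function.update w j (curvOp gg (comp J S.card) (sel x S) y z (w j)))) r)
      + ∑ j : Fin 4, comp J (Sᶜ.card + m) (Fin.append (Fin.append (sel x Sᶜ) w)
          (Function.update r j (curvOp gg (comp J S.card) (sel x S) y z (r j)))))

/-- Algebraic curvature jets `(R, ∇R, …, ∇^{N-1)} R)` (of order `N - 1`): all components have the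
symmetries of a curvature tensor in the last four slots, they satisfy the second Bianchi identity in
the last derivative slot, and all the (higher) Ricci identities
`∇_{x₁,…,xₛ,y,z,w₁,…,wₘ} R - ∇_{x₁,…,xₛ,z,y,w₁,…,wₘ} R = ∇_{x₁,…,xₛ} (R(y, z) · ∇_{w₁,…,wₘ} R)`
hold, the right hand side being expanded by the Leibniz rule. -/
structure IsCurvJet (gg : BForm V) {N : ℕ} (J : JetAmb V N) : Prop where
  algCurv : ∀ i < N, ∀ x : Fin i → V,
    IsAlgCurv fun a b c d => comp J i (Fin.append x ![a, b, c, d])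
  bianchi₂ : ∀ i, i + 1 < N → ∀ (x : Fin i → V) (x₁ x₂ x₃ y₁ y₂ : V),
    comp J (i + 1) (Fin.append (Fin.snoc x x₁ : Fin (i + 1) → V) ![x₂, x₃, y₁, y₂])
      + comp J (i + 1) (Fin.append (Fin.snoc x x₂ : Fin (i + 1) → V) ![x₃, x₁, y₁, y₂])
      + comp J (i + 1) (Fin.append (Fin.snoc x x₃ : Fin (i + 1) → V) ![x₁, x₂, y₁, y₂]) = 0
  ricci : ∀ s m : ℕ, s + 2 + m < N → ∀ (x : Fin s → V) (y z : V) (w : Fin m → V) (r : Fin 4 → V),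
    comp J (s + 2 + m) (Fin.append (Fin.append (Fin.append x ![y, z]) w) r)
      - comp J (s + 2 + m) (Fin.append (Fin.append (Fin.append x ![z, y]) w) r)
      = ricciRHS gg J x y z w r

/-- The sequence `(0, …, 0, T)` with `T` in order `k`. -/
noncomputable def topJet (V : Type*) [NormedAddCommGroup V] [NormedSpace ℝ V] (k : ℕ) :
    Tensor V (k + 4) →L[ℝ] JetAmb V (k + 1) :=
  ContinuousLinearMap.single ℝ (fun i : Fin (k + 1) => Tensor V (i + 4)) (Fin.last k)

/-- Omitting the component of highest order. -/
def truncJet (V : Type*) [NormedAddCommGroup V] [NormedSpace ℝ V] (k : ℕ) :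
    JetAmb V (k + 1) → JetAmb V k :=
  fun J i => J i.castSucc

theorem comp_topJet_of_ne {k i : ℕ} (h : i ≠ k) (T : Tensor V (k + 4)) :
    comp (topJet V k T) i = 0 := by
  unfold comp
  split_ifs with hi
  · exact Pi.single_eq_of_ne (M := fun i : Fin (k + 1) => Tensor V (i + 4))
      (i := Fin.last k) (i' := ⟨i, hi⟩) (fun e => h (congrArg Fin.val e)) T
  · rfl

theorem ricciRHS_topJet (gg : BForm V) {k s m : ℕ} (h : s + 2 + m < k + 1) (T : Tensor V (k + 4))
    (x : Fin s → V) (y z : V) (w : Fin m → V) (r : Fin 4 → V) :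
    ricciRHS gg (topJet V k T) x y z w r = 0 := by
  refine Finset.sum_eq_zero fun S _ => ?_
  have h1 : Sᶜ.card ≤ s := by simpa using Sᶜ.card_le_univ
  rw [comp_topJet_of_ne (i := Sᶜ.card + m) (by omega)]
  simp

theorem comp_add {N : ℕ} (J J' : JetAmb V N) (i : ℕ) :
    comp (J + J') i = comp J i + comp J' i := by
  unfold comp
  split_ifs <;> simp

theorem comp_smul {N : ℕ} (c : ℝ) (J : JetAmb V N) (i : ℕ) :
    comp (c • J) i = c • comp J i := by
  unfold comp
  split_ifs <;> simp

/-- The linear space `𝒞_k` of those `T` for which `(0, …, 0, T)` is an algebraic curvature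
`k`-jet. -/
noncomputable def linJet (gg : BForm V) (k : ℕ) : Submodule ℝ (Tensor V (k + 4)) where
  carrier := {T | IsCurvJet gg (topJet V k T)}
  zero_mem' := by
    have h0 : ∀ i, comp (0 : JetAmb V (k + 1)) i = 0 := by
      intro i
      unfold comp
      split_ifs <;> rfl
    refine ⟨fun i _ x => ⟨?_, ?_, ?_⟩, ?_, fun s m h x y z w r => ?_⟩
    · simp [h0]
    · simp [h0]
    · simp [h0]
    · simp [h0]
    · rw [ricciRHS_topJet gg h]
      simp [h0]
  add_mem' := by
    rintro a b ⟨ha, ha', ha''⟩ ⟨hb, hb', hb''⟩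
    refine ⟨fun i hi x => ⟨fun x₁ x₂ y₁ y₂ => ?_, fun x₁ x₂ y₁ y₂ => ?_, fun x₁ x₂ x₃ y => ?_⟩,
      fun i hi x x₁ x₂ x₃ y₁ y₂ => ?_, fun s m h x y z w r => ?_⟩
    · have e1 := (ha i hi x).skew x₁ x₂ y₁ y₂
      have e2 := (hb i hi x).skew x₁ x₂ y₁ y₂
      simp only [map_add, comp_add, add_apply] at e1 e2 ⊢
      linarith
    · have e1 := (ha i hi x).pair x₁ x₂ y₁ y₂
      have e2 := (hb i hi x).pair x₁ x₂ y₁ y₂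
      simp only [map_add, comp_add, add_apply] at e1 e2 ⊢
      linarith
    · have e1 := (ha i hi x).bianchi x₁ x₂ x₃ y
      have e2 := (hb i hi x).bianchi x₁ x₂ x₃ y
      simp only [map_add, comp_add, add_apply] at e1 e2 ⊢
      linarith
    · have e1 := ha' i hi x x₁ x₂ x₃ y₁ y₂
      have e2 := hb' i hi x x₁ x₂ x₃ y₁ y₂
      simp only [map_add, comp_add, add_apply] at e1 e2 ⊢
      linarith
    · have e1 := ha'' s m h x y z w r
      have e2 := hb'' s m h x y z w r
      rw [ricciRHS_topJet gg h] at e1 e2 ⊢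
      simp only [map_add, comp_add, add_apply] at e1 e2 ⊢
      linarith
  smul_mem' := by
    rintro c a ⟨ha, ha', ha''⟩
    refine ⟨fun i hi x => ⟨fun x₁ x₂ y₁ y₂ => ?_, fun x₁ x₂ y₁ y₂ => ?_, fun x₁ x₂ x₃ y => ?_⟩,
      fun i hi x x₁ x₂ x₃ y₁ y₂ => ?_, fun s m h x y z w r => ?_⟩
    · have e1 := (ha i hi x).skew x₁ x₂ y₁ y₂
      simp only [map_smul, comp_smul, smul_apply, smul_eq_mul] at e1 ⊢
      rw [e1, mul_neg]
    · have e1 := (ha i hi x).pair x₁ x₂ y₁ y₂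
      simp only [map_smul, comp_smul, smul_apply, smul_eq_mul] at e1 ⊢
      rw [e1]
    · have e1 := (ha i hi x).bianchi x₁ x₂ x₃ y
      simp only [map_smul, comp_smul, smul_apply, smul_eq_mul] at e1 ⊢
      rw [← mul_add, ← mul_add, e1, mul_zero]
    · have e1 := ha' i hi x x₁ x₂ x₃ y₁ y₂
      simp only [map_smul, comp_smul, smul_apply, smul_eq_mul] at e1 ⊢
      rw [← mul_add, ← mul_add, e1, mul_zero]
    · have e1 := ha'' s m h x y z w r
      rw [ricciRHS_topJet gg h] at e1 ⊢
      simp only [map_smul, comp_smul, smul_apply, smul_eq_mul] at e1 ⊢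
      rw [← mul_sub, e1, mul_zero]

/-- The space `Jet^{N-1} 𝒞` of algebraic curvature jets with `N` components, and so
`curvJets gg (k + 1)` is the space of algebraic curvature `k`-jets; `Jet^{-1} 𝒞` is a point. -/
def curvJets (gg : BForm V) (N : ℕ) : Set (JetAmb V N) := {J | IsCurvJet gg J}

/-! ## Taylor polynomials of metrics in normal coordinates -/

/-- The space `𝒩_ℓ` of all `h ∈ Sym^ℓ V* ⊗ Sym² V*` with `h(ξ, …, ξ; ξ, ·) = 0` for all `ξ`. -/
def normalSpace (V : Type*) [NormedAddCommGroup V] [NormedSpace ℝ V] (l : ℕ) :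
    Submodule ℝ (V [×l]→L[ℝ] BForm V) where
  carrier := {h | (∀ (σ : Equiv.Perm (Fin l)) (v : Fin l → V), h (fun j => v (σ j)) = h v) ∧
    (∀ v x y, h v x y = h v y x) ∧ ∀ ξ y, h (fun _ => ξ) ξ y = 0}
  zero_mem' := by simp
  add_mem' := by
    rintro a b ⟨ha, ha', ha''⟩ ⟨hb, hb', hb''⟩
    refine ⟨fun σ v => ?_, fun v x y => ?_, fun ξ y => ?_⟩
    · simp [ha σ v, hb σ v]
    · simp [ha' v x y, hb' v x y]
    · simp [ha'', hb'']
  smul_mem' := by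
    rintro c a ⟨ha, ha', ha''⟩
    refine ⟨fun σ v => ?_, fun v x y => ?_, fun ξ y => ?_⟩
    · simp [ha σ v]
    · simp [ha' v x y]
    · simp [ha'']

/-- Sequences `(h₂, …, h_{N+1})`, where `h_{i+2}` has degree `i + 2` and values in bilinear forms. -/
abbrev SymAmb (V : Type*) [NormedAddCommGroup V] [NormedSpace ℝ V] (N : ℕ) : Type _ :=
  (i : Fin N) → V [×(i + 2)]→L[ℝ] BForm V

/-- The direct sum `𝒩₂ ⊕ … ⊕ 𝒩_{N+1}`. -/
def normalSum (V : Type*) [NormedAddCommGroup V] [NormedSpace ℝ V] (N : ℕ) : Set (SymAmb V N) :=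
  {h | ∀ i : Fin N, h i ∈ normalSpace V (i + 2)}

/-- The sequence `(0, …, 0, h)` with `h` in degree `k + 2`. -/
noncomputable def topSym (V : Type*) [NormedAddCommGroup V] [NormedSpace ℝ V] (k : ℕ) :
    (V [×(k + 2)]→L[ℝ] BForm V) →L[ℝ] SymAmb V (k + 1) :=
  ContinuousLinearMap.single ℝ (fun i : Fin (k + 1) => V [×(i + 2)]→L[ℝ] BForm V) (Fin.last k)

/-- Omitting the component of highest degree. -/
def truncSym (V : Type*) [NormedAddCommGroup V] [NormedSpace ℝ V] (k : ℕ) :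
    SymAmb V (k + 1) → SymAmb V k :=
  fun h i => h i.castSucc

/-! ## The two bundles -/

/-- The projection `Jet^k 𝒞 → Jet^{k-1} 𝒞`, with `𝒞_k` acting by translation of the component of
order `k`. -/
noncomputable def jetBundle (gg : BForm V) (k : ℕ) :
    BundleData (JetAmb V (k + 1)) (JetAmb V k) (linJet gg k) where
  proj := truncJet V k
  total := curvJets gg (k + 1)
  base := curvJets gg k
  dir := (topJet V k).comp (linJet gg k).subtypeL

/-- The projection `𝒩₂ ⊕ … ⊕ 𝒩_{k+2} → 𝒩₂ ⊕ … ⊕ 𝒩_{k+1}`, with `𝒩_{k+2}` acting by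
translation of the last component. -/
noncomputable def normalBundle (V : Type*) [NormedAddCommGroup V] [NormedSpace ℝ V] (k : ℕ) :
    BundleData (SymAmb V (k + 1)) (SymAmb V k) (normalSpace V (k + 2)) where
  proj := truncSym V k
  total := normalSum V (k + 1)
  base := normalSum V k
  dir := (topSym V k).comp (normalSpace V (k + 2)).subtypeL

/-! ## The three maps -/

/-- The polynomial metric `⟨·,·⟩ + ∑ h_ℓ`. -/
noncomputable def metricOf (gg : BForm V) {N : ℕ} (h : SymAmb V N) (ξ : V) : BForm V :=
  gg + ∑ i : Fin N, h i (fun _ => ξ)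

/-- The map `R`: the curvature jet at the origin of the metric `⟨·,·⟩ + ∑ h_ℓ`. -/
noncomputable def mapR [FiniteDimensional ℝ V] (gg : BForm V) (N : ℕ) (h : SymAmb V N) :
    JetAmb V N :=
  fun i => nablaCurv (metricOf gg h) i 0

/-- Polarization: if `p` is a homogeneous polynomial of degree `n`, this is the symmetric `n`-linear
map `H` with `H(ξ, …, ξ) = p(ξ)`. -/
noncomputable def polarize {G : Type*} [NormedAddCommGroup G] [NormedSpace ℝ G] (n : ℕ)
    (p : V → G) : V [×n]→L[ℝ] G :=
  ((n.factorial : ℝ)⁻¹) • iteratedFDeriv ℝ n p 0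

theorem polarize_diag {G : Type*} [NormedAddCommGroup G] [NormedSpace ℝ G] {n : ℕ}
    (H : V [×n]→L[ℝ] G) (ξ : V) :
    polarize n (fun η => H (fun _ => η)) (fun _ => ξ) = H (fun _ => ξ) := by
  rw [polarize, smul_apply,
    ContinuousMultilinearMap.iteratedFDeriv_comp_diagonal]
  simp only [Finset.sum_const, Finset.card_univ, Fintype.card_perm, Fintype.card_fin]
  rw [← Nat.cast_smul_eq_nsmul ℝ, smul_smul, inv_mul_cancel₀, one_smul]
  exact_mod_cast n.factorial_ne_zero

/-- The bilinear form `(x, y) ↦ T(ξ, …, ξ, x, ξ, ξ, y)`. -/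
noncomputable def jacobiForm {i : ℕ} (T : Tensor V (i + 4)) (ξ : V) : BForm V :=
  ((T.domDomCongr (Equiv.swap (Fin.natAdd i 0) (Fin.natAdd i 2)) :
    Tensor V (i + 4)).curryRight).curryRight (fun _ => ξ)

theorem jacobiForm_apply {i : ℕ} (T : Tensor V (i + 4)) (ξ x y : V) :
    jacobiForm T ξ x y = T (Fin.append (fun _ => ξ) ![x, ξ, ξ, y]) := by
  change T (fun j => (Fin.snoc (Fin.snoc (fun _ => ξ) x : Fin (i + 3) → V) y : Fin (i + 4) → V)
    (Equiv.swap (Fin.natAdd i 0) (Fin.natAdd i 2) j)) = _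
  have e : (Fin.snoc (Fin.snoc (fun _ => ξ) x : Fin (i + 3) → V) y : Fin (i + 4) → V)
      = Fin.append (fun _ : Fin i => ξ) ![ξ, ξ, x, y] := by
    funext j
    refine Fin.addCases (m := i) (n := 4) (fun j => ?_) (fun j => ?_) j
    · rw [Fin.append_left]
      have h1 : (Fin.castAdd 4 j : Fin (i + 4)) = (Fin.castAdd 2 j : Fin (i + 2)).castSucc.castSucc :=
        rfl
      rw [h1, Fin.snoc_castSucc (α := fun _ => V), Fin.snoc_castSucc (α := fun _ => V)]
    · rw [Fin.append_right]
      match j with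
      | 0 | 1 | 2 | 3 => simp [Fin.snoc]
  rw [e]
  congr 1
  funext j
  refine Fin.addCases (m := i) (n := 4) (fun j => ?_) (fun j => ?_) j
  · rw [Equiv.swap_apply_of_ne_of_ne, Fin.append_left, Fin.append_left]
    · intro h
      have := congrArg Fin.val h
      have := j.isLt
      simp at *
      omega
    · intro h
      have := congrArg Fin.val h
      have := j.isLt
      simp at *
      omega
  · rw [Fin.append_right]
    match j with
    | 0 => rw [Equiv.swap_apply_left, Fin.append_right]; rfl
    | 2 => rw [Equiv.swap_apply_right, Fin.append_right]; rfl
    | 1 | 3 =>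
      rw [Equiv.swap_apply_of_ne_of_ne, Fin.append_right]
      · rfl
      · simp [Fin.ext_iff]
      · simp [Fin.ext_iff]

/-- The map `𝓡`: the symmetrized curvature jet, with components obtained by polarization from
`𝓡^{i)}(ξ; x, y) = ∇^{i)}_{ξ,…,ξ} R(x, ξ, ξ, y)`. -/
noncomputable def mapSym (N : ℕ) (J : JetAmb V N) : SymAmb V N :=
  fun i => polarize (i + 2) (jacobiForm (J i))

/-- The tensorial expressions `Q̃_k` in the free associative algebra in `X₂, X₃, …`; the generator
`X_{j+2}` is `FreeAlgebra.ι ℝ j`. They are given by `Q̃₀ = 1` and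
`Q̃_k = - 1/(k(k+1)) ∑_{ℓ=2}^k (k choose ℓ) (ℓ-1) ℓ X_ℓ Q̃_{k-ℓ}`; here `ℓ = j + 2`. -/
noncomputable def Qtilde : ℕ → FreeAlgebra ℝ ℕ
  | 0 => 1
  | k + 1 => (-1 / (((k : ℝ) + 1) * ((k : ℝ) + 2))) • ∑ j : Fin k,
      ((((k + 1).choose (j + 2) : ℝ)) * ((j : ℝ) + 1) * ((j : ℝ) + 2)) •
        (FreeAlgebra.ι ℝ (j : ℕ) * Qtilde (k + 1 - (j + 2)))
  termination_by k => k
  decreasing_by omega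

/-- `Q_k = ∑_{ℓ=0}^k (k choose ℓ) Q̃_ℓ* Q̃_{k-ℓ}`, where `*` is the anti-automorphism of the free
algebra that fixes the generators. -/
noncomputable def Qpoly (k : ℕ) : FreeAlgebra ℝ ℕ :=
  ∑ l ∈ Finset.range (k + 1), (k.choose l : ℝ) • (star (Qtilde l) * Qtilde (k - l))

/-- The endomorphism `𝓡^{j)}(ξ)` with `⟨𝓡^{j)}(ξ) x, y⟩ = 𝓡^{j)}(ξ; x, y)` (zero if the sequence
has no component of index `j`). -/
noncomputable def endOf (gg : BForm V) {N : ℕ} (H : SymAmb V N) (ξ : V) (j : ℕ) : V →L[ℝ] V :=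
  if h : j < N then (ContinuousLinearMap.inverse gg).comp (H ⟨j, h⟩ (fun _ => ξ)) else 0

/-- The homogeneous polynomial `Q_l(𝓡^{0)}, 𝓡^{1)}, …)(ξ)` with values in bilinear forms. -/
noncomputable def evalQ (gg : BForm V) {N : ℕ} (H : SymAmb V N) (l : ℕ) (ξ : V) : BForm V :=
  gg.comp (FreeAlgebra.lift ℝ (endOf gg H ξ) (Qpoly l))

/-- The map `Q`, with components the (polarized) homogeneous summands of
`∑_ℓ 1/ℓ! Q_ℓ(𝓡^{0)}, 𝓡^{1)}, …)` of the degrees `ℓ = 2, …, N + 1`. -/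
noncomputable def mapQ (gg : BForm V) (N : ℕ) (H : SymAmb V N) : SymAmb V N :=
  fun i => (((i + 2 : ℕ).factorial : ℝ)⁻¹) • polarize (i + 2) (evalQ gg H (i + 2))

/-! ## The orthogonal group -/

/-- `A` is an element of the full orthogonal group of the inner product `gg` (and so in particular
every element of its subgroup `SO(V, gg)` satisfies this). -/
def IsOrthogonal (gg : BForm V) (A : V ≃L[ℝ] V) : Prop :=
  ∀ x y, gg (A x) (A y) = gg x y

/-- The natural action on sequences of tensors, `(A · T)(v₁, …, vₙ) = T(A⁻¹ v₁, …, A⁻¹ vₙ)`. -/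
noncomputable def actJet (A : V ≃L[ℝ] V) {N : ℕ} (J : JetAmb V N) : JetAmb V N :=
  fun i => (J i).compContinuousLinearMap fun _ => (A.symm : V →L[ℝ] V)

/-- The natural action `(A · h)(ξ; x, y) = h(A⁻¹ ξ; A⁻¹ x, A⁻¹ y)`. -/
noncomputable def actSym (A : V ≃L[ℝ] V) {N : ℕ} (h : SymAmb V N) : SymAmb V N :=
  fun i => ((A.arrowCongr (A.arrowCongr (ContinuousLinearEquiv.refl ℝ ℝ)) :
      BForm V ≃L[ℝ] BForm V) : BForm V →L[ℝ] BForm V).compContinuousMultilinearMap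
    ((h i).compContinuousLinearMap fun _ => (A.symm : V →L[ℝ] V))

theorem actSym_apply (A : V ≃L[ℝ] V) {N : ℕ} (h : SymAmb V N) (i : Fin N)
    (v : Fin (i + 2) → V) (x y : V) :
    actSym A h i v x y = h i (fun j => A.symm (v j)) (A.symm x) (A.symm y) := rfl

end JetIso

open JetIso

/-! Everything rests on three facts: `Q ∘ 𝓡 ∘ R = Id` (`mapQ_mapSym_mapR`), `Q` is injective on the
sum of the `𝒩_ℓ` (`mapQ_injOn`), and `𝓡` is injective on curvature jets (`mapSym_injOn`). By the
first two, `𝓡 ∘ R ∘ Q = Id`, because `Q` takes the same value on both sides; by the third, `R ∘ Q ∘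
𝓡 = Id` in the same way. So each map is a bijection whose inverse is the composition of the other
two. All of them are restrictions of analytic maps of the ambient spaces, hence they are
diffeomorphisms, and the set of jets is a submanifold, diffeomorphic to a vector space. A jet is
extended by appending zero to its symmetrization and transporting the result back by `R ∘ Q`.

`R` takes values in curvature jets (`IsMetricOn.isCurvJet`): the classical identities for `R`, `∇R`
and commuted second derivatives hold at every point near the origin, and they may be differentiated
covariantly any number of times.

`Q ∘ 𝓡 ∘ R = Id`: the condition defining `𝒩_ℓ` gives `g_ξ(ξ, ·) = ⟨ξ, ·⟩`. Hence the rays `tξ` are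
geodesics and `J_x(t) = t x` is a Jacobi field along them, so that `t² g_{tξ}(x, y) = g(J_x, J_y)`.
The equation `J'' = -R(J, ξ)ξ` determines the covariant derivatives of `J_x` at `t = 0` recursively,
and the recursion is that of `Q̃`: the derivative of order `m + 1` is `(m + 1) Q̃_m x`. Comparing
Taylor coefficients of order `ℓ + 2` gives `h_ℓ = Q_ℓ / ℓ!`.

`Q` is triangular: the generator of highest degree enters `Q_{k+2}` linearly and with a non-zero
factor. For `𝓡`, two jets with the same truncation differ by an element `T` of `𝒞_k`, since the
right-hand side of a Ricci identity involves lower orders only. The derivative slots of `T` commute,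
and polarization together with the Bianchi identities recovers `T` from `T(ξ, …, ξ; x, ξ, ξ, y)`.

On fibres, `Q` and `𝓡` are computed directly. Compatibility of `R` with truncation, its affineness
on fibres and its equivariance are not obtained by differentiating metrics, but by inverting `Q ∘
𝓡`. -/

namespace JetIso

/-! ## Smooth dependence on parameters -/

section Parameters

variable {V : Type*} [NormedAddCommGroup V] [NormedSpace ℝ V] [FiniteDimensional ℝ V]
  {E G : Type*} [NormedAddCommGroup E] [NormedSpace ℝ E] [NormedAddCommGroup G] [NormedSpace ℝ G]

/-- A basis of `V` identifies `V →L[ℝ] G` with a finite power of `G`, the coordinates being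
evaluations at the basis vectors. This and the tensor version below reduce regularity of all tensor
fields to that of their values. -/
theorem contDiffAt_clm_of_apply {f : E → V →L[ℝ] G} {x : E} {n : ℕ∞ω}
    (h : ∀ v, ContDiffAt ℝ n (fun e => f e v) x) : ContDiffAt ℝ n f x := by
  let d := Module.finrank ℝ V
  have hd : d = Module.finrank ℝ (Fin d → ℝ) := (Module.finrank_fin_fun ℝ).symm
  let e₁ := ContinuousLinearEquiv.ofFinrankEq hd
  let e₂ := (e₁.arrowCongr (1 : G ≃L[ℝ] G)).trans (ContinuousLinearEquiv.piRing (Fin d))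
  have : f = fun y => e₂.symm (e₂ (f y)) := by
    funext y; simp
  rw [this]
  exact e₂.symm.contDiff.contDiffAt.comp x (contDiffAt_pi.mpr fun i => h _)

theorem contDiffAt_tensor_of_apply {n : ℕ} {f : E → V [×n]→L[ℝ] G} {x : E} {m : ℕ∞ω}
    (h : ∀ v, ContDiffAt ℝ m (fun e => f e v) x) : ContDiffAt ℝ m f x := by
  induction n with
  | zero =>
    let e := continuousMultilinearCurryFin0 ℝ V G
    have : f = fun y => e.symm (f y ![]) := by
      funext y; ext v
      simp [e, Subsingleton.elim v ![]]
    rw [this]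
    exact e.symm.contDiff.contDiffAt.comp x (h ![])
  | succ n ih =>
    let e := continuousMultilinearCurryLeftEquiv ℝ (fun _ : Fin (n + 1) => V) G
    have : f = fun y => e.symm (e (f y)) := by
      funext y; simp
    rw [this]
    refine e.symm.contDiff.contDiffAt.comp x (contDiffAt_clm_of_apply fun v => ih fun w => ?_)
    exact h (Fin.cons v w)

omit [FiniteDimensional ℝ V] in
theorem contDiffAt_multilinear_apply {n : ℕ} {f : E → V [×n]→L[ℝ] G} {w : Fin n → E → V} {x : E}
    {m : ℕ∞ω} (hf : ContDiffAt ℝ m f x) (hw : ∀ i, ContDiffAt ℝ m (w i) x) :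
    ContDiffAt ℝ m (fun e => f e fun i => w i e) x := by
  let F := (ContinuousLinearMap.id ℝ (V [×n]→L[ℝ] G)).continuousMultilinearMapOption
  exact F.contDiff.contDiffAt.comp (f := fun e _ => (f e, fun i => w i e)) x
    (contDiffAt_pi.mpr fun _ => hf.prodMk (contDiffAt_pi.mpr hw))

theorem contDiffAt_inverse {f : E → BForm V} {x : E} {n : ℕ∞ω} (hf : ContDiffAt ℝ n f x)
    (hx : (f x).IsInvertible) :
    ContDiffAt ℝ n (fun e => ContinuousLinearMap.inverse (f e)) x := by
  have : CompleteSpace V := FiniteDimensional.complete ℝ V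
  obtain ⟨e, he⟩ := hx
  have := contDiffAt_map_inverse (𝕜 := ℝ) (n := n) e
  rw [he] at this
  exact this.comp x hf

variable {P : Type*} [NormedAddCommGroup P] [NormedSpace ℝ P]

omit [FiniteDimensional ℝ V] in
-- The regularity class `ω` is stable under differentiation, so no orders have to be counted when
-- derivatives are iterated.
theorem contDiffAt_partial_fderiv {T : P → V → G} {q : P × V}
    (h : ContDiffAt ℝ ω (fun q : P × V => T q.1 q.2) q) :
    ContDiffAt ℝ ω (fun q : P × V => fderiv ℝ (T q.1) q.2) q := by
  refine ContDiffAt.fderiv (n := ω) (f := fun q : P × V => T q.1) ?_ contDiffAt_snd (by simp)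
  exact h.comp (f := fun r : (P × V) × V => (r.1.1, r.2)) (q, q.2)
    ((contDiffAt_fst.fst).prodMk contDiffAt_snd)

variable {g : P → V → BForm V} {q : P × V}

theorem contDiffAt_koszul_param (h : ContDiffAt ℝ ω (fun q : P × V => g q.1 q.2) q) :
    ContDiffAt ℝ ω (fun q : P × V => koszul (g q.1) q.2) q := by
  refine contDiffAt_clm_of_apply fun x => contDiffAt_clm_of_apply fun y =>
    contDiffAt_clm_of_apply fun z => ?_
  simp only [koszul_apply]
  have := contDiffAt_partial_fderiv h
  fun_prop

theorem contDiffAt_christoffel_param (h : ContDiffAt ℝ ω (fun q : P × V => g q.1 q.2) q)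
    (hq : (g q.1 q.2).IsInvertible) :
    ContDiffAt ℝ ω (fun q : P × V => christoffel (g q.1) q.2) q := by
  refine contDiffAt_clm_of_apply fun x => contDiffAt_clm_of_apply fun y => ?_
  simp only [christoffel_apply]
  have h1 := contDiffAt_koszul_param h
  have h2 := contDiffAt_inverse h hq
  fun_prop

theorem contDiffAt_curvTensor_param (h : ContDiffAt ℝ ω (fun q : P × V => g q.1 q.2) q)
    (hq : (g q.1 q.2).IsInvertible) :
    ContDiffAt ℝ ω (fun q : P × V => curvTensor (g q.1) q.2) q := by
  refine contDiffAt_tensor_of_apply fun v => ?_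
  change ContDiffAt ℝ ω (fun q : P × V => g q.1 q.2 (curvEnd (g q.1) q.2 (v 0) (v 1) (v 2)) (v 3)) q
  unfold curvEnd
  have h1 := contDiffAt_christoffel_param h hq
  have h2 := contDiffAt_partial_fderiv (T := fun p => christoffel (g p)) h1
  fun_prop

theorem contDiffAt_covDeriv_param {n : ℕ} {T : P → V → Tensor V n}
    (h : ContDiffAt ℝ ω (fun q : P × V => g q.1 q.2) q) (hq : (g q.1 q.2).IsInvertible)
    (hT : ContDiffAt ℝ ω (fun q : P × V => T q.1 q.2) q) :
    ContDiffAt ℝ ω (fun q : P × V => covDeriv (g q.1) (T q.1) q.2) q := by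
  refine contDiffAt_tensor_of_apply fun v => ?_
  simp only [covDeriv_apply, derivAct_apply]
  have h1 := contDiffAt_christoffel_param h hq
  have h2 := contDiffAt_partial_fderiv hT
  refine ContDiffAt.add ?_ (ContDiffAt.neg (ContDiffAt.sum fun j _ => ?_))
  · have : ContDiffAt ℝ ω (fun q : P × V => fderiv ℝ (T q.1) q.2 (v 0)) q := by fun_prop
    exact (ContinuousMultilinearMap.apply ℝ (fun _ : Fin n => V) ℝ
      (Fin.tail v)).contDiff.contDiffAt.comp q this
  · refine contDiffAt_multilinear_apply hT fun i => ?_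
    by_cases hij : i = j
    · subst hij
      simp only [Function.update_self]
      fun_prop
    · simp only [Function.update_of_ne hij]
      fun_prop

/-- Joint regularity in metric and point serves twice: with the coefficients of the metric as
parameter it gives smoothness of `R`, and with a dummy parameter it gives regularity of the
curvature of a fixed metric. -/
theorem contDiffAt_nablaCurv_param (h : ContDiffAt ℝ ω (fun q : P × V => g q.1 q.2) q)
    (hq : (g q.1 q.2).IsInvertible) (i : ℕ) :
    ContDiffAt ℝ ω (fun q : P × V => nablaCurv (g q.1) i q.2) q := by
  induction i with
  | zero => exact contDiffAt_curvTensor_param h hq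
  | succ i ih => exact contDiffAt_covDeriv_param (T := fun p => nablaCurv (g p) i) h hq ih

end Parameters

/-! ## Covariant differentiation along curves -/

section Prefix

variable {V : Type*} [NormedAddCommGroup V] [NormedSpace ℝ V]

/-- Orders such as `s + 2 + m` and `m + B.length` agree only propositionally. Comparing the argument
tuples as lists avoids every cast. -/
theorem tensor_congr (T : (i : ℕ) → Tensor V (i + 4)) {a b : ℕ} {u : Fin (a + 4) → V}
    {v : Fin (b + 4) → V} (h : List.ofFn u = List.ofFn v) : T a u = T b v := by
  have hab : a = b := by
    have := congrArg List.length h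
    simpa using this
  subst hab
  rw [List.ofFn_injective h]

/-- The argument tuple `(f x₁, …, f xₛ, q₁, …, q_{m+4})` for a list `x₁, …, xₛ`. -/
def prefixArgs {X : Type*} {m : ℕ} (f : X → V) : (B : List X) → (q : Fin (m + 4) → V) →
    Fin (m + B.length + 4) → V
  | [], q => q
  | x :: B, q => Fin.cons (α := fun _ => V) (f x) (prefixArgs f B q)

theorem ofFn_prefixArgs {X : Type*} {m : ℕ} (f : X → V) (B : List X) (q : Fin (m + 4) → V) :
    List.ofFn (prefixArgs f B q) = B.map f ++ List.ofFn q := by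
  induction B with
  | nil => rfl
  | cons x B ih =>
    change List.ofFn (Fin.cons (α := fun _ => V) (f x) (prefixArgs f B q)) = _
    rw [List.ofFn_cons, ih]
    rfl

/-- In a Leibniz sum, slots filled with parallel fields contribute nothing; only the last `m + 4`
slots remain. -/
theorem sum_update_prefixArgs {X : Type*} {m : ℕ} {B : List X} (T : Tensor V (m + B.length + 4))
    (f e : X → V) (q d : Fin (m + 4) → V) (he : ∀ x ∈ B, e x = 0) :
    ∑ i, T (Function.update (prefixArgs f B q) i (prefixArgs e B d i))
      = ∑ j, T (prefixArgs f B (Function.update q j (d j))) := by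
  induction B with
  | nil => rfl
  | cons x B ih =>
    have h0 : e x = 0 := he x (by simp)
    have key := ih (ContinuousMultilinearMap.curryLeft T (f x)) fun y hy => he y (by simp [hy])
    refine (Fin.sum_univ_succ (n := m + B.length + 4) _).trans ?_
    have h1 : T (Function.update (prefixArgs f (x :: B) q) (0 : Fin (m + B.length + 4 + 1))
        (prefixArgs e (x :: B) d (0 : Fin (m + B.length + 4 + 1)))) = 0 :=
      ContinuousMultilinearMap.map_coord_zero _ (0 : Fin (m + B.length + 4 + 1))
        (by rw [Function.update_self]; exact h0)
    rw [h1, zero_add]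
    refine Eq.trans (Finset.sum_congr rfl fun i _ => ?_) key
    refine congrArg (T : (Fin (m + B.length + 4 + 1) → V) → ℝ) ?_
    exact (Fin.cons_update (α := fun _ => V) (f x) (prefixArgs f B q) i (prefixArgs e B d i)).symm

theorem hasDerivAt_prefixArgs {X : Type*} {m : ℕ} {B : List X} {f : X → ℝ → V} {f' : X → V}
    {q : Fin (m + 4) → ℝ → V} {q' : Fin (m + 4) → V} {t : ℝ}
    (hf : ∀ x ∈ B, HasDerivAt (f x) (f' x) t) (hq : ∀ j, HasDerivAt (q j) (q' j) t)
    (i : Fin (m + B.length + 4)) :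
    HasDerivAt (fun s => prefixArgs (fun x => f x s) B (fun j => q j s) i)
      (prefixArgs f' B q' i) t := by
  induction B with
  | nil => exact hq i
  | cons x B ih =>
    refine Fin.cases (n := m + B.length + 4) ?_ (fun i => ?_) i
    · exact hf x (by simp)
    · exact ih (fun y hy => hf y (by simp [hy])) i

theorem prefixArgs_update {X : Type*} {m : ℕ} (f : X → V) (B : List X) (q : Fin (m + 4) → V)
    (j : Fin (m + 4)) : ∃ i, ∀ w, prefixArgs f B (Function.update q j w)
      = Function.update (prefixArgs f B q) i w := by
  induction B with
  | nil => exact ⟨j, fun _ => rfl⟩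
  | cons x B ih =>
    obtain ⟨i, hi⟩ := ih
    refine ⟨Fin.succ (n := m + B.length + 4) i, fun w => ?_⟩
    change Fin.cons (α := fun _ => V) (f x) (prefixArgs f B (Function.update q j w)) = _
    rw [hi]
    exact Fin.cons_update (α := fun _ => V) (f x) (prefixArgs f B q) i w

theorem prefixArgs_map_add {X : Type*} {m : ℕ} (A : V →L[ℝ] V) (f f' : X → V) (B : List X)
    (q q' : Fin (m + 4) → V) (i : Fin (m + B.length + 4)) :
    prefixArgs f' B q' i + A (prefixArgs f B q i)
      = prefixArgs (fun x => f' x + A (f x)) B (fun j => q' j + A (q j)) i := by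
  induction B with
  | nil => rfl
  | cons x B ih =>
    refine Fin.cases (n := m + B.length + 4) ?_ (fun i => ?_) i
    · rfl
    · exact ih i

end Prefix

/-- A smooth field of symmetric non-degenerate bilinear forms, the non-degeneracy being required
on an open set `U`. -/
structure IsMetricOn {V : Type*} [NormedAddCommGroup V] [NormedSpace ℝ V] (g : V → BForm V)
    (U : Set V) : Prop where
  isOpen : IsOpen U
  smooth : ∀ ξ ∈ U, ContDiffAt ℝ ω g ξ
  symm : ∀ ξ x y, g ξ x y = g ξ y x
  inv : ∀ ξ ∈ U, (g ξ).IsInvertible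

section Calculus

variable {V : Type*} [NormedAddCommGroup V] [NormedSpace ℝ V] [FiniteDimensional ℝ V]
  {g : V → BForm V} {U : Set V} {ξ : V}

theorem IsMetricOn.contDiffAt_nablaCurv (hg : IsMetricOn g U) (hξ : ξ ∈ U) (i : ℕ) :
    ContDiffAt ℝ ω (nablaCurv g i) ξ := by
  have := contDiffAt_nablaCurv_param (P := ℝ) (g := fun _ => g) (q := (0, ξ))
    ((hg.smooth ξ hξ).comp (0, ξ) contDiffAt_snd) (hg.inv ξ hξ) i
  exact this.comp (f := fun ξ => ((0 : ℝ), ξ)) ξ (contDiffAt_const.prodMk contDiffAt_id)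

theorem IsMetricOn.contDiffAt_christoffel (hg : IsMetricOn g U) (hξ : ξ ∈ U) :
    ContDiffAt ℝ ω (christoffel g) ξ := by
  have := contDiffAt_christoffel_param (P := ℝ) (g := fun _ => g) (q := (0, ξ))
    ((hg.smooth ξ hξ).comp (0, ξ) contDiffAt_snd) (hg.inv ξ hξ)
  exact this.comp (f := fun ξ => ((0 : ℝ), ξ)) ξ (contDiffAt_const.prodMk contDiffAt_id)

omit [FiniteDimensional ℝ V] in
theorem IsMetricOn.differentiableAt (hg : IsMetricOn g U) (hξ : ξ ∈ U) : DifferentiableAt ℝ g ξ :=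
  (hg.smooth ξ hξ).differentiableAt (by simp)

omit [FiniteDimensional ℝ V] in
theorem IsMetricOn.ext (hg : IsMetricOn g U) (hξ : ξ ∈ U) {x y : V}
    (h : ∀ v, g ξ x v = g ξ y v) : x = y :=
  (hg.inv ξ hξ).injective (ContinuousLinearMap.ext h)

theorem IsMetricOn.fderiv_symm (hg : IsMetricOn g U) (hξ : ξ ∈ U) (x y z : V) :
    fderiv ℝ g ξ x y z = fderiv ℝ g ξ x z y := by
  have h1 : ∀ y z, HasFDerivAt (fun η => g η y z)
      (((fderiv ℝ g ξ).flip y).flip z) ξ := fun y z => by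
    have := ((hg.differentiableAt hξ).hasFDerivAt.clm_apply (hasFDerivAt_const y ξ)).clm_apply
      (hasFDerivAt_const z ξ)
    exact this.congr_fderiv (by ext; simp)
  have h2 := (h1 y z).unique (by simpa only [hg.symm _ y z] using h1 z y)
  simpa using congrArg (fun f : V →L[ℝ] ℝ => f x) h2

omit [FiniteDimensional ℝ V] in
theorem IsMetricOn.christoffel_spec (hg : IsMetricOn g U) (hξ : ξ ∈ U) (x y z : V) :
    g ξ (christoffel g ξ x y) z = koszul g ξ x y z := by
  rw [christoffel_apply, (hg.inv ξ hξ).self_apply_inverse]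

theorem IsMetricOn.christoffel_comm (hg : IsMetricOn g U) (hξ : ξ ∈ U) (x y : V) :
    christoffel g ξ x y = christoffel g ξ y x := by
  refine hg.ext hξ fun z => ?_
  rw [hg.christoffel_spec hξ, hg.christoffel_spec hξ, koszul_apply, koszul_apply,
    hg.fderiv_symm hξ z x y]
  ring

/-- This is `∇g = 0`, the source of the product rule for inner products of fields along curves. -/
theorem IsMetricOn.fderiv_eq (hg : IsMetricOn g U) (hξ : ξ ∈ U) (x y z : V) :
    fderiv ℝ g ξ x y z = g ξ (christoffel g ξ x y) z + g ξ y (christoffel g ξ x z) := by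
  rw [hg.symm ξ y, hg.christoffel_spec hξ, hg.christoffel_spec hξ, koszul_apply, koszul_apply,
    hg.fderiv_symm hξ x z y, hg.fderiv_symm hξ z x y]
  rw [hg.fderiv_symm hξ z y x, hg.fderiv_symm hξ y x z]
  ring

theorem IsMetricOn.hasDerivAt_inner (hg : IsMetricOn g U) {c Y Z : ℝ → V} {x Y' Z' : V} {t : ℝ}
    (hc : c t ∈ U) (hx : HasDerivAt c x t) (hY : HasDerivAt Y Y' t) (hZ : HasDerivAt Z Z' t) :
    HasDerivAt (fun s => g (c s) (Y s) (Z s))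
      (g (c t) (Y' + christoffel g (c t) x (Y t)) (Z t)
        + g (c t) (Y t) (Z' + christoffel g (c t) x (Z t))) t := by
  have h := (((hg.differentiableAt hc).hasFDerivAt.comp_hasDerivAt t hx).clm_apply hY).clm_apply hZ
  refine h.congr_deriv ?_
  simp only [map_add, add_apply, hg.fderiv_eq hc, Function.comp]
  ring

/-- The expressions `W' + Γ(x, W)` are the covariant derivatives of the argument fields along the
curve. The Christoffel terms added there cancel those inside `covDeriv`. -/
theorem hasDerivAt_tensor_apply {n : ℕ} {T : V → Tensor V n} {c : ℝ → V} {W : Fin n → ℝ → V}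
    {x : V} {W' : Fin n → V} {t : ℝ} (hT : DifferentiableAt ℝ T (c t)) (hx : HasDerivAt c x t)
    (hW : ∀ i, HasDerivAt (W i) (W' i) t) :
    HasDerivAt (fun s => T (c s) fun i => W i s)
      (covDeriv g T (c t) (Fin.cons x fun i => W i t)
        + ∑ i, T (c t) (Function.update (fun i => W i t) i
            (W' i + christoffel g (c t) x (W i t)))) t := by
  have h := (HasFDerivAt.continuousMultilinearMap_apply
    (hT.hasFDerivAt.comp_hasDerivAt t hx).hasFDerivAt
    (fun i => (hW i).hasFDerivAt)).hasDerivAt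
  refine h.congr_deriv ?_
  simp only [covDeriv_apply, derivAct_apply, Fin.cons_zero, Fin.tail_cons,
    ContinuousMultilinearMap.map_update_add, Finset.sum_add_distrib]
  simp [ContinuousMultilinearMap.toContinuousLinearMap]
  ring

theorem differentiableAt_clm_of_apply {α : ℝ → V →L[ℝ] ℝ} {t : ℝ}
    (h : ∀ v, DifferentiableAt ℝ (fun s => α s v) t) : DifferentiableAt ℝ α t := by
  let d := Module.finrank ℝ V
  have hd : d = Module.finrank ℝ (Fin d → ℝ) := (Module.finrank_fin_fun ℝ).symm
  let e₁ := ContinuousLinearEquiv.ofFinrankEq hd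
  let e₂ := (e₁.arrowCongr (1 : ℝ ≃L[ℝ] ℝ)).trans (ContinuousLinearEquiv.piRing (Fin d))
  have : α = fun y => e₂.symm (e₂ (α y)) := by
    funext y; simp
  rw [this]
  exact e₂.symm.differentiableAt.comp t (differentiableAt_pi.mpr fun i => h _)

/-- Raising an index commutes with covariant differentiation along a curve. -/
theorem IsMetricOn.hasDerivAt_inverse (hg : IsMetricOn g U) {c : ℝ → V} {x : V} {t : ℝ}
    {α : ℝ → V →L[ℝ] ℝ} {u : V} (hc : c t ∈ U) (hx : HasDerivAt c x t)
    (h : ∀ (Y : ℝ → V) (Y' : V), HasDerivAt Y Y' t → HasDerivAt (fun s => α s (Y s))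
      (g (c t) u (Y t) + α t (Y' + christoffel g (c t) x (Y t))) t) :
    HasDerivAt (fun s => ContinuousLinearMap.inverse (g (c s)) (α s))
      (u - christoffel g (c t) x (ContinuousLinearMap.inverse (g (c t)) (α t))) t := by
  have hα : DifferentiableAt ℝ α t := differentiableAt_clm_of_apply fun v =>
    (h (fun _ => v) 0 (hasDerivAt_const t v)).differentiableAt
  have h1 : DifferentiableAt ℝ (fun s => ContinuousLinearMap.inverse (g (c s))) t :=
    ((contDiffAt_inverse (hg.smooth _ hc) (hg.inv _ hc)).differentiableAt (by simp)).comp t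
      hx.differentiableAt
  have h2 := (h1.clm_apply hα).hasDerivAt
  set D := deriv (fun s => ContinuousLinearMap.inverse (g (c s)) (α s)) t with hD
  have h3 : D = u - christoffel g (c t) x (ContinuousLinearMap.inverse (g (c t)) (α t)) := by
    rw [eq_sub_iff_add_eq]
    refine hg.ext hc fun v => ?_
    -- A test field with value `v` and vanishing covariant derivative at `t`, so that only the
    -- derivative of the other factor survives in both product rules.
    let Y : ℝ → V := fun s => v - (s - t) • christoffel g (c t) x v
    have hY : HasDerivAt Y (-christoffel g (c t) x v) t := by
      have := (((hasDerivAt_id t).sub_const t).smul_const (christoffel g (c t) x v)).const_sub v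
      simpa using this
    have hYt : Y t = v := by simp [Y]
    have e1 := hg.hasDerivAt_inner hc hx h2 hY
    have e2 := h Y _ hY
    have hev : (fun s => α s (Y s)) =ᶠ[𝓝 t]
        fun s => g (c s) (ContinuousLinearMap.inverse (g (c s)) (α s)) (Y s) := by
      filter_upwards [hx.continuousAt.preimage_mem_nhds (hg.isOpen.mem_nhds hc)] with s hs
      rw [(hg.inv _ hs).self_apply_inverse]
    have e3 := (e1.congr_of_eventuallyEq hev).unique e2
    rw [hYt] at e3
    simpa using e3
  rw [← h3]
  exact h2

/-- The value `∇^{m+s)}_{x₁,…,xₛ} R (q)` at the point `ξ`, for a list `x₁, …, xₛ`. -/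
noncomputable def nablaList (g : V → BForm V) (ξ : V) {m : ℕ} (B : List V) (q : Fin (m + 4) → V) :
    ℝ :=
  nablaCurv g (m + B.length) ξ (prefixArgs id B q)

theorem nablaCurv_eq_nablaList {m i : ℕ} (B : List V) (q : Fin (m + 4) → V)
    {u : Fin (i + 4) → V} (h : List.ofFn u = B ++ List.ofFn q) :
    nablaCurv g i ξ u = nablaList g ξ B q :=
  tensor_congr (fun i => nablaCurv g i ξ) (by rw [h, ofFn_prefixArgs, List.map_id])

theorem nablaList_update_zero {m : ℕ} (B : List V) (q : Fin (m + 4) → V) (j : Fin (m + 4)) :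
    nablaList g ξ B (Function.update q j 0) = 0 := by
  obtain ⟨i, hi⟩ := prefixArgs_update id B q j
  rw [nablaList, hi]
  exact ContinuousMultilinearMap.map_coord_zero _ i (by simp)

theorem nablaList_map {X : Type*} {m : ℕ} (f : X → V) (B : List X) (q : Fin (m + 4) → V) :
    nablaList g ξ (B.map f) q = nablaCurv g (m + B.length) ξ (prefixArgs f B q) :=
  (nablaCurv_eq_nablaList _ _ (ofFn_prefixArgs f B q)).symm

/-- The derivative of `∇^{m+s)}_{x₁,…,xₛ} R (q)` along a curve if the fields `xᵢ` are parallel. -/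
theorem IsMetricOn.hasDerivAt_nablaList (hg : IsMetricOn g U) {c : ℝ → V} {x : V} {t : ℝ}
    (hc : c t ∈ U) (hx : HasDerivAt c x t) {X : Type*} {m : ℕ} {B : List X} {f : X → ℝ → V}
    {q : Fin (m + 4) → ℝ → V} {q' : Fin (m + 4) → V}
    (hf : ∀ y ∈ B, HasDerivAt (f y) (-christoffel g (c t) x (f y t)) t)
    (hq : ∀ j, HasDerivAt (q j) (q' j) t) :
    HasDerivAt (fun s => nablaList g (c s) (B.map fun y => f y s) fun j => q j s)
      (nablaList g (c t) (x :: B.map fun y => f y t) (fun j => q j t)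
        + ∑ j, nablaList g (c t) (B.map fun y => f y t) (Function.update (fun j => q j t) j
            (q' j + christoffel g (c t) x (q j t)))) t := by
  simp only [nablaList_map]
  have h := hasDerivAt_tensor_apply (g := g)
    ((hg.contDiffAt_nablaCurv hc (m + B.length)).differentiableAt (by simp)) hx
    (hasDerivAt_prefixArgs hf hq)
  refine h.congr_deriv ?_
  congr 1
  · refine Eq.symm (nablaCurv_eq_nablaList (i := m + B.length + 1) _ _ ?_).symm
    refine (List.ofFn_cons (n := m + B.length + 4) _ _).trans ?_
    rw [ofFn_prefixArgs]
    rfl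
  · simp only [prefixArgs_map_add]
    rw [sum_update_prefixArgs]
    · intro y _
      simp

end Calculus

/-! ## The identities satisfied by the curvature tensor of a metric -/

section Curvature

variable {V : Type*} [NormedAddCommGroup V] [NormedSpace ℝ V] [FiniteDimensional ℝ V]
  {g : V → BForm V} {U : Set V} {ξ : V}

/-- Along the line `ξ + s x` the field with value `v` and vanishing covariant derivative
at `s = 0`. -/
noncomputable def parallelField (g : V → BForm V) (ξ x v : V) (s : ℝ) : V :=
  v - s • christoffel g ξ x v

omit [FiniteDimensional ℝ V] in
@[simp]
theorem parallelField_zero (x v : V) : parallelField g ξ x v 0 = v := by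
  simp [parallelField]

omit [FiniteDimensional ℝ V] in
theorem hasDerivAt_parallelField (x v : V) :
    HasDerivAt (parallelField g ξ x v) (-christoffel g ξ x v) 0 := by
  have h := ((hasDerivAt_id (0 : ℝ)).smul_const (christoffel g ξ x v)).const_sub v
  exact h.congr_deriv (by simp)

omit [FiniteDimensional ℝ V] in
theorem hasDerivAt_line (ξ x : V) : HasDerivAt (fun s : ℝ => ξ + s • x) x 0 := by
  simpa using ((hasDerivAt_id (0 : ℝ)).smul_const x).const_add ξ

theorem hasDerivAt_comp_line {G : Type*} [NormedAddCommGroup G] [NormedSpace ℝ G] {F : V → G}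
    (h : DifferentiableAt ℝ F ξ) (x : V) :
    HasDerivAt (fun s : ℝ => F (ξ + s • x)) (fderiv ℝ F ξ x) 0 := by
  have h1 : HasFDerivAt F (fderiv ℝ F ξ) (ξ + (0 : ℝ) • x) := by simpa using h.hasFDerivAt
  exact h1.comp_hasDerivAt (0 : ℝ) (hasDerivAt_line ξ x)

theorem IsMetricOn.eventually_line (hg : IsMetricOn g U) (hξ : ξ ∈ U) (x : V) :
    ∀ᶠ s : ℝ in 𝓝 0, ξ + s • x ∈ U :=
  (hasDerivAt_line ξ x).continuousAt.preimage_mem_nhds (hg.isOpen.mem_nhds (by simpa using hξ))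

/-- All arguments are extended with vanishing covariant derivative at `s = 0`, so covariant
differentiation becomes an ordinary derivative of a real function. This is what allows identities to
be differentiated covariantly. -/
theorem IsMetricOn.hasDerivAt_nablaList_line (hg : IsMetricOn g U) (hξ : ξ ∈ U) (x : V) {m : ℕ}
    (B : List V) (q : Fin (m + 4) → V) :
    HasDerivAt (fun s : ℝ => nablaList g (ξ + s • x) (B.map fun y => parallelField g ξ x y s)
      fun j => parallelField g ξ x (q j) s) (nablaList g ξ (x :: B) q) 0 := by
  have h := hg.hasDerivAt_nablaList (c := fun s : ℝ => ξ + s • x) (t := 0) (by simpa using hξ)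
    (hasDerivAt_line ξ x) (B := B) (f := parallelField g ξ x)
    (q := fun j => parallelField g ξ x (q j))
    (fun y _ => by simpa using hasDerivAt_parallelField x y)
    (fun j => hasDerivAt_parallelField x (q j))
  refine h.congr_deriv ?_
  simp only [zero_smul, add_zero, parallelField_zero, List.map_id', neg_add_cancel]
  rw [Finset.sum_eq_zero, add_zero]
  exact fun j _ => nablaList_update_zero B q j

/-- A linear identity between the components of `∇^{m)} R` that holds at all points remains valid
after covariant differentiation. -/
theorem IsMetricOn.nablaList_identity (hg : IsMetricOn g U) {m : ℕ} {ι : Type*} [Fintype ι]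
    (k : ι → ℝ) (σ : ι → Fin (m + 4) → Fin (m + 4))
    (h : ∀ ξ ∈ U, ∀ q : Fin (m + 4) → V, ∑ a, k a * nablaCurv g m ξ (q ∘ σ a) = 0)
    (B : List V) (hξ : ξ ∈ U) (q : Fin (m + 4) → V) :
    ∑ a, k a * nablaList g ξ B (q ∘ σ a) = 0 := by
  generalize hn : B.length = n
  induction n generalizing B ξ q with
  | zero =>
    obtain rfl := List.length_eq_zero_iff.mp hn
    exact h ξ hξ q
  | succ n ih =>
    obtain ⟨x, B, rfl⟩ := List.exists_cons_of_length_eq_add_one hn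
    have h1 := HasDerivAt.fun_sum (u := Finset.univ) fun a _ =>
      (hg.hasDerivAt_nablaList_line hξ x B (q ∘ σ a)).const_mul (k a)
    have h2 : (fun s : ℝ => ∑ a, k a * nablaList g (ξ + s • x)
        (B.map fun y => parallelField g ξ x y s)
        fun j => parallelField g ξ x ((q ∘ σ a) j) s) =ᶠ[𝓝 0] fun _ => 0 := by
      filter_upwards [hg.eventually_line hξ x] with s hs
      -- The shorter identity holds at the nearby points with the extended arguments. The function
      -- is therefore zero near `s = 0`, and its derivative there is the identity for `x :: B`.
      exact ih _ hs (fun j => parallelField g ξ x (q j) s) (by simpa using hn)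
    exact (h1.congr_of_eventuallyEq h2.symm).unique (hasDerivAt_const 0 0)

omit [FiniteDimensional ℝ V] in
theorem curvEnd_skew (x y z : V) : curvEnd g ξ x y z = -curvEnd g ξ y x z := by
  unfold curvEnd; abel

theorem IsMetricOn.fderiv_christoffel_comm (hg : IsMetricOn g U) (hξ : ξ ∈ U) (u x y : V) :
    fderiv ℝ (christoffel g) ξ u x y = fderiv ℝ (christoffel g) ξ u y x := by
  have hd := ((hg.contDiffAt_christoffel hξ).differentiableAt (by simp))
  have h1 : ∀ x y, HasDerivAt (fun s : ℝ => christoffel g (ξ + s • u) x y)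
      (fderiv ℝ (christoffel g) ξ u x y) 0 := fun x y => by
    have := ((hasDerivAt_comp_line hd u).clm_apply (hasDerivAt_const 0 x)).clm_apply (hasDerivAt_const 0 y)
    exact this.congr_deriv (by simp)
  refine (h1 x y).unique ((h1 y x).congr_of_eventuallyEq ?_)
  filter_upwards [hg.eventually_line hξ u] with s hs
  exact hg.christoffel_comm hs x y

theorem IsMetricOn.curvEnd_bianchi (hg : IsMetricOn g U) (hξ : ξ ∈ U) (x y z : V) :
    curvEnd g ξ x y z + curvEnd g ξ y z x + curvEnd g ξ z x y = 0 := by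
  unfold curvEnd
  rw [hg.fderiv_christoffel_comm hξ x y z, hg.fderiv_christoffel_comm hξ y x z,
    hg.fderiv_christoffel_comm hξ z x y, hg.christoffel_comm hξ y z, hg.christoffel_comm hξ x z,
    hg.christoffel_comm hξ x y]
  abel

/-- Differentiating `∇g = 0` once more expresses the second derivative of `g` through the
connection. That derivative is symmetric in `u` and `x`, and antisymmetrizing the expression leaves
the two curvature terms. -/
theorem IsMetricOn.curvEnd_skew_inner (hg : IsMetricOn g U) (hξ : ξ ∈ U) (u x y z : V) :
    g ξ (curvEnd g ξ u x y) z = -g ξ y (curvEnd g ξ u x z) := by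
  have hd := ((hg.contDiffAt_christoffel hξ).differentiableAt (by simp))
  have hd2 : DifferentiableAt ℝ (fderiv ℝ g) ξ :=
    ((hg.smooth ξ hξ).fderiv_right (m := ω) (by simp)).differentiableAt (by simp)
  have key : ∀ u x, fderiv ℝ (fderiv ℝ g) ξ u x y z =
      g ξ (fderiv ℝ (christoffel g) ξ u x y + christoffel g ξ u (christoffel g ξ x y)) z
      + g ξ (christoffel g ξ x y) (christoffel g ξ u z)
      + (g ξ (christoffel g ξ u y) (christoffel g ξ x z)
      + g ξ y (fderiv ℝ (christoffel g) ξ u x z + christoffel g ξ u (christoffel g ξ x z))) := by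
    intro u x
    have h1 : ∀ y, HasDerivAt (fun s : ℝ => christoffel g (ξ + s • u) x y)
        (fderiv ℝ (christoffel g) ξ u x y) 0 := fun y => by
      have := ((hasDerivAt_comp_line hd u).clm_apply (hasDerivAt_const 0 x)).clm_apply (hasDerivAt_const 0 y)
      exact this.congr_deriv (by simp)
    have h0 : ξ + (0 : ℝ) • u ∈ U := by simpa using hξ
    have h2 := (hg.hasDerivAt_inner h0 (hasDerivAt_line ξ u) (h1 y) (hasDerivAt_const 0 z)).add
      (hg.hasDerivAt_inner h0 (hasDerivAt_line ξ u) (hasDerivAt_const 0 y) (h1 z))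
    have h3 : HasDerivAt (fun s : ℝ => fderiv ℝ g (ξ + s • u) x y z)
        (fderiv ℝ (fderiv ℝ g) ξ u x y z) 0 := by
      have := (((hasDerivAt_comp_line hd2 u).clm_apply (hasDerivAt_const 0 x)).clm_apply
        (hasDerivAt_const 0 y)).clm_apply (hasDerivAt_const 0 z)
      exact this.congr_deriv (by simp)
    have h4 := h3.unique (h2.congr_of_eventuallyEq (by
      filter_upwards [hg.eventually_line hξ u] with s hs
      exact hg.fderiv_eq hs x y z))
    simpa using h4
  have hs : fderiv ℝ (fderiv ℝ g) ξ u x = fderiv ℝ (fderiv ℝ g) ξ x u :=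
    ((hg.smooth ξ hξ).isSymmSndFDerivAt (by simp)) u x
  have e := key u x
  rw [hs, key x u] at e
  unfold curvEnd
  simp only [map_add, map_sub, add_apply, sub_apply] at e ⊢
  linarith

theorem IsMetricOn.hasDerivAt_curvEnd (hg : IsMetricOn g U) (hξ : ξ ∈ U) {x y' z' u' : V}
    {y z u : ℝ → V} (hy : HasDerivAt y y' 0) (hz : HasDerivAt z z' 0) (hu : HasDerivAt u u' 0) :
    HasDerivAt (fun s : ℝ => curvEnd g (ξ + s • x) (y s) (z s) (u s))
      (fderiv ℝ (fderiv ℝ (christoffel g)) ξ x (y 0) (z 0) (u 0)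
        - fderiv ℝ (fderiv ℝ (christoffel g)) ξ x (z 0) (y 0) (u 0)
        + fderiv ℝ (christoffel g) ξ x (y 0) (christoffel g ξ (z 0) (u 0))
        + christoffel g ξ (y 0) (fderiv ℝ (christoffel g) ξ x (z 0) (u 0))
        - fderiv ℝ (christoffel g) ξ x (z 0) (christoffel g ξ (y 0) (u 0))
        - christoffel g ξ (z 0) (fderiv ℝ (christoffel g) ξ x (y 0) (u 0))
        + curvEnd g ξ y' (z 0) (u 0) + curvEnd g ξ (y 0) z' (u 0) + curvEnd g ξ (y 0) (z 0) u')
      0 := by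
  have hs := hg.contDiffAt_christoffel hξ
  have h1 := hasDerivAt_comp_line (hs.differentiableAt (by simp)) x
  have h2 := hasDerivAt_comp_line ((hs.fderiv_right (m := ω) (by simp)).differentiableAt
    (by simp)) x
  have h := ((((h2.clm_apply hy).clm_apply hz).clm_apply hu).sub
    (((h2.clm_apply hz).clm_apply hy).clm_apply hu)).add
    ((h1.clm_apply hy).clm_apply ((h1.clm_apply hz).clm_apply hu)) |>.sub
    ((h1.clm_apply hz).clm_apply ((h1.clm_apply hy).clm_apply hu))
  refine h.congr_deriv ?_
  simp only [zero_smul, add_zero, add_apply, map_add, curvEnd]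
  abel

/-- With `∇R` written through `Γ` and its first two derivatives, the second Bianchi identity becomes
a cancellation that uses only the symmetry of `Γ` and of its second derivative. -/
theorem IsMetricOn.nablaCurv_one_apply (hg : IsMetricOn g U) (hξ : ξ ∈ U) (q : Fin 5 → V) :
    nablaCurv g 1 ξ q = g ξ
      (fderiv ℝ (fderiv ℝ (christoffel g)) ξ (q 0) (q 1) (q 2) (q 3)
        - fderiv ℝ (fderiv ℝ (christoffel g)) ξ (q 0) (q 2) (q 1) (q 3)
        + fderiv ℝ (christoffel g) ξ (q 0) (q 1) (christoffel g ξ (q 2) (q 3))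
        + christoffel g ξ (q 1) (fderiv ℝ (christoffel g) ξ (q 0) (q 2) (q 3))
        - fderiv ℝ (christoffel g) ξ (q 0) (q 2) (christoffel g ξ (q 1) (q 3))
        - christoffel g ξ (q 2) (fderiv ℝ (christoffel g) ξ (q 0) (q 1) (q 3))
        + curvEnd g ξ (-christoffel g ξ (q 0) (q 1)) (q 2) (q 3)
        + curvEnd g ξ (q 1) (-christoffel g ξ (q 0) (q 2)) (q 3)
        + curvEnd g ξ (q 1) (q 2) (-christoffel g ξ (q 0) (q 3))
        + christoffel g ξ (q 0) (curvEnd g ξ (q 1) (q 2) (q 3))) (q 4) := by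
  have hP := fun v : V => hasDerivAt_parallelField (g := g) (ξ := ξ) (q 0) v
  have h1 := hg.hasDerivAt_inner (c := fun s : ℝ => ξ + s • q 0) (t := 0) (by simpa using hξ)
    (hasDerivAt_line ξ (q 0)) (hg.hasDerivAt_curvEnd hξ (x := q 0) (hP (q 1)) (hP (q 2)) (hP (q 3)))
    (hP (q 4))
  have h2 := hg.hasDerivAt_nablaList_line hξ (q 0) [] (Fin.tail q : Fin (0 + 4) → V)
  have h3 := h2.unique h1
  have h4 : nablaCurv g 1 ξ q = nablaList g ξ [q 0] (Fin.tail q : Fin (0 + 4) → V) :=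
    nablaCurv_eq_nablaList _ _ (by
      rw [List.ofFn_succ]
      rfl)
  rw [h4, h3]
  simp

theorem IsMetricOn.second_bianchi (hg : IsMetricOn g U) (hξ : ξ ∈ U) (x y z u v : V) :
    nablaCurv g 1 ξ ![x, y, z, u, v] + nablaCurv g 1 ξ ![y, z, x, u, v]
      + nablaCurv g 1 ξ ![z, x, y, u, v] = 0 := by
  have hs : ∀ x y, fderiv ℝ (fderiv ℝ (christoffel g)) ξ x y
      = fderiv ℝ (fderiv ℝ (christoffel g)) ξ y x :=
    fun x y => ((hg.contDiffAt_christoffel hξ).isSymmSndFDerivAt (by simp)) x y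
  have h0 : ∀ a b c w : V, a + b + c = 0 → g ξ a w + g ξ b w + g ξ c w = 0 := fun a b c w h => by
    rw [← add_apply, ← add_apply, ← map_add, ← map_add, h, map_zero, zero_apply]
  simp only [hg.nablaCurv_one_apply hξ, Matrix.cons_val]
  refine h0 _ _ _ _ ?_
  rw [hs y x, hs z y, hs x z]
  simp only [curvEnd, map_neg, neg_apply, map_sub, map_add]
  rw [hg.christoffel_comm hξ y x, hg.christoffel_comm hξ z y, hg.christoffel_comm hξ x z]
  abel

end Curvature

/-! ## The Ricci identities -/

section Commutator

variable {V : Type*} [NormedAddCommGroup V] [NormedSpace ℝ V]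

theorem derivAct_tensor_add {n : ℕ} (A : V →L[ℝ] V) (T T' : Tensor V n) :
    derivAct A (T + T') = derivAct A T + derivAct A T' := by
  ext v
  simp only [derivAct_apply, add_apply, Finset.sum_add_distrib, neg_add]

/-- The terms in which `A` and `B` act on different slots are symmetric in `A` and `B` and cancel.
Those acting on one slot give the commutator. -/
theorem derivAct_commutator {n : ℕ} (A B : V →L[ℝ] V) (T : Tensor V n) :
    derivAct A (derivAct B T) - derivAct B (derivAct A T) = derivAct (A ∘L B - B ∘L A) T := by
  ext v
  have key : ∀ A B : V →L[ℝ] V, derivAct A (derivAct B T) v =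
      ∑ j, T (Function.update v j (B (A (v j)))) + ∑ j, ∑ i ∈ Finset.univ.erase j,
        T (Function.update (Function.update v j (A (v j))) i (B (v i))) := by
    intro A B
    simp only [derivAct_apply, ← Finset.sum_neg_distrib, neg_neg]
    rw [← Finset.sum_add_distrib]
    refine Finset.sum_congr rfl fun j _ => ?_
    rw [← Finset.add_sum_erase _ _ (Finset.mem_univ j)]
    congr 1
    · simp
    · refine Finset.sum_congr rfl fun i hi => ?_
      rw [Function.update_of_ne (Finset.ne_of_mem_erase hi)]
  have hcomm : ∑ j, ∑ i ∈ Finset.univ.erase j,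
        T (Function.update (Function.update v j (A (v j))) i (B (v i)))
      = ∑ j, ∑ i ∈ Finset.univ.erase j,
        T (Function.update (Function.update v j (B (v j))) i (A (v i))) := by
    rw [Finset.sum_comm' (t' := Finset.univ) (s' := fun i => Finset.univ.erase i)]
    · refine Finset.sum_congr rfl fun j _ => Finset.sum_congr rfl fun i hi => ?_
      rw [Function.update_comm (Finset.ne_of_mem_erase hi)]
    · intro i j
      simp [eq_comm]
  rw [sub_apply, key A B, key B A, hcomm, derivAct_apply]
  simp only [sub_apply, ContinuousLinearMap.comp_apply, ContinuousMultilinearMap.map_update_sub,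
    Finset.sum_sub_distrib]
  ring

end Commutator

section Ricci

variable {V : Type*} [NormedAddCommGroup V] [NormedSpace ℝ V] [FiniteDimensional ℝ V]
  {g : V → BForm V} {U : Set V} {ξ : V}

/-- The terms are grouped by their symmetry in `y` and `z`. After antisymmetrization only the
derivatives of `Γ` and the products of two Christoffel actions survive, and these form the
curvature. -/
theorem IsMetricOn.covDeriv_covDeriv_apply (hg : IsMetricOn g U) (hξ : ξ ∈ U) {n : ℕ}
    {T : V → Tensor V n} (hT : ∀ ξ ∈ U, ContDiffAt ℝ ω T ξ) (y z : V) (q : Fin n → V) :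
    covDeriv g (covDeriv g T) ξ (Fin.cons y (Fin.cons z q)) =
      (fderiv ℝ (fderiv ℝ T) ξ y z + derivAct (fderiv ℝ (christoffel g) ξ y z) (T ξ)
        + derivAct (christoffel g ξ z) (fderiv ℝ T ξ y)
        + derivAct (christoffel g ξ y) (fderiv ℝ T ξ z)
        + derivAct (christoffel g ξ y) (derivAct (christoffel g ξ z) (T ξ))) q
      - covDeriv g T ξ (Fin.cons (christoffel g ξ y z) q) := by
  have hcT : DifferentiableAt ℝ (covDeriv g T) ξ := by
    have := contDiffAt_covDeriv_param (P := ℝ) (g := fun _ => g) (T := fun _ => T) (q := (0, ξ))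
      ((hg.smooth ξ hξ).comp (0, ξ) contDiffAt_snd) (hg.inv ξ hξ)
      ((hT ξ hξ).comp (0, ξ) contDiffAt_snd)
    exact (this.comp (f := fun ξ => ((0 : ℝ), ξ)) ξ
      (contDiffAt_const.prodMk contDiffAt_id)).differentiableAt (by simp)
  have hd : HasDerivAt (fun s : ℝ => covDeriv g T (ξ + s • y) (Fin.cons z q))
      (fderiv ℝ (covDeriv g T) ξ y (Fin.cons z q)) 0 :=
    ((ContinuousMultilinearMap.apply ℝ (fun _ : Fin (n + 1) => V) ℝ
      (Fin.cons z q)).hasFDerivAt.comp_hasDerivAt (0 : ℝ) (hasDerivAt_comp_line hcT y))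
  have hT' := hasDerivAt_comp_line ((hT ξ hξ).differentiableAt (by simp)) y
  have hT'' := hasDerivAt_comp_line (((hT ξ hξ).fderiv_right (m := ω) (by simp)).differentiableAt
    (by simp)) y
  have hΓ := hasDerivAt_comp_line ((hg.contDiffAt_christoffel hξ).differentiableAt (by simp)) y
  have h1 : HasDerivAt (fun s : ℝ => fderiv ℝ T (ξ + s • y) z q)
      (fderiv ℝ (fderiv ℝ T) ξ y z q) 0 :=
    (((ContinuousMultilinearMap.apply ℝ (fun _ : Fin n => V) ℝ
      q).hasFDerivAt.comp_hasDerivAt (0 : ℝ)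
      (hT''.clm_apply (hasDerivAt_const 0 z)))).congr_deriv (by simp)
  have h2 : ∀ j : Fin n, HasDerivAt
      (fun s : ℝ => T (ξ + s • y) (Function.update q j (christoffel g (ξ + s • y) z (q j))))
      (fderiv ℝ T ξ y (Function.update q j (christoffel g ξ z (q j)))
        + T ξ (Function.update q j (fderiv ℝ (christoffel g) ξ y z (q j)))) 0 := by
    intro j
    have hU := (hΓ.clm_apply (hasDerivAt_const 0 z)).clm_apply (hasDerivAt_const 0 (q j))
    have hW : ∀ i, HasDerivAt (fun s : ℝ =>
        Function.update q j (christoffel g (ξ + s • y) z (q j)) i)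
        (Function.update (0 : Fin n → V) j (fderiv ℝ (christoffel g) ξ y z (q j)) i) 0 := by
      intro i
      by_cases hij : i = j
      · subst hij
        simpa using hU
      · simpa [hij] using hasDerivAt_const (0 : ℝ) (q i)
    have h := (HasFDerivAt.continuousMultilinearMap_apply hT'.hasFDerivAt
      (fun i => (hW i).hasFDerivAt)).hasDerivAt
    refine h.congr_deriv ?_
    simp only [ContinuousMultilinearMap.toContinuousLinearMap, add_apply, zero_smul, add_zero,
      sum_apply, ContinuousLinearMap.comp_apply, ContinuousLinearMap.toSpanSingleton_apply,
      one_smul]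
    congr 1
    rw [Finset.sum_eq_single j]
    · simp
    · intro i _ hij
      exact ContinuousMultilinearMap.map_coord_zero _ i (by simp [hij])
    · simp
  have h3 := (h1.sub (HasDerivAt.fun_sum (u := Finset.univ) fun j _ => h2 j)).unique
    (hd.congr_of_eventuallyEq (Filter.Eventually.of_forall fun s => by
      simp only [covDeriv_apply, derivAct_apply, Fin.cons_zero, Fin.tail_cons, Pi.sub_apply]
      ring))
  rw [covDeriv_apply, Fin.cons_zero, Fin.tail_cons, ← h3]
  have h4 : derivAct (christoffel g ξ y) (covDeriv g T ξ) (Fin.cons z q)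
      = -covDeriv g T ξ (Fin.cons (christoffel g ξ y z) q)
        + derivAct (christoffel g ξ y) (fderiv ℝ T ξ z + derivAct (christoffel g ξ z) (T ξ)) q := by
    rw [derivAct_apply, Fin.sum_univ_succ, derivAct_apply, neg_add]
    congr 1
    simp only [Fin.cons_succ, ← Fin.cons_update, covDeriv_apply, Fin.cons_zero, Fin.tail_cons,
      add_apply]
  rw [h4, derivAct_tensor_add]
  simp only [add_apply, derivAct_apply, Finset.sum_add_distrib]
  ring

/-- The Ricci identity for an arbitrary tensor field. -/
theorem IsMetricOn.ricci_identity (hg : IsMetricOn g U) (hξ : ξ ∈ U) {n : ℕ}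
    {T : V → Tensor V n} (hT : ∀ ξ ∈ U, ContDiffAt ℝ ω T ξ) (y z : V) (q : Fin n → V) :
    covDeriv g (covDeriv g T) ξ (Fin.cons y (Fin.cons z q))
      - covDeriv g (covDeriv g T) ξ (Fin.cons z (Fin.cons y q))
      = -∑ j, T ξ (Function.update q j (curvEnd g ξ y z (q j))) := by
  rw [hg.covDeriv_covDeriv_apply hξ hT, hg.covDeriv_covDeriv_apply hξ hT,
    hg.christoffel_comm hξ z y,
    ((hT ξ hξ).isSymmSndFDerivAt (by simp)) z y]
  have h := congrArg (fun S : Tensor V n => S q)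
    (derivAct_commutator (christoffel g ξ y) (christoffel g ξ z) (T ξ))
  have h2 : derivAct (fderiv ℝ (christoffel g) ξ y z - fderiv ℝ (christoffel g) ξ z y
      + (christoffel g ξ y ∘L christoffel g ξ z - christoffel g ξ z ∘L christoffel g ξ y)) (T ξ) q
      = -∑ j, T ξ (Function.update q j (curvEnd g ξ y z (q j))) := by
    rw [derivAct_apply]
    refine congrArg Neg.neg (Finset.sum_congr rfl fun j _ => ?_)
    congr 2
    simp only [curvEnd, add_apply, sub_apply, ContinuousLinearMap.comp_apply]
    abel
  rw [← h2]
  have h3 : ∀ A B : V →L[ℝ] V, derivAct (A - B) (T ξ) = derivAct A (T ξ) - derivAct B (T ξ) := by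
    intro A B
    rw [eq_sub_iff_add_eq, ← derivAct_add, sub_add_cancel]
  rw [derivAct_add, h3]
  simp only [add_apply, sub_apply] at h ⊢
  linarith

/-- The endomorphism `∇^{s)}_{x₁,…,xₛ} R(y, z)` at the point `ξ`, for a list `x₁, …, xₛ`. -/
noncomputable def curvEndList (g : V → BForm V) (ξ : V) (A : List V) (y z u : V) : V :=
  curvOp (g ξ) (nablaCurv g A.length ξ) A.get y z u

omit [FiniteDimensional ℝ V] in
theorem IsMetricOn.nondegenerate (hg : IsMetricOn g U) (hξ : ξ ∈ U) (x : V)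
    (hx : ∀ y, g ξ x y = 0) : x = 0 :=
  hg.ext hξ fun v => by simp [hx v]

theorem IsMetricOn.curvEndList_spec (hg : IsMetricOn g U) (hξ : ξ ∈ U) (A : List V)
    (y z u v : V) : g ξ (curvEndList g ξ A y z u) v
      = nablaList g ξ A (![y, z, u, v] : Fin (0 + 4) → V) := by
  rw [curvEndList, curvOp_spec _ (hg.nondegenerate hξ)]
  refine nablaCurv_eq_nablaList _ _ ?_
  rw [List.ofFn_fin_append, List.ofFn_get]

theorem IsMetricOn.curvEndList_nil (hg : IsMetricOn g U) (hξ : ξ ∈ U) (y z u : V) :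
    curvEndList g ξ [] y z u = curvEnd g ξ y z u :=
  hg.ext hξ fun v => by
    rw [hg.curvEndList_spec hξ]
    rfl

theorem IsMetricOn.curvEndList_eq_zero (hg : IsMetricOn g U) (hξ : ξ ∈ U) (A : List V)
    {y z u : V} (h : y = 0 ∨ z = 0 ∨ u = 0) : curvEndList g ξ A y z u = 0 := by
  have e : ∀ v : V, (![y, z, u, v] : Fin (0 + 4) → V)
      = Function.update ![y, z, u, v] 0 y ∧ (![y, z, u, v] : Fin (0 + 4) → V)
      = Function.update ![y, z, u, v] 1 z ∧ (![y, z, u, v] : Fin (0 + 4) → V)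
      = Function.update ![y, z, u, v] 2 u := fun v =>
    ⟨(Function.update_eq_self 0 _).symm, (Function.update_eq_self 1 _).symm,
      (Function.update_eq_self 2 _).symm⟩
  refine hg.ext hξ fun v => ?_
  rw [hg.curvEndList_spec hξ, map_zero, zero_apply]
  rcases h with rfl | rfl | rfl
  · rw [(e v).1]
    exact nablaList_update_zero A _ _
  · rw [(e v).2.1]
    exact nablaList_update_zero A _ _
  · rw [(e v).2.2]
    exact nablaList_update_zero A _ _

/-- The product rule for an endomorphism field is obtained from the one for the lowered tensor,
since raising an index commutes with covariant differentiation. -/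
theorem IsMetricOn.hasDerivAt_curvEndList (hg : IsMetricOn g U) {c : ℝ → V} {x : V} {t : ℝ}
    (hc : c t ∈ U) (hx : HasDerivAt c x t) {X : Type*} {A : List X} {f : X → ℝ → V}
    {y z u : ℝ → V} {y' z' u' : V}
    (hf : ∀ y ∈ A, HasDerivAt (f y) (-christoffel g (c t) x (f y t)) t)
    (hy : HasDerivAt y y' t) (hz : HasDerivAt z z' t) (hu : HasDerivAt u u' t) :
    HasDerivAt (fun s => curvEndList g (c s) (A.map fun a => f a s) (y s) (z s) (u s))
      (curvEndList g (c t) (x :: A.map fun a => f a t) (y t) (z t) (u t)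
        + curvEndList g (c t) (A.map fun a => f a t) (y' + christoffel g (c t) x (y t)) (z t) (u t)
        + curvEndList g (c t) (A.map fun a => f a t) (y t) (z' + christoffel g (c t) x (z t)) (u t)
        + curvEndList g (c t) (A.map fun a => f a t) (y t) (z t) (u' + christoffel g (c t) x (u t))
        - christoffel g (c t) x
            (curvEndList g (c t) (A.map fun a => f a t) (y t) (z t) (u t))) t := by
  have hev := hx.continuousAt.preimage_mem_nhds (hg.isOpen.mem_nhds hc)
  have h := hg.hasDerivAt_inverse (c := c) (x := x) (t := t)
    (α := fun s => g (c s) (curvEndList g (c s) (A.map fun a => f a s) (y s) (z s) (u s)))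
    (u := curvEndList g (c t) (x :: A.map fun a => f a t) (y t) (z t) (u t)
      + curvEndList g (c t) (A.map fun a => f a t) (y' + christoffel g (c t) x (y t)) (z t) (u t)
      + curvEndList g (c t) (A.map fun a => f a t) (y t) (z' + christoffel g (c t) x (z t)) (u t)
      + curvEndList g (c t) (A.map fun a => f a t) (y t) (z t)
            (u' + christoffel g (c t) x (u t))) hc hx ?_
  · rw [(hg.inv _ hc).inverse_apply_self] at h
    refine h.congr_of_eventuallyEq ?_
    filter_upwards [hev] with s hs
    rw [(hg.inv _ hs).inverse_apply_self]
  · intro Y Y' hY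
    have hq := hg.hasDerivAt_nablaList (m := 0) hc hx hf (q := ![y, z, u, Y])
      (q' := ![y', z', u', Y']) (by
        intro j
        match j with
        | 0 => exact hy
        | 1 => exact hz
        | 2 => exact hu
        | 3 => exact hY)
    have e : ∀ s, (fun j => (![y, z, u, Y] : Fin (0 + 4) → ℝ → V) j s) = ![y s, z s, u s, Y s] := by
      intro s
      funext j
      match j with
      | 0 | 1 | 2 | 3 => rfl
    have hq2 : HasDerivAt (fun s => nablaList g (c s) (A.map fun a => f a s)
        (![y s, z s, u s, Y s] : Fin (0 + 4) → V)) _ t :=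
      hq.congr_of_eventuallyEq (Filter.Eventually.of_forall fun s => by simp only [e])
    refine (hq2.congr_of_eventuallyEq ?_).congr_deriv ?_
    · filter_upwards [hev] with s hs
      exact hg.curvEndList_spec hs _ _ _ _ _
    · simp only [map_add (g (c t)), add_apply, hg.curvEndList_spec hc, e]
      refine (congrArg _ (Fin.sum_univ_four (M := ℝ) _)).trans ?_
      have e0 : ∀ w, Function.update (![y t, z t, u t, Y t] : Fin (0 + 4) → V) 0 w
          = ![w, z t, u t, Y t] := by
        intro w; funext j
        match j with
        | 0 | 1 | 2 | 3 => rfl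
      have e1 : ∀ w, Function.update (![y t, z t, u t, Y t] : Fin (0 + 4) → V) 1 w
          = ![y t, w, u t, Y t] := by
        intro w; funext j
        match j with
        | 0 | 1 | 2 | 3 => rfl
      have e2 : ∀ w, Function.update (![y t, z t, u t, Y t] : Fin (0 + 4) → V) 2 w
          = ![y t, z t, w, Y t] := by
        intro w; funext j
        match j with
        | 0 | 1 | 2 | 3 => rfl
      have e3 : ∀ w, Function.update (![y t, z t, u t, Y t] : Fin (0 + 4) → V) 3 w
          = ![y t, z t, u t, w] := by
        intro w; funext j
        match j with
        | 0 | 1 | 2 | 3 => rfl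
      simp only [Matrix.cons_val, e0, e1, e2, e3]
      ring

/-- `∑ φ (x_S) (x_{Sᶜ})`, the sum being over all ways of splitting a list `x` into two
complementary sublists. -/
def splitSum {X : Type*} : (List X → List X → ℝ) → List X → ℝ
  | φ, [] => φ [] []
  | φ, x :: B => splitSum (fun A C => φ (x :: A) C) B + splitSum (fun A C => φ A (x :: C)) B

omit [FiniteDimensional ℝ V] in
theorem splitSum_add {X : Type*} (φ ψ : List X → List X → ℝ) (B : List X) :
    splitSum (fun A C => φ A C + ψ A C) B = splitSum φ B + splitSum ψ B := by
  induction B generalizing φ ψ with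
  | nil => rfl
  | cons x B ih =>
    simp only [splitSum, ih]
    ring

theorem hasDerivAt_splitSum {X Y : Type*} {φ : ℝ → List Y → List Y → ℝ} {φ' : List X → List X → ℝ}
    {f : X → ℝ → Y} {t : ℝ} (h : ∀ A C, HasDerivAt
      (fun s => φ s (A.map fun x => f x s) (C.map fun x => f x s)) (φ' A C) t) (B : List X) :
    HasDerivAt (fun s => splitSum (φ s) (B.map fun x => f x s)) (splitSum φ' B) t := by
  induction B generalizing φ φ' with
  | nil => exact h [] []
  | cons x B ih =>
    exact (ih (φ := fun s A C => φ s (f x s :: A) C) fun A C => h (x :: A) C).add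
      (ih (φ := fun s A C => φ s A (f x s :: C)) fun A C => h A (x :: C))

/-- The value `(∇_{x} R(y, z) · ∇_{x'} ∇^{m)} R)(q)` for lists `x = A` and `x' = C`. -/
noncomputable def ricciTerm (g : V → BForm V) (ξ : V) {m : ℕ} (y z : V) (q : Fin (m + 4) → V)
    (A C : List V) : ℝ :=
  -∑ j, nablaList g ξ C (Function.update q j (curvEndList g ξ A y z (q j)))

/-- Leibniz rule: the new direction `x` falls either on the curvature endomorphism or on the tensor
it acts on. This is the recursion defining `splitSum`. -/
theorem IsMetricOn.hasDerivAt_ricciTerm (hg : IsMetricOn g U) (hξ : ξ ∈ U) {m : ℕ}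
    (x y z : V) (q : Fin (m + 4) → V) (A C : List V) :
    HasDerivAt (fun s : ℝ => ricciTerm g (ξ + s • x) (parallelField g ξ x y s)
      (parallelField g ξ x z s) (fun j => parallelField g ξ x (q j) s)
      (A.map fun a => parallelField g ξ x a s) (C.map fun a => parallelField g ξ x a s))
      (ricciTerm g ξ y z q (x :: A) C + ricciTerm g ξ y z q A (x :: C)) 0 := by
  have h0 : ξ + (0 : ℝ) • x ∈ U := by simpa using hξ
  have hP : ∀ v, HasDerivAt (parallelField g ξ x v)
      (-christoffel g (ξ + (0 : ℝ) • x) x (parallelField g ξ x v 0)) 0 := fun v => by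
    simpa using hasDerivAt_parallelField x v
  unfold ricciTerm
  rw [← neg_add, ← Finset.sum_add_distrib]
  refine HasDerivAt.fun_neg (HasDerivAt.fun_sum fun j _ => ?_)
  have hE := hg.hasDerivAt_curvEndList (c := fun s : ℝ => ξ + s • x) h0 (hasDerivAt_line ξ x)
    (A := A) (fun a _ => hP a) (hP y) (hP z) (hP (q j))
  have h := hg.hasDerivAt_nablaList (c := fun s : ℝ => ξ + s • x) h0 (hasDerivAt_line ξ x)
    (B := C) (fun a _ => hP a) (q := Function.update (fun j => parallelField g ξ x (q j)) j
      (fun s : ℝ => curvEndList g (ξ + s • x) (A.map fun a => parallelField g ξ x a s)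
        (parallelField g ξ x y s) (parallelField g ξ x z s) (parallelField g ξ x (q j) s)))
    (q' := Function.update (fun j => -christoffel g (ξ + (0 : ℝ) • x) x
      (parallelField g ξ x (q j) 0)) j _) (by
      intro i
      by_cases hij : i = j
      · subst hij
        simp only [Function.update_self]
        exact hE
      · simp only [Function.update_of_ne hij]
        exact hP (q i))
  have e : ∀ s : ℝ, (fun i => Function.update (fun j => parallelField g ξ x (q j)) j
      (fun s : ℝ => curvEndList g (ξ + s • x) (A.map fun a => parallelField g ξ x a s)
        (parallelField g ξ x y s) (parallelField g ξ x z s) (parallelField g ξ x (q j) s)) i s)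
      = Function.update (fun j => parallelField g ξ x (q j) s) j
        (curvEndList g (ξ + s • x) (A.map fun a => parallelField g ξ x a s)
        (parallelField g ξ x y s) (parallelField g ξ x z s) (parallelField g ξ x (q j) s)) := by
    intro s
    funext i
    by_cases hij : i = j
    · subst hij; simp
    · simp [hij]
  simp only [e] at h
  refine h.congr_deriv ?_
  rw [add_comm]
  congr 1
  -- The slots other than `j` are parallel. In slot `j` the terms with covariant derivatives of `y`,
  -- `z` and `q j` vanish, which leaves the term with the lengthened list.
  · rw [Finset.sum_eq_single j]
    · simp [hg.curvEndList_eq_zero hξ]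
    · intro i _ hij
      simp only [Function.update_of_ne hij, neg_add_cancel]
      exact nablaList_update_zero _ _ _
    · simp
  · simp

/-- For an empty prefix this is the classical Ricci identity for the field `∇^{m)}R`. Each further
direction of the prefix is obtained by differentiating both sides along a line. -/
theorem IsMetricOn.ricci_nablaList (hg : IsMetricOn g U) (hξ : ξ ∈ U) {m : ℕ} (B : List V)
    (y z : V) (q : Fin (m + 4) → V) :
    nablaList g ξ (B ++ [y, z]) q - nablaList g ξ (B ++ [z, y]) q
      = splitSum (ricciTerm g ξ y z q) B := by
  generalize hn : B.length = n
  induction n generalizing B ξ y z q with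
  | zero =>
    obtain rfl := List.length_eq_zero_iff.mp hn
    refine (hg.ricci_identity hξ (fun ξ hξ => hg.contDiffAt_nablaCurv hξ m) y z q).trans ?_
    simp only [splitSum, ricciTerm, hg.curvEndList_nil hξ]
    rfl
  | succ n ih =>
    obtain ⟨x, B, rfl⟩ := List.exists_cons_of_length_eq_add_one hn
    have h1 := (hg.hasDerivAt_nablaList_line hξ x (B ++ [y, z]) q).sub
      (hg.hasDerivAt_nablaList_line hξ x (B ++ [z, y]) q)
    have h2 := hasDerivAt_splitSum (fun A C => hg.hasDerivAt_ricciTerm hξ x y z q A C) B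
    have h3 := h1.unique (h2.congr_of_eventuallyEq (by
      filter_upwards [hg.eventually_line hξ x] with s hs
      simp only [Pi.sub_apply, List.map_append, List.map_cons, List.map_nil]
      exact ih hs _ _ _ _ (by simpa using hn)))
    exact h3.trans (splitSum_add _ _ B)

end Ricci

/-! ## The curvature jet of a metric is an algebraic curvature jet -/

section Splitting

/-- Subsets of `a :: L` either contain `a` or not, which matches the two summands of `splitSum`.
This links the sum over subsets in the Ricci identity with the recursion suited to differentiation.
-/
theorem sum_powerset_filter_eq_splitSum {ι X : Type*} [DecidableEq ι] (x : ι → X)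
    (φ : List X → List X → ℝ) (L : List ι) (hL : L.Nodup) :
    ∑ S ∈ L.toFinset.powerset, φ ((L.filter (· ∈ S)).map x) ((L.filter (· ∉ S)).map x)
      = splitSum φ (L.map x) := by
  induction L generalizing φ with
  | nil => simp [splitSum]
  | cons a L ih =>
    have ha : a ∉ L.toFinset := by simpa using (List.nodup_cons.mp hL).1
    have hL' := (List.nodup_cons.mp hL).2
    rw [List.toFinset_cons, Finset.sum_powerset_insert ha, add_comm, List.map_cons, splitSum,
      ← ih _ hL', ← ih _ hL']
    congr 1
    · refine Finset.sum_congr rfl fun S hS => ?_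
      have h1 : L.filter (· ∈ insert a S) = L.filter (· ∈ S) := by
        refine List.filter_congr fun b hb => ?_
        have : b ≠ a := fun h => ha (by simpa [h] using hb)
        simp [this]
      have h2 : L.filter (· ∉ insert a S) = L.filter (· ∉ S) := by
        refine List.filter_congr fun b hb => ?_
        have : b ≠ a := fun h => ha (by simpa [h] using hb)
        simp [this]
      rw [List.filter_cons_of_pos (by simp), List.filter_cons_of_neg (by simp), h1, h2,
        List.map_cons]
    · refine Finset.sum_congr rfl fun S hS => ?_
      have haS : a ∉ S := fun h => ha (Finset.mem_powerset.mp hS h)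
      rw [List.filter_cons_of_neg (by simpa using haS), List.filter_cons_of_pos (by simpa using haS),
        List.map_cons]

theorem ofFn_sel {V : Type*} {s : ℕ} (x : Fin s → V) (S : Finset (Fin s)) :
    List.ofFn (sel x S) = ((List.finRange s).filter (· ∈ S)).map x := by
  have h : List.ofFn (S.orderEmbOfFin rfl) = (List.finRange s).filter (· ∈ S) := by
    refine List.SortedLT.eq_of_mem_iff ?_ ?_ fun a => ?_
    · exact List.sortedLT_ofFn_iff.mpr (S.orderEmbOfFin rfl).strictMono
    · exact ((List.sortedLT_finRange s).pairwise.filter _).sortedLT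
    · rw [List.mem_ofFn, ← Set.mem_range, Finset.range_orderEmbOfFin]
      simp
  rw [← h, List.map_ofFn]
  rfl

theorem sum_sel_eq_splitSum {V : Type*} {s : ℕ} (x : Fin s → V) (φ : List V → List V → ℝ) :
    ∑ S : Finset (Fin s), φ (List.ofFn (sel x S)) (List.ofFn (sel x Sᶜ))
      = splitSum φ (List.ofFn x) := by
  have h := sum_powerset_filter_eq_splitSum x φ (List.finRange s) (List.nodup_finRange s)
  rw [List.toFinset_finRange, Finset.powerset_univ, ← List.ofFn_eq_map] at h
  rw [← h]
  refine Finset.sum_congr rfl fun S _ => ?_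
  rw [ofFn_sel, ofFn_sel]
  simp only [Finset.mem_compl]

end Splitting

theorem append_update_left {X : Type*} {m n : ℕ} (a : Fin m → X) (b : Fin n → X) (j : Fin m)
    (v : X) : Fin.append (Function.update a j v) b
      = Function.update (Fin.append a b) (Fin.castAdd n j) v := by
  funext i
  refine Fin.addCases (fun i => ?_) (fun i => ?_) i
  · by_cases h : i = j
    · subst h; simp
    · have : Fin.castAdd n i ≠ Fin.castAdd n j := fun e => h (Fin.castAdd_injective m n e)
      simp [h, this]
  · have : Fin.natAdd m i ≠ Fin.castAdd n j := fun e => by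
      have := congrArg Fin.val e; have := j.isLt; simp at *; omega
    simp [this]

theorem append_update_right {X : Type*} {m n : ℕ} (a : Fin m → X) (b : Fin n → X) (j : Fin n)
    (v : X) : Fin.append a (Function.update b j v)
      = Function.update (Fin.append a b) (Fin.natAdd m j) v := by
  funext i
  refine Fin.addCases (fun i => ?_) (fun i => ?_) i
  · have : Fin.castAdd n i ≠ Fin.natAdd m j := fun e => by
      have := congrArg Fin.val e; have := i.isLt; simp at *; omega
    simp [this]
  · by_cases h : i = j
    · subst h; simp
    · have : Fin.natAdd m i ≠ Fin.natAdd m j := fun e => h (Fin.natAdd_injective n m e)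
      simp [h, this]

theorem comp_vecCons₄ {X Y : Type*} (q : X → Y) (a b c d : X) :
    q ∘ ![a, b, c, d] = ![q a, q b, q c, q d] := by
  funext j
  match j with
  | 0 | 1 | 2 | 3 => rfl

theorem comp_vecCons₅ {X Y : Type*} (q : X → Y) (a b c d e : X) :
    q ∘ ![a, b, c, d, e] = ![q a, q b, q c, q d, q e] := by
  funext j
  match j with
  | 0 | 1 | 2 | 3 | 4 => rfl

/-! ### Verification of the jet identities for a metric -/

section MetricJet

variable {V : Type*} [NormedAddCommGroup V] [NormedSpace ℝ V] [FiniteDimensional ℝ V]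
  {g : V → BForm V} {U : Set V} {ξ : V}

theorem IsMetricOn.isAlgCurv_curvTensor (hg : IsMetricOn g U) (hξ : ξ ∈ U) :
    IsAlgCurv fun a b c d => g ξ (curvEnd g ξ a b c) d := by
  have h1 : ∀ a b c d, g ξ (curvEnd g ξ a b c) d = -g ξ (curvEnd g ξ b a c) d := fun a b c d => by
    rw [curvEnd_skew a b c, map_neg, neg_apply]
  have h2 : ∀ a b c d, g ξ (curvEnd g ξ a b c) d = -g ξ (curvEnd g ξ a b d) c := fun a b c d => by
    rw [hg.curvEnd_skew_inner hξ, hg.symm]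
  have h3 : ∀ a b c d, g ξ (curvEnd g ξ a b c) d + g ξ (curvEnd g ξ b c a) d
      + g ξ (curvEnd g ξ c a b) d = 0 := fun a b c d => by
    rw [← add_apply, ← add_apply, ← map_add, ← map_add, hg.curvEnd_bianchi hξ, map_zero,
      zero_apply]
  refine ⟨h1, fun a b c d => ?_, h3⟩
  -- The octahedron argument: pair symmetry is a linear consequence of four first Bianchi identities
  -- and the skew symmetry in each pair.
  have e1 := h3 a b c d
  have e2 := h3 b c d a
  have e3 := h3 c d a b
  have e4 := h3 d a b c
  have f1 := h2 b c a d
  have f2 := h2 c a b d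
  have f3 := h2 c d b a
  have f4 := h2 d b c a
  have f5 := h2 d a c b
  have f6 := h2 a c d b
  have f7 := h2 a b d c
  have f8 := h2 b d a c
  have i1 := h1 c a d b
  have i2 := h1 d b a c
  have i3 := h1 a d c b
  have i4 := h1 a d b c
  linarith

variable {N : ℕ}

theorem comp_nablaCurv {i : ℕ} (hi : i < N) :
    comp (fun i : Fin N => nablaCurv g i ξ) i = nablaCurv g i ξ := by
  simp [comp, hi]

theorem IsMetricOn.curvOp_eq (hg : IsMetricOn g U) (hξ : ξ ∈ U) {s : ℕ} (x : Fin s → V)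
    (y z u : V) : curvOp (g ξ) (nablaCurv g s ξ) x y z u
      = curvEndList g ξ (List.ofFn x) y z u :=
  hg.ext hξ fun v => by
    rw [hg.curvEndList_spec hξ, curvOp_spec _ (hg.nondegenerate hξ)]
    exact nablaCurv_eq_nablaList _ _ (List.ofFn_fin_append _ _)

theorem IsMetricOn.ricciRHS_eq (hg : IsMetricOn g U) (hξ : ξ ∈ U) {s m : ℕ} (h : s + 2 + m < N)
    (x : Fin s → V) (y z : V) (w : Fin m → V) (r : Fin 4 → V) :
    ricciRHS (g ξ) (fun i : Fin N => nablaCurv g i ξ) x y z w r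
      = splitSum (ricciTerm g ξ y z (Fin.append w r)) (List.ofFn x) := by
  rw [← sum_sel_eq_splitSum]
  refine Finset.sum_congr rfl fun S _ => ?_
  have h1 : S.card ≤ s := by simpa using S.card_le_univ
  have h2 : Sᶜ.card ≤ s := by simpa using Sᶜ.card_le_univ
  rw [comp_nablaCurv (by omega), comp_nablaCurv (by omega), ricciTerm, Fin.sum_univ_add]
  have e : ∀ (w : Fin m → V) (r : Fin 4 → V), nablaCurv g (Sᶜ.card + m) ξ
      (Fin.append (Fin.append (sel x Sᶜ) w) r)
      = nablaList g ξ (List.ofFn (sel x Sᶜ)) (Fin.append w r) := fun w r =>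
    nablaCurv_eq_nablaList _ _ (by
      rw [List.ofFn_fin_append, List.ofFn_fin_append, List.ofFn_fin_append, List.append_assoc])
  simp only [e, hg.curvOp_eq hξ]
  simp only [append_update_left, append_update_right, Fin.append_left, Fin.append_right]

/-- The symmetries of `R` are differentiated with all directions as prefix. For the second Bianchi
identity the innermost direction stays with the identity (`m = 1`), and only the outer ones form the
prefix. -/
theorem IsMetricOn.isCurvJet (hg : IsMetricOn g U) (hξ : ξ ∈ U) :
    IsCurvJet (g ξ) fun i : Fin N => nablaCurv g i ξ := by
  refine ⟨fun i hi x => ?_, fun i hi x x₁ x₂ x₃ y₁ y₂ => ?_, fun s m h x y z w r => ?_⟩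
  · rw [comp_nablaCurv hi]
    have e : ∀ a b c d, nablaCurv g i ξ (Fin.append x ![a, b, c, d])
        = nablaList g ξ (List.ofFn x) (![a, b, c, d] : Fin (0 + 4) → V) := fun a b c d =>
      nablaCurv_eq_nablaList _ _ (List.ofFn_fin_append _ _)
    have p1 : ∀ a b c d : V, (![a, b, c, d] : Fin (0 + 4) → V) ∘ (![0, 1, 2, 3] : Fin 4 → Fin 4)
        = ![a, b, c, d] := fun a b c d => comp_vecCons₄ _ _ _ _ _
    have p2 : ∀ a b c d : V, (![a, b, c, d] : Fin (0 + 4) → V) ∘ (![1, 0, 2, 3] : Fin 4 → Fin 4)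
        = ![b, a, c, d] := fun a b c d => comp_vecCons₄ _ _ _ _ _
    have p3 : ∀ a b c d : V, (![a, b, c, d] : Fin (0 + 4) → V) ∘ (![2, 3, 0, 1] : Fin 4 → Fin 4)
        = ![c, d, a, b] := fun a b c d => comp_vecCons₄ _ _ _ _ _
    have p4 : ∀ a b c d : V, (![a, b, c, d] : Fin (0 + 4) → V) ∘ (![1, 2, 0, 3] : Fin 4 → Fin 4)
        = ![b, c, a, d] := fun a b c d => comp_vecCons₄ _ _ _ _ _
    have p5 : ∀ a b c d : V, (![a, b, c, d] : Fin (0 + 4) → V) ∘ (![2, 0, 1, 3] : Fin 4 → Fin 4)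
        = ![c, a, b, d] := fun a b c d => comp_vecCons₄ _ _ _ _ _
    simp only [e]
    refine ⟨fun a b c d => ?_, fun a b c d => ?_, fun a b c d => ?_⟩
    · have := hg.nablaList_identity (m := 0) ![1, 1]
        ![(![0, 1, 2, 3] : Fin 4 → Fin 4), ![1, 0, 2, 3]] (fun η hη q => by
          have := (hg.isAlgCurv_curvTensor hη).skew (q 0) (q 1) (q 2) (q 3)
          rw [Fin.sum_univ_two]
          change (1 : ℝ) * g η (curvEnd g η (q 0) (q 1) (q 2)) (q 3)
            + 1 * g η (curvEnd g η (q 1) (q 0) (q 2)) (q 3) = 0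
          linarith) (List.ofFn x) hξ ![a, b, c, d]
      simp only [Fin.sum_univ_two, Matrix.cons_val, p1, p2] at this
      linarith
    · have := hg.nablaList_identity (m := 0) ![1, -1]
        ![(![0, 1, 2, 3] : Fin 4 → Fin 4), ![2, 3, 0, 1]] (fun η hη q => by
          have := (hg.isAlgCurv_curvTensor hη).pair (q 0) (q 1) (q 2) (q 3)
          rw [Fin.sum_univ_two]
          change (1 : ℝ) * g η (curvEnd g η (q 0) (q 1) (q 2)) (q 3)
            + -1 * g η (curvEnd g η (q 2) (q 3) (q 0)) (q 1) = 0
          linarith) (List.ofFn x) hξ ![a, b, c, d]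
      simp only [Fin.sum_univ_two, Matrix.cons_val, p1, p3] at this
      linarith
    · have := hg.nablaList_identity (m := 0) ![1, 1, 1]
        ![(![0, 1, 2, 3] : Fin 4 → Fin 4), ![1, 2, 0, 3], ![2, 0, 1, 3]] (fun η hη q => by
          have := (hg.isAlgCurv_curvTensor hη).bianchi (q 0) (q 1) (q 2) (q 3)
          rw [Fin.sum_univ_three]
          change (1 : ℝ) * g η (curvEnd g η (q 0) (q 1) (q 2)) (q 3)
            + 1 * g η (curvEnd g η (q 1) (q 2) (q 0)) (q 3)
            + 1 * g η (curvEnd g η (q 2) (q 0) (q 1)) (q 3) = 0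
          linarith) (List.ofFn x) hξ ![a, b, c, d]
      simp only [Fin.sum_univ_three, Matrix.cons_val, p1, p4, p5] at this
      linarith
  · rw [comp_nablaCurv hi]
    have e : ∀ a b c d f, nablaCurv g (i + 1) ξ
        (Fin.append (Fin.snoc x a : Fin (i + 1) → V) ![b, c, d, f])
        = nablaList g ξ (List.ofFn x) (![a, b, c, d, f] : Fin (1 + 4) → V) := fun a b c d f =>
      nablaCurv_eq_nablaList _ _ (by
        rw [List.ofFn_fin_append, List.ofFn_succ']
        simp)
    have := hg.nablaList_identity (m := 1) ![1, 1, 1]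
      ![(![0, 1, 2, 3, 4] : Fin 5 → Fin 5), ![1, 2, 0, 3, 4], ![2, 0, 1, 3, 4]] (fun η hη q => by
        have := hg.second_bianchi hη (q 0) (q 1) (q 2) (q 3) (q 4)
        rw [Fin.sum_univ_three]
        refine Eq.trans ?_ this
        have p1 : q ∘ (![0, 1, 2, 3, 4] : Fin 5 → Fin 5) = ![q 0, q 1, q 2, q 3, q 4] :=
          comp_vecCons₅ _ _ _ _ _ _
        have p2 : q ∘ (![1, 2, 0, 3, 4] : Fin 5 → Fin 5) = ![q 1, q 2, q 0, q 3, q 4] :=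
          comp_vecCons₅ _ _ _ _ _ _
        have p3 : q ∘ (![2, 0, 1, 3, 4] : Fin 5 → Fin 5) = ![q 2, q 0, q 1, q 3, q 4] :=
          comp_vecCons₅ _ _ _ _ _ _
        simp only [Matrix.cons_val, p1, p2, p3, one_mul]) (List.ofFn x) hξ ![x₁, x₂, x₃, y₁, y₂]
    simp only [e]
    refine Eq.trans ?_ this
    rw [Fin.sum_univ_three]
    have p1 : (![x₁, x₂, x₃, y₁, y₂] : Fin (1 + 4) → V) ∘ (![0, 1, 2, 3, 4] : Fin 5 → Fin 5)
        = ![x₁, x₂, x₃, y₁, y₂] := comp_vecCons₅ _ _ _ _ _ _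
    have p2 : (![x₁, x₂, x₃, y₁, y₂] : Fin (1 + 4) → V) ∘ (![1, 2, 0, 3, 4] : Fin 5 → Fin 5)
        = ![x₂, x₃, x₁, y₁, y₂] := comp_vecCons₅ _ _ _ _ _ _
    have p3 : (![x₁, x₂, x₃, y₁, y₂] : Fin (1 + 4) → V) ∘ (![2, 0, 1, 3, 4] : Fin 5 → Fin 5)
        = ![x₃, x₁, x₂, y₁, y₂] := comp_vecCons₅ _ _ _ _ _ _
    simp only [Matrix.cons_val, p1, p2, p3, one_mul]
  · rw [comp_nablaCurv h, hg.ricciRHS_eq hξ h, ← hg.ricci_nablaList hξ]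
    congr 1 <;>
    · refine nablaCurv_eq_nablaList _ _ ?_
      rw [List.ofFn_fin_append, List.ofFn_fin_append, List.ofFn_fin_append,
        List.ofFn_fin_append, List.append_assoc]
      simp

end MetricJet

/-! ## Polarization -/

section Polarization

variable {V : Type*} [NormedAddCommGroup V] [NormedSpace ℝ V]
  {G : Type*} [NormedAddCommGroup G] [NormedSpace ℝ G] {n : ℕ}

/-- The `n`-th derivative of `ξ ↦ H(ξ, …, ξ)` is the sum of `H` over the `n!` permutations of its
arguments. -/
theorem polarize_of_symm {H : V [×n]→L[ℝ] G}
    (hH : ∀ (σ : Equiv.Perm (Fin n)) (v : Fin n → V), H (fun j => v (σ j)) = H v) :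
    polarize n (fun ξ => H fun _ => ξ) = H := by
  ext v
  rw [polarize, smul_apply, ContinuousMultilinearMap.iteratedFDeriv_comp_diagonal]
  simp only [hH, Finset.sum_const, Finset.card_univ, Fintype.card_perm, Fintype.card_fin]
  rw [← Nat.cast_smul_eq_nsmul ℝ, smul_smul, inv_mul_cancel₀, one_smul]
  exact_mod_cast n.factorial_ne_zero

theorem eq_of_diag_eq {H H' : V [×n]→L[ℝ] G}
    (hH : ∀ (σ : Equiv.Perm (Fin n)) (v : Fin n → V), H (fun j => v (σ j)) = H v)
    (hH' : ∀ (σ : Equiv.Perm (Fin n)) (v : Fin n → V), H' (fun j => v (σ j)) = H' v)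
    (h : ∀ ξ, H (fun _ => ξ) = H' fun _ => ξ) : H = H' := by
  rw [← polarize_of_symm hH, ← polarize_of_symm hH', funext h]

theorem polarize_symm {p : V → G} (hp : ContDiff ℝ ω p) (σ : Equiv.Perm (Fin n)) (v : Fin n → V) :
    polarize n p (fun j => v (σ j)) = polarize n p v := by
  simp only [polarize, smul_apply]
  congr 1
  exact hp.contDiffAt.iteratedFDeriv_comp_perm v σ

/-- On the line `t ↦ tξ` the function is `tⁿ p(ξ)`, whose `n`-th derivative is `n! p(ξ)`. -/
theorem polarize_diag_of_homogeneous {p : V → G} (hp : ContDiff ℝ ω p)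
    (h : ∀ (t : ℝ) ξ, p (t • ξ) = t ^ n • p ξ) (ξ : V) : polarize n p (fun _ => ξ) = p ξ := by
  let L : ℝ →L[ℝ] V := ContinuousLinearMap.toSpanSingleton ℝ ξ
  have h1 := L.iteratedFDeriv_comp_right hp 0 (i := n) le_top
  have h2 : p ∘ L = fun t => t ^ n • p ξ := by
    funext t
    simp [L, h]
  have h3 : iteratedDeriv n (fun t : ℝ => t ^ n • p ξ) 0 = (n.factorial : ℝ) • p ξ := by
    rw [iteratedDeriv_smul_const (by fun_prop)]
    simp [Nat.descFactorial_self]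
  have h4 : iteratedFDeriv ℝ n p 0 (fun _ => ξ) = iteratedDeriv n (fun t : ℝ => t ^ n • p ξ) 0 := by
    rw [iteratedDeriv_eq_iteratedFDeriv, ← h2, h1]
    simp [L]
  rw [polarize, smul_apply, h4, h3, smul_smul, inv_mul_cancel₀, one_smul]
  exact_mod_cast n.factorial_ne_zero

/-- The partial iterated derivative at `0` is the total one at `(e, 0)` restricted to `V`, and the
latter depends analytically on its base point. -/
theorem contDiff_polarize_param {E : Type*} [NormedAddCommGroup E] [NormedSpace ℝ E]
    {p : E → V → G} (hp : ContDiff ℝ ω fun q : E × V => p q.1 q.2) :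
    ContDiff ℝ ω fun e => polarize n (p e) := by
  have h : ∀ e, iteratedFDeriv ℝ n (p e) 0
      = (iteratedFDeriv ℝ n (fun q : E × V => p q.1 q.2) (e, 0)).compContinuousLinearMap
          fun _ => ContinuousLinearMap.inr ℝ E V := by
    intro e
    have h1 := (ContinuousLinearMap.inr ℝ E V).iteratedFDeriv_comp_right
      (f := fun q : E × V => p ((e, 0) + q).1 ((e, 0) + q).2)
      (hp.comp (contDiff_const.add contDiff_id)) 0 (i := n) le_top
    rw [iteratedFDeriv_comp_add_left (f := fun q : E × V => p q.1 q.2)] at h1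
    have h2 : (fun q : E × V => p ((e, 0) + q).1 ((e, 0) + q).2) ∘ ContinuousLinearMap.inr ℝ E V
        = p e := by
      funext ξ; simp
    rw [h2] at h1
    simpa using h1
  unfold polarize
  simp only [h]
  have h3 : ContDiff ℝ ω (iteratedFDeriv ℝ n fun q : E × V => p q.1 q.2) :=
    hp.iteratedFDeriv_right (m := ω) (by simp)
  let L : ((E × V) [×n]→L[ℝ] G) →L[ℝ] (V [×n]→L[ℝ] G) :=
    ContinuousMultilinearMap.compContinuousLinearMapL fun _ => ContinuousLinearMap.inr ℝ E V
  have h4 : ContDiff ℝ ω fun e : E => (e, (0 : V)) := contDiff_id.prodMk contDiff_const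
  exact (L.contDiff.comp (h3.comp h4)).const_smul _

end Polarization

/-! ## Evaluation of the tensorial expressions -/

section QEval

variable {V : Type*} [NormedAddCommGroup V] [NormedSpace ℝ V]

/-- The coefficient of `X_{j+2} Q̃_{k-1-j}` in `Q̃_{k+1}`. -/
noncomputable def qCoeff (k j : ℕ) : ℝ :=
  -1 / (((k : ℝ) + 1) * ((k : ℝ) + 2)) * (((k + 1).choose (j + 2) : ℝ) * ((j : ℝ) + 1)
    * ((j : ℝ) + 2))

theorem Qtilde_zero : Qtilde 0 = 1 := by rw [Qtilde]

theorem Qtilde_succ (k : ℕ) : Qtilde (k + 1)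
    = ∑ j : Fin k, qCoeff k j • (FreeAlgebra.ι ℝ (j : ℕ) * Qtilde (k - 1 - j)) := by
  rw [Qtilde, Finset.smul_sum]
  refine Finset.sum_congr rfl fun j _ => ?_
  rw [smul_smul, qCoeff, show k + 1 - (j + 2) = k - 1 - (j : ℕ) by omega]

theorem lift_Qtilde_succ {A : Type*} [Ring A] [Algebra ℝ A] (a : ℕ → A) (k : ℕ) :
    FreeAlgebra.lift ℝ a (Qtilde (k + 1))
      = ∑ j : Fin k, qCoeff k j • (a j * FreeAlgebra.lift ℝ a (Qtilde (k - 1 - j))) := by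
  rw [Qtilde_succ]
  simp

theorem lift_Qtilde_congr {A : Type*} [Ring A] [Algebra ℝ A] {a b : ℕ → A} {m : ℕ}
    (h : ∀ j, j + 2 ≤ m → a j = b j) :
    FreeAlgebra.lift ℝ a (Qtilde m) = FreeAlgebra.lift ℝ b (Qtilde m) := by
  induction m using Nat.strong_induction_on with
  | _ m ih =>
    match m with
    | 0 => simp [Qtilde_zero]
    | k + 1 =>
      rw [lift_Qtilde_succ, lift_Qtilde_succ]
      refine Finset.sum_congr rfl fun j _ => ?_
      rw [h j (by omega), ih (k - 1 - j) (by omega) fun i hi => h i (by omega)]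

/-- Replacing the generator of highest degree changes `Q̃_{k+2}` by a multiple of the difference. -/
theorem lift_Qtilde_top {A : Type*} [Ring A] [Algebra ℝ A] {a b : ℕ → A} {k : ℕ}
    (h : ∀ j, j < k → a j = b j) :
    FreeAlgebra.lift ℝ a (Qtilde (k + 2))
      = FreeAlgebra.lift ℝ b (Qtilde (k + 2)) + qCoeff (k + 1) k • (a k - b k) := by
  rw [lift_Qtilde_succ, lift_Qtilde_succ, Fin.sum_univ_castSucc, Fin.sum_univ_castSucc]
  -- The last summand is the only one with `X_{k+2}`, and there it is multiplied by `Q̃₀ = 1`.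
  have h0 : k + 1 - 1 - (Fin.last k : ℕ) = 0 := by simp
  rw [h0, Qtilde_zero, map_one, map_one, mul_one, mul_one, add_assoc,
    Fin.val_last, ← smul_add, add_sub_cancel]
  congr 1
  · refine Finset.sum_congr rfl fun j _ => ?_
    rw [h _ (by simp), lift_Qtilde_congr fun i hi => h i (by simp at hi; omega)]

theorem lift_Qtilde_homogeneous {A : Type*} [Ring A] [Algebra ℝ A] {a b : ℕ → A} {t : ℝ}
    (h : ∀ j, a j = t ^ (j + 2) • b j) (m : ℕ) :
    FreeAlgebra.lift ℝ a (Qtilde m) = t ^ m • FreeAlgebra.lift ℝ b (Qtilde m) := by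
  induction m using Nat.strong_induction_on with
  | _ m ih =>
    match m with
    | 0 => simp [Qtilde_zero]
    | k + 1 =>
      rw [lift_Qtilde_succ, lift_Qtilde_succ, Finset.smul_sum]
      refine Finset.sum_congr rfl fun j _ => ?_
      rw [h j, ih (k - 1 - j) (by omega), smul_mul_smul_comm, ← pow_add, smul_comm,
        show (j : ℕ) + 2 + (k - 1 - j) = k + 1 by omega]

/-- For self-adjoint generators the anti-automorphism of the free algebra becomes the adjoint. Thus
`Q_l` turns into a binomial sum of inner products of values of `Q̃`, the form in which it meets the
Jacobi fields. -/
theorem lift_star_apply {gg : BForm V} {a : ℕ → V →L[ℝ] V}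
    (ha : ∀ j x y, gg (a j x) y = gg x (a j y)) (w : FreeAlgebra ℝ ℕ) (x y : V) :
    gg (FreeAlgebra.lift ℝ a (star w) x) y = gg x (FreeAlgebra.lift ℝ a w y) := by
  induction w using FreeAlgebra.induction generalizing x y with
  | grade0 r => simp [FreeAlgebra.star_algebraMap, Algebra.algebraMap_eq_smul_one (A := V →L[ℝ] V)]
  | grade1 j => simp [FreeAlgebra.star_ι, ha]
  | mul u v hu hv => simp [star_mul, hu, hv]
  | add u v hu hv => simp [star_add, hu, hv]

theorem lift_Qpoly_apply {gg : BForm V} {a : ℕ → V →L[ℝ] V}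
    (ha : ∀ j x y, gg (a j x) y = gg x (a j y)) (l : ℕ) (x y : V) :
    gg (FreeAlgebra.lift ℝ a (Qpoly l) x) y = ∑ i ∈ Finset.range (l + 1), (l.choose i : ℝ) *
      gg (FreeAlgebra.lift ℝ a (Qtilde (l - i)) x) (FreeAlgebra.lift ℝ a (Qtilde i) y) := by
  simp only [Qpoly, map_sum, map_smul, map_mul, sum_apply, smul_apply,
    mul_apply_eq_comp, smul_eq_mul]
  refine Finset.sum_congr rfl fun i _ => ?_
  rw [lift_star_apply ha]

/-- Every monomial of `Q̃_m` with `m > 0` ends with a generator, which kills `ξ`. In the companion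
below the leading generator is moved onto `ξ`. Together they give the kernel condition of `𝒩_l` for
`Q_l`. -/
theorem lift_Qtilde_kernel {a : ℕ → V →L[ℝ] V} {ξ : V} (h : ∀ j, a j ξ = 0) {m : ℕ} (hm : 0 < m) :
    FreeAlgebra.lift ℝ a (Qtilde m) ξ = 0 := by
  induction m using Nat.strong_induction_on with
  | _ m ih =>
    obtain ⟨k, rfl⟩ := Nat.exists_eq_add_of_lt hm
    rw [zero_add, lift_Qtilde_succ, sum_apply]
    refine Finset.sum_eq_zero fun j _ => ?_
    rw [smul_apply, mul_apply_eq_comp]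
    rcases Nat.eq_zero_or_pos (k - 1 - j) with h0 | h0
    · simp [h0, Qtilde_zero, h]
    · rw [ih _ (by omega) h0, map_zero, smul_zero]

theorem inner_lift_Qtilde_kernel {gg : BForm V} {a : ℕ → V →L[ℝ] V}
    (ha : ∀ j x y, gg (a j x) y = gg x (a j y)) {ξ : V} (h : ∀ j, a j ξ = 0) {m : ℕ} (hm : 0 < m)
    (y : V) : gg ξ (FreeAlgebra.lift ℝ a (Qtilde m) y) = 0 := by
  obtain ⟨k, rfl⟩ := Nat.exists_eq_add_of_lt hm
  rw [zero_add, lift_Qtilde_succ, sum_apply, map_sum]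
  refine Finset.sum_eq_zero fun j _ => ?_
  rw [smul_apply, mul_apply_eq_comp, map_smul, ← ha, h, map_zero, zero_apply,
    smul_zero]

end QEval

/-! ## The map `Q` -/

section MapQ

variable {V : Type*} [NormedAddCommGroup V] [NormedSpace ℝ V]

theorem normalSum_ext {N : ℕ} {h h' : SymAmb V N} (hh : h ∈ normalSum V N) (hh' : h' ∈ normalSum V N)
    (H : ∀ i ξ x y, h i (fun _ => ξ) x y = h' i (fun _ => ξ) x y) : h = h' := by
  funext i
  refine eq_of_diag_eq (hh i).1 (hh' i).1 fun ξ => ?_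
  ext x y
  exact H i ξ x y

/-- A polarized polynomial lies in `𝒩_ℓ` if its values have the symmetries of elements of `𝒩_ℓ`. -/
theorem polarize_mem_normalSpace {l : ℕ} {p : V → BForm V} (hp : ContDiff ℝ ω p)
    (hd : ∀ ξ, polarize l p (fun _ => ξ) = p ξ) (hs : ∀ ξ x y, p ξ x y = p ξ y x)
    (hk : ∀ ξ y, p ξ ξ y = 0) : polarize l p ∈ normalSpace V l := by
  have h1 : ∀ (σ : Equiv.Perm (Fin l)) (v : Fin l → V),
      polarize l p (fun j => v (σ j)) = polarize l p v := polarize_symm hp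
  refine ⟨h1, fun v x y => ?_, fun ξ y => by rw [hd, hk]⟩
  let F : BForm V →L[ℝ] BForm V := (ContinuousLinearMap.flipₗᵢ ℝ V V ℝ : BForm V →L[ℝ] BForm V)
  have h2 : F.compContinuousMultilinearMap (polarize l p) = polarize l p := by
    refine eq_of_diag_eq (fun σ v => ?_) h1 fun ξ => ?_
    · exact congrArg F (h1 σ v)
    · ext x y
      change (polarize l p fun _ => ξ) y x = (polarize l p fun _ => ξ) x y
      rw [hd, hs]
  have h3 := congrArg (fun h : V [×l]→L[ℝ] BForm V => h v y x) h2
  exact h3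

theorem topSym_last (k : ℕ) (v : V [×(k + 2)]→L[ℝ] BForm V) :
    topSym V k v (Fin.last k) = v :=
  Pi.single_eq_same (M := fun i : Fin (k + 1) => V [×(i + 2)]→L[ℝ] BForm V) (Fin.last k) v

theorem topSym_castSucc (k : ℕ) (v : V [×(k + 2)]→L[ℝ] BForm V) (i : Fin k) :
    topSym V k v i.castSucc = 0 :=
  Pi.single_eq_of_ne (M := fun i : Fin (k + 1) => V [×(i + 2)]→L[ℝ] BForm V)
    (i := Fin.last k) (i' := i.castSucc) (Fin.castSucc_lt_last i).ne v

theorem topSym_mem {k : ℕ} {v : V [×(k + 2)]→L[ℝ] BForm V} (hv : v ∈ normalSpace V (k + 2)) :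
    topSym V k v ∈ normalSum V (k + 1) := by
  intro i
  refine Fin.lastCases ?_ (fun i => ?_) i
  · rw [topSym_last]; exact hv
  · rw [topSym_castSucc]; exact Submodule.zero_mem _

theorem normalSum_add {N : ℕ} {h h' : SymAmb V N} (hh : h ∈ normalSum V N)
    (hh' : h' ∈ normalSum V N) : h + h' ∈ normalSum V N :=
  fun i => Submodule.add_mem _ (hh i) (hh' i)

theorem truncSym_mem {k : ℕ} {h : SymAmb V (k + 1)} (hh : h ∈ normalSum V (k + 1)) :
    truncSym V k h ∈ normalSum V k :=
  fun i => hh i.castSucc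

theorem eq_add_topSym {k : ℕ} {h h' : SymAmb V (k + 1)} (hh : truncSym V k h = truncSym V k h') :
    h' = h + topSym V k (h' (Fin.last k) - h (Fin.last k)) := by
  funext i
  refine Fin.lastCases ?_ (fun i => ?_) i
  · rw [Pi.add_apply, topSym_last]; abel
  · rw [Pi.add_apply, topSym_castSucc, add_zero]
    exact (congrFun hh i).symm

theorem truncSym_add_topSym {k : ℕ} (h : SymAmb V (k + 1)) (v : V [×(k + 2)]→L[ℝ] BForm V) :
    truncSym V k (h + topSym V k v) = truncSym V k h := by
  funext i
  change (h + topSym V k v) i.castSucc = h i.castSucc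
  rw [Pi.add_apply, topSym_castSucc, add_zero]

variable [FiniteDimensional ℝ V] {gg : BForm V}

theorem isInvertible_of_nondegenerate (hnd : ∀ x, (∀ y, gg x y = 0) → x = 0) :
    gg.IsInvertible := by
  have hinj : Function.Injective (gg : V →ₗ[ℝ] V →L[ℝ] ℝ) := by
    rw [injective_iff_map_eq_zero]
    exact fun a ha => hnd a fun b => congrArg (fun f : V →L[ℝ] ℝ => f b) ha
  have hdim : Module.finrank ℝ V = Module.finrank ℝ (V →L[ℝ] ℝ) := by
    rw [← (LinearMap.toContinuousLinearMap : (V →ₗ[ℝ] ℝ) ≃ₗ[ℝ] (V →L[ℝ] ℝ)).finrank_eq]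
    exact (Subspace.dual_finrank_eq (K := ℝ) (V := V)).symm
  exact ⟨(LinearEquiv.ofInjectiveOfFinrankEq (gg : V →ₗ[ℝ] V →L[ℝ] ℝ) hinj
    hdim).toContinuousLinearEquiv, by ext; rfl⟩

variable {N : ℕ}

theorem endOf_apply (hnd : ∀ x, (∀ y, gg x y = 0) → x = 0) (H : SymAmb V N) (ξ : V) (j : ℕ)
    (x y : V) : gg (endOf gg H ξ j x) y = if h : j < N then H ⟨j, h⟩ (fun _ => ξ) x y else 0 := by
  unfold endOf
  split_ifs with h
  · rw [ContinuousLinearMap.comp_apply,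
      (isInvertible_of_nondegenerate hnd).self_apply_inverse]
  · simp

theorem endOf_selfAdjoint (hsymm : ∀ x y, gg x y = gg y x)
    (hnd : ∀ x, (∀ y, gg x y = 0) → x = 0) {H : SymAmb V N} (hH : H ∈ normalSum V N) (ξ : V)
    (j : ℕ) (x y : V) : gg (endOf gg H ξ j x) y = gg x (endOf gg H ξ j y) := by
  rw [hsymm x, endOf_apply hnd, endOf_apply hnd]
  split_ifs with h
  · exact (hH ⟨j, h⟩).2.1 _ x y
  · rfl

theorem endOf_kernel (hnd : ∀ x, (∀ y, gg x y = 0) → x = 0) {H : SymAmb V N}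
    (hH : H ∈ normalSum V N) (ξ : V) (j : ℕ) : endOf gg H ξ j ξ = 0 := by
  refine hnd _ fun y => ?_
  rw [endOf_apply hnd]
  split_ifs with h
  · exact (hH ⟨j, h⟩).2.2 ξ y
  · rfl

omit [FiniteDimensional ℝ V] in
theorem endOf_smul (H : SymAmb V N) (t : ℝ) (ξ : V) (j : ℕ) :
    endOf gg H (t • ξ) j = t ^ (j + 2) • endOf gg H ξ j := by
  unfold endOf
  split_ifs with h
  · have : H ⟨j, h⟩ (fun _ => t • ξ) = t ^ (j + 2) • H ⟨j, h⟩ fun _ => ξ := by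
      have := (H ⟨j, h⟩).map_smul_univ (fun _ => t) fun _ => ξ
      simpa using this
    rw [this, ContinuousLinearMap.comp_smul]
  · simp

omit [FiniteDimensional ℝ V] in
theorem contDiff_endOf (j : ℕ) :
    ContDiff ℝ ω fun q : SymAmb V N × V => endOf gg q.1 q.2 j := by
  unfold endOf
  split_ifs with h
  · refine contDiff_const.clm_comp (contDiff_iff_contDiffAt.mpr fun q => ?_)
    refine contDiffAt_multilinear_apply (w := fun _ (q : SymAmb V N × V) => q.2) ?_
      fun _ => contDiffAt_snd
    exact ((ContinuousLinearMap.proj (R := ℝ) (φ := fun i : Fin N => V [×(i + 2)]→L[ℝ] BForm V)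
      ⟨j, h⟩).contDiff.comp contDiff_fst).contDiffAt
  · exact contDiff_const

omit [FiniteDimensional ℝ V] in
theorem contDiff_lift_endOf (w : FreeAlgebra ℝ ℕ) :
    ContDiff ℝ ω fun q : SymAmb V N × V => FreeAlgebra.lift ℝ (endOf gg q.1 q.2) w := by
  induction w using FreeAlgebra.induction with
  | grade0 r => simpa using contDiff_const
  | grade1 j => simpa using contDiff_endOf j
  | mul u v hu hv => simpa using hu.mul hv
  | add u v hu hv => simpa using hu.add hv

omit [FiniteDimensional ℝ V] in
theorem contDiff_evalQ (l : ℕ) :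
    ContDiff ℝ ω fun q : SymAmb V N × V => evalQ gg q.1 l q.2 :=
  contDiff_const.clm_comp (contDiff_lift_endOf _)

omit [FiniteDimensional ℝ V] in
theorem contDiff_evalQ_right (H : SymAmb V N) (l : ℕ) : ContDiff ℝ ω (evalQ gg H l) :=
  ContDiff.comp (g := fun q : SymAmb V N × V => evalQ gg q.1 l q.2) (f := fun ξ => (H, ξ))
    (contDiff_evalQ l) (contDiff_const.prodMk contDiff_id)

omit [FiniteDimensional ℝ V] in
theorem contDiff_mapQ : ContDiff ℝ ω (mapQ (V := V) gg N) :=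
  contDiff_pi.mpr fun i => (contDiff_polarize_param (contDiff_evalQ (i + 2))).const_smul _

variable (hsymm : ∀ x y, gg x y = gg y x) (hnd : ∀ x, (∀ y, gg x y = 0) → x = 0)
include hsymm hnd

theorem evalQ_apply {H : SymAmb V N} (hH : H ∈ normalSum V N) (l : ℕ) (ξ x y : V) :
    evalQ gg H l ξ x y = ∑ i ∈ Finset.range (l + 1), (l.choose i : ℝ) *
      gg (FreeAlgebra.lift ℝ (endOf gg H ξ) (Qtilde (l - i)) x)
        (FreeAlgebra.lift ℝ (endOf gg H ξ) (Qtilde i) y) :=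
  lift_Qpoly_apply (endOf_selfAdjoint hsymm hnd hH ξ) l x y

theorem evalQ_symm {H : SymAmb V N} (hH : H ∈ normalSum V N) (l : ℕ) (ξ x y : V) :
    evalQ gg H l ξ x y = evalQ gg H l ξ y x := by
  rw [evalQ_apply hsymm hnd hH, evalQ_apply hsymm hnd hH, ← Finset.sum_range_reflect]
  refine Finset.sum_congr rfl fun i hi => ?_
  have hi : i ≤ l := Nat.lt_succ_iff.mp (Finset.mem_range.mp hi)
  rw [hsymm, show l + 1 - 1 - i = l - i by omega, Nat.choose_symm hi, Nat.sub_sub_self hi]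

theorem evalQ_kernel {H : SymAmb V N} (hH : H ∈ normalSum V N) {l : ℕ} (hl : 0 < l) (ξ y : V) :
    evalQ gg H l ξ ξ y = 0 := by
  rw [evalQ_apply hsymm hnd hH]
  refine Finset.sum_eq_zero fun i hi => ?_
  rcases Nat.lt_or_ge i l with h | h
  · rw [lift_Qtilde_kernel (endOf_kernel hnd hH ξ) (by omega), map_zero, zero_apply, mul_zero]
  · have : i = l := by have := Finset.mem_range.mp hi; omega
    subst this
    rw [Nat.sub_self, Qtilde_zero, map_one, one_apply_eq_self,
      inner_lift_Qtilde_kernel (endOf_selfAdjoint hsymm hnd hH ξ) (endOf_kernel hnd hH ξ) hl,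
      mul_zero]

theorem evalQ_smul {H : SymAmb V N} (hH : H ∈ normalSum V N) (l : ℕ) (t : ℝ) (ξ : V) :
    evalQ gg H l (t • ξ) = t ^ l • evalQ gg H l ξ := by
  ext x y
  rw [smul_apply, smul_apply, evalQ_apply hsymm hnd hH, evalQ_apply hsymm hnd hH, Finset.smul_sum]
  refine Finset.sum_congr rfl fun i hi => ?_
  have hi : i ≤ l := Nat.lt_succ_iff.mp (Finset.mem_range.mp hi)
  rw [lift_Qtilde_homogeneous (endOf_smul H t ξ), lift_Qtilde_homogeneous (endOf_smul H t ξ)]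
  simp only [smul_apply, map_smul, smul_eq_mul]
  rw [← Nat.sub_add_cancel hi, pow_add, Nat.add_sub_cancel]
  ring

theorem polarize_evalQ_diag {H : SymAmb V N} (hH : H ∈ normalSum V N) (l : ℕ) (ξ : V) :
    polarize l (evalQ gg H l) (fun _ => ξ) = evalQ gg H l ξ :=
  polarize_diag_of_homogeneous (contDiff_evalQ_right H l) (evalQ_smul hsymm hnd hH l) ξ

theorem mapQ_diag {H : SymAmb V N} (hH : H ∈ normalSum V N) (i : Fin N) (ξ : V) :
    mapQ gg N H i (fun _ => ξ)
      = (((i + 2 : ℕ).factorial : ℝ)⁻¹) • evalQ gg H (i + 2) ξ := by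
  rw [mapQ, smul_apply, polarize_evalQ_diag hsymm hnd hH]

theorem polarize_evalQ_mem {H : SymAmb V N} (hH : H ∈ normalSum V N) {l : ℕ} (hl : 0 < l) :
    polarize l (evalQ gg H l) ∈ normalSpace V l :=
  polarize_mem_normalSpace (contDiff_evalQ_right H l)
    (polarize_evalQ_diag hsymm hnd hH l) (evalQ_symm hsymm hnd hH l)
    (evalQ_kernel hsymm hnd hH hl)

theorem mapQ_mem {H : SymAmb V N} (hH : H ∈ normalSum V N) : mapQ gg N H ∈ normalSum V N :=
  fun i => Submodule.smul_mem (normalSpace V (i + 2)) _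
    (polarize_evalQ_mem hsymm hnd hH (l := i + 2) (by omega))

theorem evalQ_congr {N' : ℕ} {H : SymAmb V N} {H' : SymAmb V N'} (hH : H ∈ normalSum V N)
    (hH' : H' ∈ normalSum V N') {l : ℕ} {ξ : V}
    (h : ∀ j, j + 2 ≤ l → endOf gg H ξ j = endOf gg H' ξ j) :
    evalQ gg H l ξ = evalQ gg H' l ξ := by
  ext x y
  rw [evalQ_apply hsymm hnd hH, evalQ_apply hsymm hnd hH']
  refine Finset.sum_congr rfl fun i hi => ?_
  have hi : i ≤ l := Nat.lt_succ_iff.mp (Finset.mem_range.mp hi)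
  rw [lift_Qtilde_congr fun j hj => h j (by omega), lift_Qtilde_congr fun j hj => h j (by omega)]

/-- `Q_l` contains no generator of degree greater than `l`, so the lower components of the result do
not see the highest one. -/
theorem truncSym_mapQ {k : ℕ} {H : SymAmb V (k + 1)} (hH : H ∈ normalSum V (k + 1)) :
    truncSym V k (mapQ gg (k + 1) H) = mapQ gg k (truncSym V k H) := by
  refine normalSum_ext (truncSym_mem (mapQ_mem hsymm hnd hH))
    (mapQ_mem hsymm hnd (truncSym_mem hH)) fun i ξ x y => ?_
  rw [mapQ_diag hsymm hnd (truncSym_mem hH)]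
  change mapQ gg (k + 1) H i.castSucc (fun _ => ξ) x y = _
  rw [mapQ_diag hsymm hnd hH]
  have h : evalQ gg H (i + 2) ξ = evalQ gg (truncSym V k H) (i + 2) ξ := by
    refine evalQ_congr hsymm hnd hH (truncSym_mem hH) fun j hj => ?_
    have := i.isLt
    simp only [endOf, show j < k + 1 by omega, show j < k by omega, dif_pos]
    rfl
  exact congrArg (fun β : BForm V => ((((i + 2 : ℕ).factorial : ℝ)⁻¹) • β) x y) h

/-- The factor by which `Q` acts on the fibre `𝒩_{k+2}`. -/
noncomputable def qFactor (k : ℕ) : ℝ :=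
  (((k + 2).factorial : ℝ)⁻¹) * (2 * qCoeff (k + 1) k)

omit hsymm hnd in
-- The value is `-2(k+1) / ((k+3) (k+2)!)`; for `k = 0` it is the classical `-1/3`.
theorem qFactor_ne_zero (k : ℕ) : qFactor k ≠ 0 := by
  have h1 : ((k + 2).factorial : ℝ) ≠ 0 := by exact_mod_cast (k + 2).factorial_ne_zero
  have h2 : qCoeff (k + 1) k ≠ 0 := by
    have h3 : (k : ℝ) + 1 ≠ 0 := by positivity
    have h4 : (k : ℝ) + 2 ≠ 0 := by positivity
    have h5 : (k : ℝ) + 1 + 1 ≠ 0 := by positivity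
    have h6 : (k : ℝ) + 1 + 2 ≠ 0 := by positivity
    simp only [qCoeff, show k + 1 + 1 = k + 2 from rfl, Nat.choose_self]
    push_cast
    simp [h3, h4, h5, h6]
  simp [qFactor, h1, h2]

/-- The generator `X_{k+2}` occurs only in the two extreme summands of `Q_{k+2}`, where one factor
is `Q̃_{k+2}` and the other is `1`. Both contribute the same multiple of `v` because `v` is
symmetric. -/
theorem evalQ_add_topSym {k : ℕ} {H : SymAmb V (k + 1)} (hH : H ∈ normalSum V (k + 1))
    {v : V [×(k + 2)]→L[ℝ] BForm V} (hv : v ∈ normalSpace V (k + 2)) (ξ x y : V) :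
    evalQ gg (H + topSym V k v) (k + 2) ξ x y
      = evalQ gg H (k + 2) ξ x y + 2 * qCoeff (k + 1) k * v (fun _ => ξ) x y := by
  have hH' := normalSum_add hH (topSym_mem hv)
  rw [evalQ_apply hsymm hnd hH', evalQ_apply hsymm hnd hH]
  have hlow : ∀ j, j < k → endOf gg (H + topSym V k v) ξ j = endOf gg H ξ j := by
    intro j hj
    simp only [endOf, show j < k + 1 by omega, dif_pos]
    have : (H + topSym V k v) ⟨j, by omega⟩ = H ⟨j, by omega⟩ := by
      have := topSym_castSucc k v ⟨j, hj⟩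
      rw [Pi.add_apply]
      exact (congrArg (H ⟨j, by omega⟩ + ·) this).trans (add_zero _)
    rw [this]
  have htop : ∀ x y, gg ((endOf gg (H + topSym V k v) ξ k - endOf gg H ξ k) x) y
      = v (fun _ => ξ) x y := by
    intro x y
    rw [sub_apply, map_sub, sub_apply, endOf_apply hnd, endOf_apply hnd, dif_pos (by omega),
      dif_pos (by omega)]
    have := topSym_last k v
    change (H (Fin.last k) + topSym V k v (Fin.last k)) (fun _ => ξ) x y
      - H (Fin.last k) (fun _ => ξ) x y = _
    rw [this]
    simp
  have hq : ∀ i, i < k + 2 → FreeAlgebra.lift ℝ (endOf gg (H + topSym V k v) ξ) (Qtilde i)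
      = FreeAlgebra.lift ℝ (endOf gg H ξ) (Qtilde i) := fun i hi =>
    lift_Qtilde_congr fun j hj => hlow j (by omega)
  have hsplit : ∀ f : ℕ → ℝ, ∑ i ∈ Finset.range (k + 2 + 1), f i
      = ∑ i ∈ Finset.range (k + 1), f (i + 1) + f 0 + f (k + 2) := fun f => by
    rw [Finset.sum_range_succ, Finset.sum_range_succ']
  rw [hsplit, hsplit]
  have hs : ∑ i ∈ Finset.range (k + 1), ((k + 2).choose (i + 1) : ℝ) *
      gg (FreeAlgebra.lift ℝ (endOf gg (H + topSym V k v) ξ) (Qtilde (k + 2 - (i + 1))) x)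
        (FreeAlgebra.lift ℝ (endOf gg (H + topSym V k v) ξ) (Qtilde (i + 1)) y)
      = ∑ i ∈ Finset.range (k + 1), ((k + 2).choose (i + 1) : ℝ) *
      gg (FreeAlgebra.lift ℝ (endOf gg H ξ) (Qtilde (k + 2 - (i + 1))) x)
        (FreeAlgebra.lift ℝ (endOf gg H ξ) (Qtilde (i + 1)) y) := by
    refine Finset.sum_congr rfl fun i hi => ?_
    have := Finset.mem_range.mp hi
    rw [hq _ (by omega), hq _ (by omega)]
  rw [hs]
  simp only [Nat.sub_self, Nat.sub_zero, Qtilde_zero, map_one, one_apply_eq_self,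
    Nat.choose_self, Nat.choose_zero_right, Nat.cast_one, one_mul, lift_Qtilde_top hlow]
  simp only [add_apply, map_add, smul_apply, map_smul, smul_eq_mul]
  rw [hsymm x ((endOf gg (H + topSym V k v) ξ k - endOf gg H ξ k) y), htop, htop,
    hv.2.1 _ y x]
  ring

theorem mapQ_add_topSym {k : ℕ} {H : SymAmb V (k + 1)} (hH : H ∈ normalSum V (k + 1))
    {v : V [×(k + 2)]→L[ℝ] BForm V} (hv : v ∈ normalSpace V (k + 2)) :
    mapQ gg (k + 1) (H + topSym V k v) = mapQ gg (k + 1) H + topSym V k (qFactor k • v) := by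
  have hH' := normalSum_add hH (topSym_mem hv)
  have ht : truncSym V k (mapQ gg (k + 1) H)
      = truncSym V k (mapQ gg (k + 1) (H + topSym V k v)) := by
    rw [truncSym_mapQ hsymm hnd hH, truncSym_mapQ hsymm hnd hH', truncSym_add_topSym]
  rw [eq_add_topSym ht]
  congr 2
  refine eq_of_diag_eq (fun σ w => ?_) (fun σ w => ?_) fun ξ => ?_
  · rw [sub_apply, sub_apply, (mapQ_mem hsymm hnd hH' (Fin.last k)).1,
      (mapQ_mem hsymm hnd hH (Fin.last k)).1]
  · exact congrArg (qFactor k • ·) (hv.1 σ w)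
  · rw [sub_apply, mapQ_diag hsymm hnd hH', mapQ_diag hsymm hnd hH, ← smul_sub, smul_apply,
      qFactor, mul_smul]
    congr 1
    ext x y
    rw [sub_apply, sub_apply]
    exact sub_eq_iff_eq_add'.mpr (evalQ_add_topSym hsymm hnd hH hv ξ x y)

/-- Triangularity: the truncations agree by induction, and on a fibre `Q` is a translation by a
non-zero multiple. -/
theorem mapQ_injOn : Set.InjOn (mapQ gg N) (normalSum V N) := by
  induction N with
  | zero => exact fun a _ b _ _ => Subsingleton.elim a b
  | succ k ih =>
    intro a ha b hb hab
    have h1 : truncSym V k a = truncSym V k b := ih (truncSym_mem ha) (truncSym_mem hb) (by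
      rw [← truncSym_mapQ hsymm hnd ha, ← truncSym_mapQ hsymm hnd hb, hab])
    have h2 := eq_add_topSym h1
    rw [h2, mapQ_add_topSym hsymm hnd ha
      (Submodule.sub_mem _ (hb (Fin.last k)) (ha (Fin.last k)))] at hab
    have h3 := congrFun hab (Fin.last k)
    rw [Pi.add_apply, topSym_last, left_eq_add] at h3
    have h4 := inv_smul_smul₀ (qFactor_ne_zero k)
      ((b (Fin.last k) - a (Fin.last k) : V [×(k + 2)]→L[ℝ] BForm V))
    rw [h3, smul_zero] at h4
    rw [h2, ← h4, map_zero, add_zero]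

end MapQ

/-! ## Jacobi fields in normal coordinates -/

section Jacobi

variable {V : Type*} [NormedAddCommGroup V] [NormedSpace ℝ V] [FiniteDimensional ℝ V]
  {g : V → BForm V} {U : Set V} {ξ : V}

/-- The coordinates are normal: the rays through the origin satisfy `g_ξ(ξ, ·) = g₀(ξ, ·)`. -/
structure IsNormalMetricOn (g : V → BForm V) (U : Set V) : Prop extends IsMetricOn g U where
  radial : ∀ ξ y, g ξ ξ y = g 0 ξ y

omit [FiniteDimensional ℝ V] in
theorem hasDerivAt_ray (ξ : V) (t : ℝ) : HasDerivAt (fun s : ℝ => s • ξ) ξ t := by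
  simpa using (hasDerivAt_id t).smul_const ξ

omit [FiniteDimensional ℝ V] in
theorem hasDerivAt_comp_ray {F : Type*} [NormedAddCommGroup F] [NormedSpace ℝ F] {f : V → F}
    {t : ℝ} (hf : DifferentiableAt ℝ f (t • ξ)) :
    HasDerivAt (fun s : ℝ => f (s • ξ)) (fderiv ℝ f (t • ξ) ξ) t :=
  hf.hasFDerivAt.comp_hasDerivAt t (hasDerivAt_ray ξ t)

variable (hg : IsNormalMetricOn g U)
include hg

omit [FiniteDimensional ℝ V] in
theorem IsNormalMetricOn.apply_smul (t : ℝ) (ξ y : V) : g (t • ξ) ξ y = g 0 ξ y := by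
  by_cases ht : t = 0
  · simp [ht]
  · have h := hg.radial (t • ξ) y
    simp only [map_smul, smul_apply, smul_eq_mul] at h
    exact mul_left_cancel₀ ht h

theorem IsNormalMetricOn.fderiv_radial {t : ℝ} (h : t • ξ ∈ U) (y : V) :
    fderiv ℝ g (t • ξ) ξ ξ y = 0 := by
  have h1 := ((hasDerivAt_comp_ray (hg.differentiableAt h)).clm_apply
    (hasDerivAt_const t ξ)).clm_apply (hasDerivAt_const t y)
  have h2 : HasDerivAt (fun s : ℝ => g (s • ξ) ξ y) (fderiv ℝ g (t • ξ) ξ ξ y) t := by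
    refine h1.congr_deriv ?_
    simp only [map_zero, add_zero]
  have h3 : HasDerivAt (fun s : ℝ => g (s • ξ) ξ y) 0 t := by
    simp only [hg.apply_smul]
    exact hasDerivAt_const t _
  exact h2.unique h3

theorem IsNormalMetricOn.fderiv_apply_radial {t : ℝ} (h : t • ξ ∈ U) (z : V) :
    fderiv ℝ g (t • ξ) z ξ ξ = 0 := by
  by_cases ht : t = 0
  -- At the origin every direction is radial, so the preceding lemma may be polarized.
  · subst ht
    have e0 : ∀ ζ : V, (0 : ℝ) • ζ ∈ U := fun ζ => by simpa using h
    have h1 := hg.fderiv_radial (e0 (ξ + z)) ξ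
    have h2 := hg.fderiv_radial (e0 ξ) ξ
    have h3 := hg.fderiv_radial (e0 z) ξ
    have h4 := hg.fderiv_radial (e0 ξ) z
    simp only [zero_smul, map_add, add_apply] at h1 h2 h3 h4 ⊢
    have hU : (0 : V) ∈ U := by simpa using h
    rw [hg.fderiv_symm hU ξ z ξ] at h1
    linarith
  · have hl := hasDerivAt_line (t • ξ) z
    have h2 := ((hasDerivAt_comp_line (hg.differentiableAt h) z).clm_apply hl).clm_apply hl
    have h3 : HasDerivAt (fun s : ℝ => g (t • ξ + s • z) (t • ξ + s • z) (t • ξ + s • z))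
        (g 0 z (t • ξ) + g 0 (t • ξ) z) 0 := by
      simp only [hg.radial]
      have := ((hasDerivAt_const (0 : ℝ) (g 0)).clm_apply hl).clm_apply hl
      exact this.congr_deriv (by simp)
    have h4 := h2.unique h3
    simp only [zero_smul, add_zero, map_smul, add_apply, smul_apply, smul_eq_mul,
      hg.symm _ z ξ, hg.apply_smul] at h4
    have h5 : t * (t * fderiv ℝ g (t • ξ) z ξ ξ) = 0 := by linarith
    exact (mul_eq_zero.mp ((mul_eq_zero.mp h5).resolve_left ht)).resolve_left ht

/-- The rays through the origin are geodesics. -/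
theorem IsNormalMetricOn.christoffel_radial {t : ℝ} (h : t • ξ ∈ U) :
    christoffel g (t • ξ) ξ ξ = 0 := by
  refine hg.ext h fun z => ?_
  rw [hg.christoffel_spec h, koszul_apply, hg.fderiv_radial h, hg.fderiv_apply_radial h]
  simp

/-- For `t ≠ 0`, differentiate `Γ_ζ(ζ, ζ) = 0` at `ζ = tξ` and divide by `t`; for `t = 0`, polarize.
This enters the Jacobi equation for `t x`. -/
theorem IsNormalMetricOn.fderiv_christoffel_radial {t : ℝ} (h : t • ξ ∈ U) (x : V) :
    t • fderiv ℝ (christoffel g) (t • ξ) x ξ ξ = -(2 : ℝ) • christoffel g (t • ξ) ξ x := by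
  by_cases ht : t = 0
  · subst ht
    have e0 : ∀ ζ : V, (0 : ℝ) • ζ ∈ U := fun ζ => by simpa using h
    have h1 := hg.christoffel_radial (e0 (ξ + x))
    have h2 := hg.christoffel_radial (e0 ξ)
    have h3 := hg.christoffel_radial (e0 x)
    simp only [zero_smul, map_add, add_apply] at h1 h2 h3 ⊢
    have hU : (0 : V) ∈ U := by simpa using h
    rw [h2, h3, hg.christoffel_comm hU x ξ, zero_add, add_zero, ← two_smul ℝ] at h1
    rw [neg_smul, h1, neg_zero]
  · have hl := hasDerivAt_line (t • ξ) x
    have h2 := ((hasDerivAt_comp_line ((hg.contDiffAt_christoffel h).differentiableAt (by simp))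
      x).clm_apply hl).clm_apply hl
    have h3 : (fun s : ℝ => christoffel g (t • ξ + s • x) (t • ξ + s • x) (t • ξ + s • x))
        =ᶠ[𝓝 0] fun _ => 0 := by
      filter_upwards [hg.eventually_line h x] with s hs
      have := hg.christoffel_radial (t := 1) (ξ := t • ξ + s • x) (by simpa using hs)
      simpa using this
    have h4 := (h2.congr_of_eventuallyEq h3.symm).unique (hasDerivAt_const 0 0)
    simp only [zero_smul, add_zero, map_smul, add_apply, smul_apply, hg.christoffel_comm h x ξ]
      at h4
    have h5 : t • (t • fderiv ℝ (christoffel g) (t • ξ) x ξ ξ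
        + (2 : ℝ) • christoffel g (t • ξ) ξ x) = 0 := by
      rw [smul_add, ← h4]
      module
    have h6 := (smul_eq_zero.mp h5).resolve_left ht
    rw [neg_smul]
    exact eq_neg_of_add_eq_zero_left h6

omit hg in
/-- The `m`-th covariant derivative of the Jacobi field `t ↦ t x` along the ray `t ↦ t ξ`, as
prescribed by the Jacobi equation. -/
noncomputable def jacobiDeriv (g : V → BForm V) (ξ x : V) : ℕ → ℝ → V
  | 0 => fun t => t • x
  | 1 => fun t => x + t • christoffel g (t • ξ) ξ x
  | m + 2 => fun t => -∑ i : Fin (m + 1), (m.choose i : ℝ) •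
      curvEndList g (t • ξ) (List.replicate i ξ) (jacobiDeriv g ξ x (m - i) t) ξ ξ
  termination_by m => m
  decreasing_by omega

omit hg in
theorem jacobiDeriv_add_two (x : V) (m : ℕ) (t : ℝ) : jacobiDeriv g ξ x (m + 2) t
    = -∑ ij ∈ Finset.HasAntidiagonal.antidiagonal m, m.choose ij.1 •
      curvEndList g (t • ξ) (List.replicate ij.1 ξ) (jacobiDeriv g ξ x ij.2 t) ξ ξ := by
  rw [jacobiDeriv, Finset.Nat.sum_antidiagonal_eq_sum_range_succ
    (f := fun i j => m.choose i • curvEndList g (t • ξ) (List.replicate i ξ)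
      (jacobiDeriv g ξ x j t) ξ ξ), Finset.sum_range]
  simp only [← Nat.cast_smul_eq_nsmul ℝ]

/-- The prescribed sequence really consists of successive covariant derivatives. From order two on
it is the Leibniz expansion of `-R(J, ξ)ξ`; since `ξ` is parallel along the ray, its derivative is
again of this form by Pascal's rule. -/
theorem IsNormalMetricOn.hasDerivAt_jacobiDeriv (x : V) (m : ℕ) {t : ℝ} (ht : t • ξ ∈ U) :
    HasDerivAt (jacobiDeriv g ξ x m)
      (jacobiDeriv g ξ x (m + 1) t - christoffel g (t • ξ) ξ (jacobiDeriv g ξ x m t)) t := by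
  have hc := hasDerivAt_ray ξ t
  induction m using Nat.strong_induction_on with
  | _ m ih =>
    match m with
    | 0 =>
      have e : jacobiDeriv g ξ x 0 = fun t => t • x := by funext t; rw [jacobiDeriv]
      have h := (hasDerivAt_id t).smul_const x
      rw [e]
      refine h.congr_deriv ?_
      rw [jacobiDeriv, map_smul]
      simp
    -- This case is the Jacobi equation. It holds because `t x` is the variation field of the
    -- geodesics `t(ξ + s x)`; here it is verified from the radial identities for `Γ` and its
    -- derivative.
    | 1 =>
      have e : jacobiDeriv g ξ x 1 = fun t => x + t • christoffel g (t • ξ) ξ x := by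
        funext t; rw [jacobiDeriv]
      have h1 := hasDerivAt_comp_ray ((hg.contDiffAt_christoffel ht).differentiableAt
        (by simp))
      have h := ((hasDerivAt_id t).smul ((h1.clm_apply (hasDerivAt_const t ξ)).clm_apply
        (hasDerivAt_const t x))).const_add x
      rw [e]
      refine h.congr_deriv ?_
      rw [jacobiDeriv_add_two]
      simp only [Finset.Nat.antidiagonal_zero, Finset.sum_singleton, Nat.choose_self, one_smul,
        List.replicate_zero, hg.curvEndList_nil ht, jacobiDeriv, curvEnd, map_smul, smul_apply,
        hg.christoffel_radial ht, hg.fderiv_christoffel_radial ht, map_zero, map_add, id,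
        add_zero, hg.christoffel_comm ht x ξ,
        hg.fderiv_christoffel_comm ht ξ x ξ]
      module
    | m + 2 =>
      have e : jacobiDeriv g ξ x (m + 2) = fun t => -∑ ij ∈ Finset.HasAntidiagonal.antidiagonal m,
          m.choose ij.1 • curvEndList g (t • ξ) (List.replicate ij.1 ξ)
            (jacobiDeriv g ξ x ij.2 t) ξ ξ := by
        funext t; exact jacobiDeriv_add_two x m t
      have hterm : ∀ ij ∈ Finset.HasAntidiagonal.antidiagonal m, HasDerivAt (fun s : ℝ => m.choose ij.1 •
          curvEndList g (s • ξ) (List.replicate ij.1 ξ) (jacobiDeriv g ξ x ij.2 s) ξ ξ)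
          (m.choose ij.1 • (curvEndList g (t • ξ) (List.replicate (ij.1 + 1) ξ)
              (jacobiDeriv g ξ x ij.2 t) ξ ξ
            + curvEndList g (t • ξ) (List.replicate ij.1 ξ) (jacobiDeriv g ξ x (ij.2 + 1) t) ξ ξ
            - christoffel g (t • ξ) ξ (curvEndList g (t • ξ) (List.replicate ij.1 ξ)
              (jacobiDeriv g ξ x ij.2 t) ξ ξ))) t := by
        intro ij hij
        have hij := Finset.HasAntidiagonal.mem_antidiagonal.mp hij
        have h := hg.hasDerivAt_curvEndList (c := fun s : ℝ => s • ξ) ht hc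
          (A := List.replicate ij.1 ξ) (f := fun a _ => a) (fun a ha => by
            rw [List.eq_of_mem_replicate ha, hg.christoffel_radial ht, neg_zero]
            exact hasDerivAt_const _ _) (ih ij.2 (by omega)) (hasDerivAt_const t ξ)
          (hasDerivAt_const t ξ)
        have h2 := h.const_smul (m.choose ij.1 : ℝ)
        simp only [List.map_id', Nat.cast_smul_eq_nsmul ℝ, hg.christoffel_radial ht, add_zero,
          sub_add_cancel] at h2
        refine h2.congr_deriv ?_
        rw [hg.curvEndList_eq_zero (z := 0) ht _ (by simp),
          hg.curvEndList_eq_zero (u := 0) ht _ (by simp)]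
        simp only [add_zero, List.replicate_succ]
      have h := (HasDerivAt.fun_sum hterm).fun_neg
      rw [e]
      refine h.congr_deriv ?_
      rw [show m + 2 + 1 = (m + 1) + 2 from rfl, jacobiDeriv_add_two,
        Finset.sum_antidiagonal_choose_succ_nsmul (fun i j =>
          curvEndList g (t • ξ) (List.replicate i ξ) (jacobiDeriv g ξ x j t) ξ ξ)]
      simp only [smul_sub, smul_add, Finset.sum_sub_distrib, Finset.sum_add_distrib, map_neg,
        map_sum, map_nsmul]
      have hsymm : ∑ ij ∈ Finset.HasAntidiagonal.antidiagonal m, m.choose ij.2 •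
          curvEndList g (t • ξ) (List.replicate (ij.1 + 1) ξ) (jacobiDeriv g ξ x ij.2 t) ξ ξ
          = ∑ ij ∈ Finset.HasAntidiagonal.antidiagonal m, m.choose ij.1 •
          curvEndList g (t • ξ) (List.replicate (ij.1 + 1) ξ) (jacobiDeriv g ξ x ij.2 t) ξ ξ :=
        Finset.sum_congr rfl fun ij hij => by
          rw [Nat.choose_symm_of_eq_add (Finset.HasAntidiagonal.mem_antidiagonal.mp hij).symm]
      rw [hsymm]
      abel

/-- The Taylor coefficients of a metric in normal coordinates along a ray. -/
theorem IsNormalMetricOn.iteratedDeriv_inner (x y : V) (n : ℕ) {t : ℝ} (ht : t • ξ ∈ U) :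
    iteratedDeriv n (fun t : ℝ => t ^ 2 * g (t • ξ) x y) t
      = ∑ ij ∈ Finset.HasAntidiagonal.antidiagonal n, n.choose ij.1 •
        g (t • ξ) (jacobiDeriv g ξ x ij.1 t) (jacobiDeriv g ξ y ij.2 t) := by
  induction n generalizing t with
  | zero =>
    simp only [iteratedDeriv_zero, Finset.Nat.antidiagonal_zero, Finset.sum_singleton,
      Nat.choose_self, one_smul, jacobiDeriv, map_smul, smul_apply, smul_eq_mul]
    ring
  | succ n ih =>
    have hc := hasDerivAt_ray ξ t
    have hev : iteratedDeriv n (fun t : ℝ => t ^ 2 * g (t • ξ) x y) =ᶠ[𝓝 t]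
        fun t => ∑ ij ∈ Finset.HasAntidiagonal.antidiagonal n, n.choose ij.1 •
        g (t • ξ) (jacobiDeriv g ξ x ij.1 t) (jacobiDeriv g ξ y ij.2 t) := by
      filter_upwards [hc.continuousAt.preimage_mem_nhds (hg.isOpen.mem_nhds ht)] with s hs
      exact ih hs
    rw [iteratedDeriv_succ, hev.deriv_eq]
    have hterm : ∀ ij ∈ Finset.HasAntidiagonal.antidiagonal n, HasDerivAt (fun t : ℝ => n.choose ij.1 •
        g (t • ξ) (jacobiDeriv g ξ x ij.1 t) (jacobiDeriv g ξ y ij.2 t))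
        (n.choose ij.1 • (g (t • ξ) (jacobiDeriv g ξ x (ij.1 + 1) t) (jacobiDeriv g ξ y ij.2 t)
          + g (t • ξ) (jacobiDeriv g ξ x ij.1 t) (jacobiDeriv g ξ y (ij.2 + 1) t))) t := by
      intro ij _
      have h := (hg.hasDerivAt_inner (c := fun s : ℝ => s • ξ) ht hc
        (hg.hasDerivAt_jacobiDeriv x ij.1 ht)
        (hg.hasDerivAt_jacobiDeriv y ij.2 ht)).const_mul (n.choose ij.1 : ℝ)
      simpa only [sub_add_cancel, nsmul_eq_mul] using h
    rw [(HasDerivAt.fun_sum hterm).deriv, Finset.sum_antidiagonal_choose_succ_nsmul (fun i j =>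
      g (t • ξ) (jacobiDeriv g ξ x i t) (jacobiDeriv g ξ y j t))]
    simp only [smul_add, Finset.sum_add_distrib]
    rw [add_comm]
    congr 1
    exact Finset.sum_congr rfl fun ij hij => by
      rw [Nat.choose_symm_of_eq_add (Finset.HasAntidiagonal.mem_antidiagonal.mp hij).symm]

omit hg in
-- The coefficients of `Q̃` are made for this: the Jacobi recursion has the factor `k.choose i`, and
-- the derivative of order `k - i` at `0` brings the further factor `k - i`.
theorem choose_qCoeff (k i : ℕ) :
    (((k + 1 : ℕ) : ℝ) + 1) * qCoeff k i = -((k.choose i : ℝ) * ((k - i : ℕ) : ℝ)) := by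
  have h1 := Nat.add_one_mul_choose_eq k (i + 1)
  have h2 := Nat.choose_succ_right_eq k i
  have h1' : ((k : ℝ) + 1) * (k.choose (i + 1) : ℝ)
      = ((k + 1).choose (i + 2) : ℝ) * ((i : ℝ) + 2) := by
    have := congrArg (Nat.cast : ℕ → ℝ) h1
    push_cast at this
    rw [this]
    ring
  have h2' : (k.choose (i + 1) : ℝ) * ((i : ℝ) + 1) = (k.choose i : ℝ) * ((k - i : ℕ) : ℝ) := by
    have := congrArg (Nat.cast : ℕ → ℝ) h2
    rw [Nat.cast_mul, Nat.cast_mul] at this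
    rw [← this]
    push_cast
    ring
  rw [← h2', qCoeff]
  have h3 : (k : ℝ) + 1 ≠ 0 := by positivity
  have h4 : (k : ℝ) + 2 ≠ 0 := by positivity
  push_cast
  field_simp
  linear_combination ((k : ℝ) + 2) * h1'

theorem IsNormalMetricOn.jacobiDeriv_zero (h0 : (0 : V) ∈ U) {a : ℕ → V →L[ℝ] V} {M : ℕ}
    (ha : ∀ j, j + 2 ≤ M → ∀ u, a j u = curvEndList g 0 (List.replicate j ξ) u ξ ξ) (x : V)
    {k : ℕ} (hk : k ≤ M) : jacobiDeriv g ξ x (k + 1) 0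
      = ((k : ℝ) + 1) • FreeAlgebra.lift ℝ a (Qtilde k) x := by
  induction k using Nat.strong_induction_on with
  | _ k ih =>
    match k with
    | 0 => simp [jacobiDeriv, Qtilde_zero]
    | k + 1 =>
      rw [jacobiDeriv, lift_Qtilde_succ]
      beta_reduce
      rw [Fin.sum_univ_castSucc]
      -- The last summand contains the Jacobi field itself, which vanishes at `t = 0`. The others
      -- match the recursion of `Q̃` term by term.
      have hlast : curvEndList g ((0 : ℝ) • ξ) (List.replicate (Fin.last k : ℕ) ξ)
          (jacobiDeriv g ξ x (k - (Fin.last k : ℕ)) 0) ξ ξ = 0 := by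
        refine hg.curvEndList_eq_zero (by simpa using h0) _ (Or.inl ?_)
        simp [jacobiDeriv]
      rw [hlast, smul_zero, add_zero, sum_apply, Finset.smul_sum, ← Finset.sum_neg_distrib]
      refine Finset.sum_congr rfl fun i _ => ?_
      have hi := i.isLt
      have h1 := ih (k - 1 - i) (by omega) (by omega)
      rw [show k - 1 - (i : ℕ) + 1 = k - i by omega] at h1
      rw [Fin.val_castSucc, h1, zero_smul, ← ha i (by omega), map_smul, smul_apply,
        mul_apply_eq_comp, smul_smul, smul_smul, ← neg_smul, choose_qCoeff]
      congr 3
      have : ((k - i : ℕ) : ℝ) = ((k - 1 - i : ℕ) : ℝ) + 1 := by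
        rw [← Nat.cast_add_one]; congr 1; omega
      rw [this]

end Jacobi

/-! ## The maps `R` and `𝓡` -/

section Maps

variable {V : Type*} [NormedAddCommGroup V] [NormedSpace ℝ V] {gg : BForm V} {N : ℕ}

theorem contDiff_metricOf : ContDiff ℝ ω fun q : SymAmb V N × V => metricOf gg q.1 q.2 := by
  refine contDiff_const.add (ContDiff.sum fun i _ => ?_)
  refine contDiff_iff_contDiffAt.mpr fun q => contDiffAt_multilinear_apply ?_ fun _ => ?_
  · exact (contDiff_pi.mp contDiff_fst i).contDiffAt
  · exact contDiffAt_snd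

theorem contDiff_metricOf_right (h : SymAmb V N) : ContDiff ℝ ω (metricOf gg h) :=
  contDiff_const.add (ContDiff.sum fun i _ =>
    (h i).contDiff.comp (contDiff_pi.mpr fun _ => contDiff_id))

theorem metricOf_zero (h : SymAmb V N) : metricOf gg h 0 = gg := by
  rw [metricOf, Finset.sum_eq_zero, add_zero]
  exact fun i _ => (h i).map_zero

theorem metricOf_apply (h : SymAmb V N) (ξ x y : V) :
    metricOf gg h ξ x y = gg x y + ∑ i : Fin N, h i (fun _ => ξ) x y := by
  simp [metricOf]

section FinDim

variable [FiniteDimensional ℝ V]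

theorem isNormalMetricOn_metricOf (hsymm : ∀ x y, gg x y = gg y x) {h : SymAmb V N}
    (hh : h ∈ normalSum V N) :
    IsNormalMetricOn (metricOf gg h) {ξ | (metricOf gg h ξ).IsInvertible} where
  isOpen := by
    have : CompleteSpace V := FiniteDimensional.complete ℝ V
    have h1 := (contDiff_metricOf_right (gg := gg) h).continuous
    have h2 : IsOpen {f : BForm V | f.IsInvertible} := by
      convert ContinuousLinearEquiv.isOpen (𝕜 := ℝ) (E := V) (F := V →L[ℝ] ℝ) using 1
      rfl
    exact h2.preimage h1
  smooth ξ _ := (contDiff_metricOf_right h).contDiffAt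
  symm ξ x y := by
    rw [metricOf_apply, metricOf_apply, hsymm]
    congr 1
    exact Finset.sum_congr rfl fun i _ => (hh i).2.1 _ x y
  inv ξ hξ := hξ
  radial ξ y := by
    rw [metricOf_zero, metricOf_apply, Finset.sum_eq_zero, add_zero]
    exact fun i _ => (hh i).2.2 ξ y

theorem mapR_mem (hsymm : ∀ x y, gg x y = gg y x) (hnd : ∀ x, (∀ y, gg x y = 0) → x = 0)
    {h : SymAmb V N} (hh : h ∈ normalSum V N) : mapR gg N h ∈ curvJets gg N := by
  have h1 := (isNormalMetricOn_metricOf hsymm hh).toIsMetricOn.isCurvJet (ξ := 0) (N := N) (by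
    simpa [metricOf_zero] using isInvertible_of_nondegenerate hnd)
  rwa [metricOf_zero] at h1

theorem contDiff_mapR (hnd : ∀ x, (∀ y, gg x y = 0) → x = 0) :
    ContDiff ℝ ω (mapR (V := V) gg N) := by
  refine contDiff_pi.mpr fun i => contDiff_iff_contDiffAt.mpr fun h => ?_
  have h1 := contDiffAt_nablaCurv_param (g := fun h : SymAmb V N => metricOf gg h) (q := (h, 0))
    contDiff_metricOf.contDiffAt (by
      simpa [metricOf_zero] using isInvertible_of_nondegenerate hnd) i
  exact h1.comp (f := fun h : SymAmb V N => (h, (0 : V))) h (contDiffAt_id.prodMk contDiffAt_const)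

theorem contDiff_jacobiForm_comp : ∀ i : Fin N, ContDiff ℝ ω
    fun q : JetAmb V N × V => jacobiForm (q.1 i) q.2 := by
  intro i
  refine contDiff_iff_contDiffAt.mpr fun q => contDiffAt_clm_of_apply fun x =>
    contDiffAt_clm_of_apply fun y => ?_
  simp only [jacobiForm_apply]
  refine contDiffAt_multilinear_apply (contDiff_pi.mp contDiff_fst i).contDiffAt fun j => ?_
  refine Fin.addCases (m := i) (n := 4) (fun j => ?_) (fun j => ?_) j
  · simp only [Fin.append_left]
    exact contDiffAt_snd
  · simp only [Fin.append_right]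
    match j with
    | 0 | 3 => exact contDiffAt_const
    | 1 | 2 => exact contDiffAt_snd

theorem contDiff_mapSym : ContDiff ℝ ω (mapSym (V := V) N) :=
  contDiff_pi.mpr fun i => contDiff_polarize_param (contDiff_jacobiForm_comp i)

end FinDim

theorem polarize_jacobiForm_diag {i : ℕ} (T : Tensor V (i + 4)) (ξ : V) :
    polarize (i + 2) (jacobiForm T) (fun _ => ξ) = jacobiForm T ξ :=
  polarize_diag (((T.domDomCongr (Equiv.swap (Fin.natAdd i 0) (Fin.natAdd i 2)) :
    Tensor V (i + 4)).curryRight).curryRight) ξ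

theorem contDiff_jacobiForm {i : ℕ} (T : Tensor V (i + 4)) : ContDiff ℝ ω (jacobiForm T) := by
  let H : V [×(i + 2)]→L[ℝ] BForm V :=
    ((T.domDomCongr (Equiv.swap (Fin.natAdd i 0) (Fin.natAdd i 2)) :
      Tensor V (i + 4)).curryRight).curryRight
  exact H.contDiff.comp (contDiff_pi.mpr fun _ => contDiff_id)

theorem polarize_jacobiForm_mem {i : ℕ} {T : Tensor V (i + 4)}
    (hT : ∀ x : Fin i → V, IsAlgCurv fun a b c d => T (Fin.append x ![a, b, c, d])) :
    polarize (i + 2) (jacobiForm T) ∈ normalSpace V (i + 2) := by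
  refine polarize_mem_normalSpace (contDiff_jacobiForm T) (polarize_jacobiForm_diag T)
    (fun ξ x y => ?_) fun ξ y => ?_
  · have h := hT fun _ => ξ
    rw [jacobiForm_apply, jacobiForm_apply]
    have h1 := h.pair x ξ ξ y
    have h2 := h.skew ξ y x ξ
    have h3 := h.pair y ξ x ξ
    have h4 := h.skew x ξ y ξ
    have h5 := h.pair ξ x y ξ
    linarith
  · have h1 := (hT fun _ => ξ).skew ξ ξ ξ y
    rw [jacobiForm_apply]
    linarith

theorem mapSym_diag (J : JetAmb V N) (i : Fin N) (ξ : V) :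
    mapSym N J i (fun _ => ξ) = jacobiForm (J i) ξ :=
  polarize_jacobiForm_diag (J i) ξ

theorem comp_val (J : JetAmb V N) (i : Fin N) : comp J (i : ℕ) = J i := by
  simp [comp]

theorem mapSym_mem {J : JetAmb V N} (hJ : J ∈ curvJets gg N) : mapSym N J ∈ normalSum V N := by
  intro i
  refine polarize_jacobiForm_mem fun x => ?_
  have h := hJ.algCurv i i.isLt x
  rwa [comp_val] at h

/-- Absorbs the factors `a + 1` and `b + 1` of the Jacobi derivatives, so that the binomials of
order `l + 2` in the Leibniz rule become those of `Q_l`. -/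
theorem succ_mul_succ_mul_choose {l a b : ℕ} (h : a + b = l) :
    (l + 2).choose (a + 1) * ((a + 1) * (b + 1)) = (l + 2) * (l + 1) * l.choose a := by
  have h1 := Nat.add_one_mul_choose_eq (l + 1) a
  have h2 := Nat.add_one_mul_choose_eq l b
  rw [Nat.choose_symm_of_eq_add (show l = a + b by omega)]
  rw [Nat.choose_symm_of_eq_add (show l + 1 = a + (b + 1) by omega)] at h1
  nlinarith

theorem iteratedDeriv_metricOf (h : SymAmb V N) (ξ x y : V) (i : Fin N) :
    iteratedDeriv (i + 4) (fun t : ℝ => t ^ 2 * metricOf gg h (t • ξ) x y) 0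
      = ((i + 4 : ℕ).factorial : ℝ) * h i (fun _ => ξ) x y := by
  have h1 : (fun t : ℝ => t ^ 2 * metricOf gg h (t • ξ) x y) = fun t : ℝ => gg x y * t ^ 2
      + ∑ j : Fin N, h j (fun _ => ξ) x y * t ^ (j + 4 : ℕ) := by
    funext t
    rw [metricOf_apply, mul_add, Finset.mul_sum, mul_comm]
    congr 1
    refine Finset.sum_congr rfl fun j _ => ?_
    have h2 := (h j).map_smul_univ (fun _ => t) fun _ => ξ
    simp only [Finset.prod_const, Finset.card_univ, Fintype.card_fin] at h2
    rw [h2, smul_apply, smul_apply, smul_eq_mul]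
    ring
  rw [h1, iteratedDeriv_fun_add (by fun_prop) (by fun_prop), iteratedDeriv_const_mul_field,
    iteratedDeriv_fun_sum (fun j _ => by fun_prop)]
  simp only [iteratedDeriv_const_mul_field, iteratedDeriv_fun_pow_zero]
  rw [Finset.sum_eq_single i]
  · simp [mul_comm]
  · intro j _ hj
    have : (i : ℕ) ≠ j := fun e => hj (Fin.ext e.symm)
    simp [this]
  · simp

/-! ### The composition of the three maps -/

section FinDim

variable [FiniteDimensional ℝ V]

variable (hsymm : ∀ x y, gg x y = gg y x) (hnd : ∀ x, (∀ y, gg x y = 0) → x = 0)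
include hsymm hnd

theorem endOf_mapSym_mapR {h : SymAmb V N} (hh : h ∈ normalSum V N) (ξ u : V) {j : ℕ}
    (hj : j < N) : endOf gg (mapSym N (mapR gg N h)) ξ j u
      = curvEndList (metricOf gg h) 0 (List.replicate j ξ) u ξ ξ := by
  have hg := isNormalMetricOn_metricOf hsymm hh
  have h0 : (0 : V) ∈ {ξ | (metricOf gg h ξ).IsInvertible} := by
    simpa [metricOf_zero] using isInvertible_of_nondegenerate hnd
  refine hg.ext h0 fun y => ?_
  rw [hg.curvEndList_spec h0, metricOf_zero, endOf_apply hnd, dif_pos hj, mapSym_diag,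
    jacobiForm_apply]
  exact nablaCurv_eq_nablaList _ _ (by rw [List.ofFn_fin_append, List.ofFn_const])

theorem mapQ_mapSym_mapR {h : SymAmb V N} (hh : h ∈ normalSum V N) :
    mapQ gg N (mapSym N (mapR gg N h)) = h := by
  have hS := mapSym_mem (mapR_mem hsymm hnd hh)
  refine normalSum_ext (mapQ_mem hsymm hnd hS) hh fun i ξ x y => ?_
  have hg := isNormalMetricOn_metricOf hsymm hh
  have h0 : (0 : V) ∈ {ξ | (metricOf gg h ξ).IsInvertible} := by
    simpa [metricOf_zero] using isInvertible_of_nondegenerate hnd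
  rw [mapQ_diag hsymm hnd hS, smul_apply, smul_apply, smul_eq_mul]
  set H := mapSym N (mapR gg N h) with hHdef
  have hJ : ∀ k ≤ (i + 2 : ℕ), ∀ x, jacobiDeriv (metricOf gg h) ξ x (k + 1) 0
      = ((k : ℝ) + 1) • FreeAlgebra.lift ℝ (endOf gg H ξ) (Qtilde k) x := fun k hk x =>
    hg.jacobiDeriv_zero h0 (M := i + 2)
      (fun j hj u => endOf_mapSym_mapR hsymm hnd hh ξ u (by omega)) x hk
  have hz : ∀ x, jacobiDeriv (metricOf gg h) ξ x 0 0 = 0 := fun x => by simp [jacobiDeriv]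
  have e1 := hg.iteratedDeriv_inner (ξ := ξ) x y (i + 2 + 1 + 1) (t := 0) (by simpa using h0)
  -- The order `i + 4` is the degree `i + 2` of `h i` plus two for the factor `t²`. The two extreme
  -- terms are split off and vanish because the Jacobi fields are zero at `t = 0`.
  rw [iteratedDeriv_metricOf, Finset.Nat.sum_antidiagonal_succ, Finset.Nat.sum_antidiagonal_succ']
    at e1
  simp only [hz, map_zero, zero_apply, smul_zero, zero_add, zero_smul, metricOf_zero] at e1
  have e2 : ∑ p ∈ Finset.HasAntidiagonal.antidiagonal (i + 2 : ℕ),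
      (i + 2 + 1 + 1 : ℕ).choose (p.1 + 1) • gg (jacobiDeriv (metricOf gg h) ξ x (p.1 + 1) 0)
        (jacobiDeriv (metricOf gg h) ξ y (p.2 + 1) 0)
      = ((i + 4 : ℕ) * (i + 3 : ℕ) : ℝ) * evalQ gg H (i + 2) ξ x y := by
    rw [evalQ_symm hsymm hnd hS, evalQ_apply hsymm hnd hS,
      ← Finset.Nat.sum_antidiagonal_eq_sum_range_succ (fun a b => ((i + 2 : ℕ).choose a : ℝ) *
      gg (FreeAlgebra.lift ℝ (endOf gg H ξ) (Qtilde b) y)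
        (FreeAlgebra.lift ℝ (endOf gg H ξ) (Qtilde a) x)), Finset.mul_sum]
    refine Finset.sum_congr rfl fun p hp => ?_
    have hp := Finset.HasAntidiagonal.mem_antidiagonal.mp hp
    have h3 := congrArg (Nat.cast : ℕ → ℝ) (succ_mul_succ_mul_choose hp)
    push_cast at h3
    rw [hJ _ (by omega), hJ _ (by omega), hsymm]
    simp only [map_smul, smul_apply, smul_eq_mul, nsmul_eq_mul]
    push_cast
    linear_combination gg (FreeAlgebra.lift ℝ (endOf gg H ξ) (Qtilde p.2) y)
        (FreeAlgebra.lift ℝ (endOf gg H ξ) (Qtilde p.1) x) * h3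
  rw [e2] at e1
  have h5 : ((i + 4 : ℕ).factorial : ℝ) = ((i + 4 : ℕ) * (i + 3 : ℕ) : ℝ) * (i + 2 : ℕ).factorial := by
    rw [Nat.factorial_succ, Nat.factorial_succ]
    push_cast
    ring
  rw [h5, mul_assoc] at e1
  have h6 := mul_left_cancel₀ (by positivity) e1
  rw [← h6, inv_mul_cancel_left₀ (by positivity)]

end FinDim

end Maps

/-! ## The symmetrized jet determines the jet -/

section Injectivity

variable {V : Type*} [NormedAddCommGroup V] [NormedSpace ℝ V] {gg : BForm V} {N k : ℕ}

theorem comp_topJet (T : Tensor V (k + 4)) : comp (topJet V k T) k = T := by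
  rw [comp, dif_pos (Nat.lt_succ_self k)]
  exact Pi.single_eq_same (M := fun i : Fin (k + 1) => Tensor V (i + 4)) (Fin.last k) T

/-- A Ricci identity of order `s + 2 + m` has a right-hand side of order at most `s + m`. Hence,
over a fixed truncation, the conditions on the top component are affine, with homogeneous part
`𝒞_k`. -/
theorem ricciRHS_congr {N' : ℕ} {J : JetAmb V N} {J' : JetAmb V N'} {s m : ℕ}
    (h : ∀ i ≤ s + m, comp J i = comp J' i) (x : Fin s → V) (y z : V) (w : Fin m → V)
    (r : Fin 4 → V) : ricciRHS gg J x y z w r = ricciRHS gg J' x y z w r := by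
  refine Finset.sum_congr rfl fun S _ => ?_
  have h1 : Sᶜ.card ≤ s := by simpa using Sᶜ.card_le_univ
  have h2 : S.card ≤ s := by simpa using S.card_le_univ
  rw [h (Sᶜ.card + m) (by omega), h S.card (by omega)]

theorem comp_truncJet {J : JetAmb V (k + 1)} {i : ℕ} (hi : i < k) :
    comp (truncJet V k J) i = comp J i := by
  rw [comp, comp, dif_pos hi, dif_pos (by omega)]
  rfl

theorem truncJet_mem {J : JetAmb V (k + 1)} (hJ : J ∈ curvJets gg (k + 1)) :
    truncJet V k J ∈ curvJets gg k := by
  refine ⟨fun i hi x => ?_, fun i hi x x₁ x₂ x₃ y₁ y₂ => ?_, fun s m h x y z w r => ?_⟩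
  · rw [comp_truncJet hi]
    exact hJ.algCurv i (by omega) x
  · rw [comp_truncJet hi]
    exact hJ.bianchi₂ i (by omega) x x₁ x₂ x₃ y₁ y₂
  · rw [comp_truncJet h, ricciRHS_congr (J' := J) fun i hi => comp_truncJet (by omega)]
    exact hJ.ricci s m (by omega) x y z w r

theorem add_topJet_mem {J : JetAmb V (k + 1)} (hJ : J ∈ curvJets gg (k + 1))
    {T : Tensor V (k + 4)} (hT : T ∈ linJet gg k) : J + topJet V k T ∈ curvJets gg (k + 1) := by
  refine ⟨fun i hi x => ⟨fun x₁ x₂ y₁ y₂ => ?_, fun x₁ x₂ y₁ y₂ => ?_, fun x₁ x₂ x₃ y => ?_⟩,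
    fun i hi x x₁ x₂ x₃ y₁ y₂ => ?_, fun s m h x y z w r => ?_⟩
  · have e1 := (hJ.algCurv i hi x).skew x₁ x₂ y₁ y₂
    have e2 := (hT.algCurv i hi x).skew x₁ x₂ y₁ y₂
    simp only [comp_add, add_apply] at e1 e2 ⊢
    linarith
  · have e1 := (hJ.algCurv i hi x).pair x₁ x₂ y₁ y₂
    have e2 := (hT.algCurv i hi x).pair x₁ x₂ y₁ y₂
    simp only [comp_add, add_apply] at e1 e2 ⊢
    linarith
  · have e1 := (hJ.algCurv i hi x).bianchi x₁ x₂ x₃ y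
    have e2 := (hT.algCurv i hi x).bianchi x₁ x₂ x₃ y
    simp only [comp_add, add_apply] at e1 e2 ⊢
    linarith
  · have e1 := hJ.bianchi₂ i hi x x₁ x₂ x₃ y₁ y₂
    have e2 := hT.bianchi₂ i hi x x₁ x₂ x₃ y₁ y₂
    simp only [comp_add, add_apply] at e1 e2 ⊢
    linarith
  · have e1 := hJ.ricci s m h x y z w r
    have e2 := hT.ricci s m h x y z w r
    rw [ricciRHS_topJet gg h] at e2
    rw [ricciRHS_congr (J' := J) fun i hi => by
      rw [comp_add, comp_topJet_of_ne (by omega), add_zero]]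
    simp only [comp_add, add_apply] at e1 e2 ⊢
    linarith

theorem eq_add_topJet {J J' : JetAmb V (k + 1)} (h : truncJet V k J = truncJet V k J') :
    J' = J + topJet V k (J' (Fin.last k) - J (Fin.last k)) := by
  funext i
  refine Fin.lastCases ?_ (fun i => ?_) i
  · rw [Pi.add_apply, topJet, ContinuousLinearMap.single_apply, Pi.single_eq_same]
    abel
  · have h1 := congrFun h i
    rw [Pi.add_apply, topJet, ContinuousLinearMap.single_apply,
      Pi.single_eq_of_ne (Fin.castSucc_lt_last i).ne, add_zero]
    exact h1.symm

theorem sub_mem_linJet {J J' : JetAmb V (k + 1)} (hJ : J ∈ curvJets gg (k + 1))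
    (hJ' : J' ∈ curvJets gg (k + 1)) (h : truncJet V k J = truncJet V k J') :
    J' (Fin.last k) - J (Fin.last k) ∈ linJet gg k := by
  have hsub := eq_add_topJet h
  set T := J' (Fin.last k) - J (Fin.last k)
  have hc : ∀ i, comp J' i = comp J i + comp (topJet V k T) i := fun i => by
    rw [← comp_add, ← hsub]
  refine ⟨fun i hi x => ⟨fun x₁ x₂ y₁ y₂ => ?_, fun x₁ x₂ y₁ y₂ => ?_, fun x₁ x₂ x₃ y => ?_⟩,
    fun i hi x x₁ x₂ x₃ y₁ y₂ => ?_, fun s m h x y z w r => ?_⟩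
  · have e1 := (hJ.algCurv i hi x).skew x₁ x₂ y₁ y₂
    have e2 := (hJ'.algCurv i hi x).skew x₁ x₂ y₁ y₂
    simp only [hc, add_apply] at e1 e2 ⊢
    linarith
  · have e1 := (hJ.algCurv i hi x).pair x₁ x₂ y₁ y₂
    have e2 := (hJ'.algCurv i hi x).pair x₁ x₂ y₁ y₂
    simp only [hc, add_apply] at e1 e2 ⊢
    linarith
  · have e1 := (hJ.algCurv i hi x).bianchi x₁ x₂ x₃ y
    have e2 := (hJ'.algCurv i hi x).bianchi x₁ x₂ x₃ y
    simp only [hc, add_apply] at e1 e2 ⊢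
    linarith
  · have e1 := hJ.bianchi₂ i hi x x₁ x₂ x₃ y₁ y₂
    have e2 := hJ'.bianchi₂ i hi x x₁ x₂ x₃ y₁ y₂
    simp only [hc, add_apply] at e1 e2 ⊢
    linarith
  · have e1 := hJ.ricci s m h x y z w r
    have e2 := hJ'.ricci s m h x y z w r
    rw [ricciRHS_congr (J := J') (J' := J) fun i hi => by
      rw [hc, comp_topJet_of_ne (by omega), add_zero]] at e2
    rw [ricciRHS_topJet gg h]
    simp only [hc, add_apply] at e1 e2 ⊢
    linarith

theorem sum_const_fin (k : ℕ) (b : ℝ) : ∑ _j : Fin k, b = k * b := by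
  simp

/-! ### Homogeneous jets: an element of `𝒞_k` is determined by its symmetrization -/

section Linear

variable {T : Tensor V (k + 4)} (hT : T ∈ linJet gg k)
include hT

theorem isAlgCurv_of_mem_linJet (x : Fin k → V) :
    IsAlgCurv fun a b c d => T (Fin.append x ![a, b, c, d]) := by
  have h := hT.algCurv k (Nat.lt_succ_self k) x
  rwa [comp_topJet] at h

/-- For a homogeneous jet the Ricci identities say that neighbouring derivative directions commute,
and such swaps generate all permutations. The prefix `p` is there for the induction. -/
theorem comp_topJet_perm (r : Fin 4 → V) {l l' : List V} (h : l.Perm l') (p : List V) :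
    comp (topJet V k T) (p ++ l).length (Fin.append (p ++ l).get r)
      = comp (topJet V k T) (p ++ l').length (Fin.append (p ++ l').get r) := by
  induction h generalizing p with
  | nil => rfl
  | cons a _ ih =>
    have h := ih (p ++ [a])
    rw [List.append_assoc, List.append_assoc] at h
    exact h
  | swap a b l =>
    -- Lists of the wrong length select a component of the jet that is zero.
    by_cases hk : (p ++ b :: a :: l).length = k
    · have e : p.length + 2 + l.length = k := by simp at hk; omega
      have h := hT.ricci p.length l.length (by omega) p.get b a l.get r
      rw [ricciRHS_topJet gg (by omega), sub_eq_zero] at h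
      refine Eq.trans ?_ (h.trans ?_)
      · refine tensor_congr (comp (topJet V k T)) ?_
        simp only [List.ofFn_fin_append, List.ofFn_get]
        simp
      · refine tensor_congr (comp (topJet V k T)) ?_
        simp only [List.ofFn_fin_append, List.ofFn_get]
        simp
    · have hk' : (p ++ a :: b :: l).length ≠ k := by simpa using hk
      rw [comp_topJet_of_ne hk, comp_topJet_of_ne hk']
      rfl
  | trans _ _ ih1 ih2 => exact (ih1 p).trans (ih2 p)

theorem linJet_perm (σ : Equiv.Perm (Fin k)) (x : Fin k → V) (r : Fin 4 → V) :
    T (Fin.append (fun j => x (σ j)) r) = T (Fin.append x r) := by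
  have h := comp_topJet_perm hT r (Equiv.Perm.ofFn_comp_perm σ x) []
  have e : ∀ y : Fin k → V, comp (topJet V k T) ([] ++ List.ofFn y).length
      (Fin.append ([] ++ List.ofFn y).get r) = T (Fin.append y r) := fun y => by
    conv_rhs => rw [← comp_topJet T]
    refine tensor_congr (comp (topJet V k T)) ?_
    simp only [List.ofFn_fin_append, List.ofFn_get]
    simp
  rw [e, e] at h
  exact h

/-- By symmetry, slot `j` may be exchanged with the last derivative slot, where the second Bianchi
identity is assumed. -/
theorem linJet_bianchi (j : Fin k) (ξ x₁ x₂ x₃ y₁ y₂ : V) :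
    T (Fin.append (Function.update (fun _ => ξ) j x₁) ![x₂, x₃, y₁, y₂])
      + T (Fin.append (Function.update (fun _ => ξ) j x₂) ![x₃, x₁, y₁, y₂])
      + T (Fin.append (Function.update (fun _ => ξ) j x₃) ![x₁, x₂, y₁, y₂]) = 0 := by
  match k, T, hT, j with
  | k + 1, T, hT, j =>
    have h := hT.bianchi₂ k (Nat.lt_succ_self _) (fun _ => ξ) x₁ x₂ x₃ y₁ y₂
    rw [comp_topJet] at h
    have e : ∀ (u : V) (r : Fin 4 → V), T (Fin.append (Function.update (fun _ => ξ) j u) r)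
        = T (Fin.append (Fin.snoc (fun _ => ξ) u : Fin (k + 1) → V) r) := fun u r => by
      rw [← linJet_perm hT (Equiv.swap j (Fin.last k)) (Fin.snoc (fun _ => ξ) u)]
      congr 2
      funext i
      by_cases hi : i = j
      · subst hi
        simp
      · rw [Function.update_of_ne hi]
        have h1 : Equiv.swap j (Fin.last k) i ≠ Fin.last k := fun e => hi (by
          rw [Equiv.swap_apply_eq_iff, Equiv.swap_apply_right] at e
          exact e)
        obtain ⟨i', hi'⟩ := Fin.exists_castSucc_eq.mpr h1
        rw [← hi', Fin.snoc_castSucc (α := fun _ => V)]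
    rw [e, e, e]
    exact h

variable [FiniteDimensional ℝ V]

omit hT [FiniteDimensional ℝ V] in
theorem sum_update_eq_zero {ξ u : V} {r r' : Fin 4 → V}
    (h : ∀ s : ℝ, T (Fin.append (fun _ => ξ + s • u) fun j => r j + s • r' j) = 0) :
    ∑ j : Fin k, T (Fin.append (Function.update (fun _ => ξ) j u) r)
      + ∑ j : Fin 4, T (Fin.append (fun _ => ξ) (Function.update r j (r' j))) = 0 := by
  have h1 : HasDerivAt (fun s : ℝ => (Fin.append (fun _ => ξ + s • u) fun j => r j + s • r' j :
      Fin (k + 4) → V)) (Fin.append (fun _ => u) r') 0 := by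
    refine hasDerivAt_pi.mpr fun j => ?_
    refine Fin.addCases (m := k) (n := 4) (fun j => ?_) (fun j => ?_) j
    · simp only [Fin.append_left]
      exact hasDerivAt_line ξ u
    · simp only [Fin.append_right]
      exact hasDerivAt_line (r j) (r' j)
  have h2 := (T.hasFDerivAt _).comp_hasDerivAt 0 h1
  have h3 := h2.unique ((hasDerivAt_const (0 : ℝ) (0 : ℝ)).congr_of_eventuallyEq
    (Filter.Eventually.of_forall h))
  rw [ContinuousMultilinearMap.linearDeriv_apply, Fin.sum_univ_add] at h3
  simpa only [zero_smul, add_zero, Fin.append_left, Fin.append_right, ← append_update_left,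
    ← append_update_right] using h3

/-- A homogeneous curvature jet vanishes if its symmetrization does. -/
theorem eq_zero_of_jacobiForm_eq_zero (h : ∀ ξ, jacobiForm T ξ = 0) : T = 0 := by
  have h0 : ∀ ξ x y, T (Fin.append (fun _ => ξ) ![x, ξ, ξ, y]) = 0 := fun ξ x y => by
    rw [← jacobiForm_apply, h]; rfl
  have hs := fun ξ => (isAlgCurv_of_mem_linJet hT fun _ => ξ).skew
  have hp := fun ξ => (isAlgCurv_of_mem_linJet hT fun _ => ξ).pair
  have hb := fun ξ => (isAlgCurv_of_mem_linJet hT fun _ => ξ).bianchi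
  -- Polarize the hypothesis in the direction `u` and antisymmetrize in `x`, `u`. The second Bianchi
  -- identity turns the derivative slots into `k` copies of the claim and the algebraic identities
  -- turn the rest into three, whence the factor `k + 3`.
  have hB : ∀ ξ x u y, T (Fin.append (fun _ => ξ) ![x, u, ξ, y]) = 0 := by
    intro ξ x u y
    have h1 : ∀ u x, ∑ j : Fin k, T (Fin.append (Function.update (fun _ => ξ) j u) ![x, ξ, ξ, y])
        + (T (Fin.append (fun _ => ξ) ![x, u, ξ, y])
          + T (Fin.append (fun _ => ξ) ![x, ξ, u, y])) = 0 := fun u x => by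
      have h2 := sum_update_eq_zero (T := T) (ξ := ξ) (u := u) (r := ![x, ξ, ξ, y])
        (r' := ![0, u, u, 0]) fun s => by
          have e : (fun j : Fin 4 => (![x, ξ, ξ, y] : Fin 4 → V) j
              + s • (![0, u, u, 0] : Fin 4 → V) j) = ![x, ξ + s • u, ξ + s • u, y] := by
            funext j; fin_cases j <;> simp
          rw [e, h0]
      rw [Fin.sum_univ_four] at h2
      have e0 : T (Fin.append (fun _ => ξ)
          (Function.update ![x, ξ, ξ, y] 0 ((![0, u, u, 0] : Fin 4 → V) 0))) = 0 := by
        rw [append_update_right]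
        exact T.map_update_zero _ _
      have e3 : T (Fin.append (fun _ => ξ)
          (Function.update ![x, ξ, ξ, y] 3 ((![0, u, u, 0] : Fin 4 → V) 3))) = 0 := by
        rw [append_update_right]
        exact T.map_update_zero _ _
      have e1 : Function.update ![x, ξ, ξ, y] 1 ((![0, u, u, 0] : Fin 4 → V) 1)
          = ![x, u, ξ, y] := by
        funext j; fin_cases j <;> rfl
      have e2 : Function.update ![x, ξ, ξ, y] 2 ((![0, u, u, 0] : Fin 4 → V) 2)
          = ![x, ξ, u, y] := by
        funext j; fin_cases j <;> rfl
      rw [e0, e3, e1, e2] at h2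
      linarith
    have h3 : ∑ j : Fin k, T (Fin.append (Function.update (fun _ => ξ) j u) ![x, ξ, ξ, y])
        - ∑ j : Fin k, T (Fin.append (Function.update (fun _ => ξ) j x) ![u, ξ, ξ, y])
        = k * T (Fin.append (fun _ => ξ) ![x, u, ξ, y]) := by
      rw [← Finset.sum_sub_distrib, ← sum_const_fin]
      refine Finset.sum_congr rfl fun j _ => ?_
      have e1 := linJet_bianchi hT j ξ u x ξ ξ y
      rw [Function.update_eq_self j fun _ => ξ] at e1
      have e2 := (isAlgCurv_of_mem_linJet hT (Function.update (fun _ => ξ) j x)).skew ξ u ξ y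
      have e3 := hs ξ u x ξ y
      linarith
    have h4 := h1 u x
    have h5 := h1 x u
    have e1 := hp ξ x ξ u y
    have e2 := hp ξ u ξ x y
    have e3 := hb ξ x u y ξ
    have e4 := hs ξ x y u ξ
    have e5 := hs ξ x u ξ y
    have e6 := hp ξ x u y ξ
    have e7 := hs ξ y ξ x u
    have e8 := hp ξ ξ y x u
    have e9 : ((k : ℝ) + 3) * T (Fin.append (fun _ => ξ) ![x, u, ξ, y]) = 0 := by linarith
    exact (mul_eq_zero.mp e9).resolve_left (by positivity)
  -- The same once more: pair symmetry brings the remaining `ξ` to the first curvature slot.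
  -- Polarizing and antisymmetrizing in `v`, `y` now gives the factor `k + 2`.
  have hE : ∀ ξ v y p q, T (Fin.append (fun _ => ξ) ![v, y, p, q]) = 0 := by
    intro ξ v y p q
    have h1 : ∀ v y, ∑ j : Fin k, T (Fin.append (Function.update (fun _ => ξ) j v) ![ξ, y, p, q])
        + T (Fin.append (fun _ => ξ) ![v, y, p, q]) = 0 := fun v y => by
      have h2 := sum_update_eq_zero (T := T) (ξ := ξ) (u := v) (r := ![ξ, y, p, q])
        (r' := ![v, 0, 0, 0]) fun s => by
          have e : (fun j : Fin 4 => (![ξ, y, p, q] : Fin 4 → V) j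
              + s • (![v, 0, 0, 0] : Fin 4 → V) j) = ![ξ + s • v, y, p, q] := by
            funext j; fin_cases j <;> simp
          have e1 := hp (ξ + s • v) (ξ + s • v) y p q
          rw [e]
          exact e1.trans (hB _ _ _ _)
      rw [Fin.sum_univ_four] at h2
      have e0 : Function.update ![ξ, y, p, q] 0 ((![v, 0, 0, 0] : Fin 4 → V) 0)
          = ![v, y, p, q] := by
        funext j; fin_cases j <;> rfl
      have e : ∀ j : Fin 4, T (Fin.append (fun _ => ξ) (Function.update ![ξ, y, p, q] j 0)) = 0 :=
        fun j => by
          rw [append_update_right]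
          exact T.map_update_zero _ _
      have e1 := e 1
      have e2 := e 2
      have e3 := e 3
      rw [e0] at h2
      change _ + (_ + T (Fin.append (fun _ => ξ) (Function.update ![ξ, y, p, q] 1 0))
        + T (Fin.append (fun _ => ξ) (Function.update ![ξ, y, p, q] 2 0))
        + T (Fin.append (fun _ => ξ) (Function.update ![ξ, y, p, q] 3 0))) = 0 at h2
      linarith
    have h3 : ∑ j : Fin k, T (Fin.append (Function.update (fun _ => ξ) j v) ![ξ, y, p, q])
        - ∑ j : Fin k, T (Fin.append (Function.update (fun _ => ξ) j y) ![ξ, v, p, q])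
        = k * T (Fin.append (fun _ => ξ) ![v, y, p, q]) := by
      rw [← Finset.sum_sub_distrib, ← sum_const_fin]
      refine Finset.sum_congr rfl fun j _ => ?_
      have e1 := linJet_bianchi hT j ξ v ξ y p q
      rw [Function.update_eq_self j fun _ => ξ] at e1
      have e2 := (isAlgCurv_of_mem_linJet hT (Function.update (fun _ => ξ) j y)).skew v ξ p q
      have e3 := hs ξ y v p q
      linarith
    have h4 := h1 v y
    have h5 := h1 y v
    have e3 := hs ξ y v p q
    have e9 : ((k : ℝ) + 2) * T (Fin.append (fun _ => ξ) ![v, y, p, q]) = 0 := by linarith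
    exact (mul_eq_zero.mp e9).resolve_left (by positivity)
  ext u
  let r : Fin 4 → V := fun j => u (Fin.natAdd k j)
  -- With the curvature arguments frozen, `T` is a symmetric form in the derivative slots that
  -- vanishes on the diagonal.
  let H : V [×k]→L[ℝ] ℝ :=
    { toFun := fun x => T (Fin.append x r)
      map_update_add' := by
        intro inst v i x y
        rw [Subsingleton.elim inst (instDecidableEqFin k)]
        simp only [append_update_left, ContinuousMultilinearMap.map_update_add]
      map_update_smul' := by
        intro inst v i c x
        rw [Subsingleton.elim inst (instDecidableEqFin k)]
        simp only [append_update_left, ContinuousMultilinearMap.map_update_smul]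
      cont := by
        refine T.cont.comp (continuous_pi fun j => ?_)
        refine Fin.addCases (m := k) (n := 4) (fun j => ?_) (fun j => ?_) j
        · simp only [Fin.append_left]
          exact continuous_apply j
        · simp only [Fin.append_right]
          exact continuous_const }
  have hH : H = 0 := by
    refine eq_of_diag_eq (fun σ v => linJet_perm hT σ v r) (fun _ _ => rfl) fun ξ => ?_
    have hr : r = ![r 0, r 1, r 2, r 3] := by
      funext j; fin_cases j <;> rfl
    change T (Fin.append (fun _ => ξ) r) = 0
    rw [hr]
    exact hE _ _ _ _ _
  have h1 : T (Fin.append (fun j => u (Fin.castAdd 4 j)) r) = 0 :=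
    congrArg (fun H : V [×k]→L[ℝ] ℝ => H fun j => u (Fin.castAdd 4 j)) hH
  rwa [Fin.append_castAdd_natAdd] at h1

end Linear

end Injectivity

/-! ## The three maps are mutually inverse bijections -/

section Bijections

variable {V : Type*} [NormedAddCommGroup V] [NormedSpace ℝ V] {gg : BForm V} {N k : ℕ}

theorem jacobiForm_sub {i : ℕ} (T T' : Tensor V (i + 4)) (ξ : V) :
    jacobiForm (T - T') ξ = jacobiForm T ξ - jacobiForm T' ξ := by
  ext x y
  simp only [sub_apply, jacobiForm_apply]

theorem mapSym_add_topJet {J : JetAmb V (k + 1)} (hJ : J ∈ curvJets gg (k + 1))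
    {T : Tensor V (k + 4)} (hT : T ∈ linJet gg k) : mapSym (k + 1) (J + topJet V k T)
      = mapSym (k + 1) J + topSym V k (polarize (k + 2) (jacobiForm T)) := by
  refine normalSum_ext (mapSym_mem (add_topJet_mem hJ hT)) (normalSum_add (mapSym_mem hJ)
    (topSym_mem (polarize_jacobiForm_mem (isAlgCurv_of_mem_linJet hT)))) fun i ξ x y => ?_
  rw [Pi.add_apply, add_apply, mapSym_diag, mapSym_diag]
  simp only [add_apply]
  rw [jacobiForm_apply, jacobiForm_apply]
  refine Fin.lastCases ?_ (fun i => ?_) i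
  · have e := congrArg (fun β : BForm V => β x y) (polarize_jacobiForm_diag T ξ)
    rw [jacobiForm_apply] at e
    rw [topSym_last, Pi.add_apply, topJet, ContinuousLinearMap.single_apply, Pi.single_eq_same]
    exact congrArg (J (Fin.last k) (Fin.append (fun _ => ξ) ![x, ξ, ξ, y]) + ·) e.symm
  · rw [topSym_castSucc, Pi.add_apply, topJet, ContinuousLinearMap.single_apply,
      Pi.single_eq_of_ne (Fin.castSucc_lt_last i).ne]
    rfl

theorem zero_mem_curvJets : (0 : JetAmb V (k + 1)) ∈ curvJets gg (k + 1) := by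
  have h : IsCurvJet gg (topJet V k 0) := (linJet gg k).zero_mem
  rwa [map_zero] at h

variable [FiniteDimensional ℝ V]

theorem mapSym_injOn : Set.InjOn (mapSym N) (curvJets gg N) := by
  induction N with
  | zero => exact fun a _ b _ _ => Subsingleton.elim a b
  | succ k ih =>
    intro J hJ J' hJ' h
    have h1 : truncJet V k J = truncJet V k J' :=
      ih (truncJet_mem hJ) (truncJet_mem hJ') (congrArg (truncSym V k) h)
    have h2 := eq_zero_of_jacobiForm_eq_zero (sub_mem_linJet hJ hJ' h1) fun ξ => by
      rw [jacobiForm_sub, sub_eq_zero, ← mapSym_diag, ← mapSym_diag, h]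
    have h3 := eq_add_topJet h1
    rw [h2, map_zero, add_zero] at h3
    exact h3.symm

section

variable (hsymm : ∀ x y, gg x y = gg y x) (hnd : ∀ x, (∀ y, gg x y = 0) → x = 0)
include hsymm hnd

/-- A left inverse of an injective map from the right: `Q` agrees on both sides because `Q ∘ 𝓡 ∘ R =
Id`. The next lemma uses injectivity of `𝓡` in the same way. -/
theorem mapSym_mapR_mapQ {H : SymAmb V N} (hH : H ∈ normalSum V N) :
    mapSym N (mapR gg N (mapQ gg N H)) = H := by
  have hQ := mapQ_mem hsymm hnd hH
  exact mapQ_injOn hsymm hnd (mapSym_mem (mapR_mem hsymm hnd hQ)) hH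
    (mapQ_mapSym_mapR hsymm hnd hQ)

theorem mapR_mapQ_mapSym {J : JetAmb V N} (hJ : J ∈ curvJets gg N) :
    mapR gg N (mapQ gg N (mapSym N J)) = J :=
  mapSym_injOn (mapR_mem hsymm hnd (mapQ_mem hsymm hnd (mapSym_mem hJ))) hJ
    (mapSym_mapR_mapQ hsymm hnd (mapSym_mem hJ))

/-- `R` inverts `Q ∘ 𝓡`, and both factors commute with truncation. -/
theorem truncJet_mapR {h : SymAmb V (k + 1)} (hh : h ∈ normalSum V (k + 1)) :
    truncJet V k (mapR gg (k + 1) h) = mapR gg k (truncSym V k h) := by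
  have h1 := truncJet_mem (mapR_mem hsymm hnd hh)
  rw [← mapR_mapQ_mapSym hsymm hnd h1]
  change mapR gg k (mapQ gg k (truncSym V k (mapSym (k + 1) (mapR gg (k + 1) h)))) = _
  rw [← truncSym_mapQ hsymm hnd (mapSym_mem (mapR_mem hsymm hnd hh)),
    mapQ_mapSym_mapR hsymm hnd hh]

/-- The symmetrization of homogeneous curvature jets is an isomorphism `𝒞_k ≅ 𝒩_{k+2}`. -/
theorem exists_linJet_equiv : ∃ L : linJet gg k ≃ₗ[ℝ] normalSpace V (k + 2),
    ∀ T, (L T : V [×(k + 2)]→L[ℝ] BForm V) = polarize (k + 2) (jacobiForm (T : Tensor V (k + 4))) := by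
  have hm : ∀ T : linJet gg k, polarize (k + 2) (jacobiForm (T : Tensor V (k + 4)))
      ∈ normalSpace V (k + 2) := fun T => polarize_jacobiForm_mem (isAlgCurv_of_mem_linJet T.2)
  have hext : ∀ v w : normalSpace V (k + 2),
      (∀ ξ x y, v.1 (fun _ => ξ) x y = w.1 (fun _ => ξ) x y) → v = w := fun v w h =>
    Subtype.ext (eq_of_diag_eq v.2.1 w.2.1 fun ξ => by ext x y; exact h ξ x y)
  let L : linJet gg k →ₗ[ℝ] normalSpace V (k + 2) :=
    { toFun := fun T => ⟨polarize (k + 2) (jacobiForm (T : Tensor V (k + 4))), hm T⟩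
      map_add' := fun T T' => hext _ _ fun ξ x y => by
        simp only [Submodule.coe_add, add_apply, polarize_jacobiForm_diag, jacobiForm_apply]
      map_smul' := fun c T => hext _ _ fun ξ x y => by
        simp only [Submodule.coe_smul, smul_apply, polarize_jacobiForm_diag, jacobiForm_apply,
          RingHom.id_apply] }
  refine ⟨LinearEquiv.ofBijective L ⟨?_, fun v => ?_⟩, fun T => rfl⟩
  · refine (injective_iff_map_eq_zero L).mpr fun T hT => Subtype.ext ?_
    refine eq_zero_of_jacobiForm_eq_zero T.2 fun ξ => ?_
    rw [← polarize_jacobiForm_diag]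
    have h : polarize (k + 2) (jacobiForm (T : Tensor V (k + 4))) = 0 := congrArg Subtype.val hT
    rw [h]
    rfl
  -- Surjectivity: the jet with symmetrization `(0, …, 0, v)` has a truncation with zero
  -- symmetrization, so it is itself of the form `(0, …, 0, T)`.
  · have h1 := mapSym_mapR_mapQ hsymm hnd (topSym_mem v.2)
    have h2 := mapR_mem hsymm hnd (mapQ_mem hsymm hnd (topSym_mem v.2))
    set J := mapR gg (k + 1) (mapQ gg (k + 1) (topSym V k v.1))
    have h0 := zero_mem_curvJets (gg := gg) (k := k)
    have h3 : truncJet V k 0 = truncJet V k J := by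
      refine mapSym_injOn (truncJet_mem h0) (truncJet_mem h2) ?_
      change _ = truncSym V k (mapSym (k + 1) J)
      rw [h1]
      funext i
      refine Eq.trans ?_ (topSym_castSucc k v.1 i).symm
      refine eq_of_diag_eq (mapSym_mem (truncJet_mem h0) i).1 (fun _ _ => rfl) fun ξ => ?_
      rw [mapSym_diag]
      ext x y
      rw [jacobiForm_apply]
      rfl
    have hT := sub_mem_linJet h0 h2 h3
    have h4 := eq_add_topJet h3
    rw [h4, mapSym_add_topJet h0 hT] at h1
    refine ⟨⟨_, hT⟩, hext _ _ fun ξ x y => ?_⟩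
    have h5 := congrArg (fun H : SymAmb V (k + 1) => H (Fin.last k) (fun _ => ξ) x y) h1
    simp only [Pi.add_apply, topSym_last, add_apply, mapSym_diag, jacobiForm_apply] at h5
    refine Eq.trans ?_ h5
    exact (zero_add _).symm

end

end Bijections

/-! ## Affine bundles with a global section -/

section Bundles

section Smooth

variable {W W' W'' : Type*} [NormedAddCommGroup W] [NormedSpace ℝ W]
  [NormedAddCommGroup W'] [NormedSpace ℝ W'] [NormedAddCommGroup W''] [NormedSpace ℝ W'']

theorem smoothOnSet_of_contDiff {f : W → W'} (hf : ContDiff ℝ ω f) (S : Set W) :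
    SmoothOnSet f S :=
  fun x _ => ⟨Set.univ, isOpen_univ, Set.mem_univ x, f,
    (hf.of_le (by exact_mod_cast le_top)).contDiffOn, fun _ _ => rfl⟩

theorem isDiffeoOn_of_contDiff {f : W → W'} {f' : W' → W} {S : Set W} {S' : Set W'}
    (hf : ContDiff ℝ ω f) (hf' : ContDiff ℝ ω f') (h : Set.MapsTo f S S')
    (h' : Set.MapsTo f' S' S) (hl : Set.LeftInvOn f' f S) (hr : Set.RightInvOn f' f S') :
    IsDiffeoOn f S S' :=
  ⟨smoothOnSet_of_contDiff hf S, h, f', smoothOnSet_of_contDiff hf' S', h', hl, hr⟩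

/-- Smoothness refers to extensions to the ambient space, so coordinates in a subspace are read off
by a projection defined everywhere. -/
theorem exists_contDiff_projection [FiniteDimensional ℝ W] (p : Submodule ℝ W) :
    ∃ P : W → p, ContDiff ℝ ω P ∧ ∀ v : p, P v = v := by
  obtain ⟨P, hP⟩ := Submodule.ClosedComplemented.of_finiteDimensional p
  exact ⟨P, P.contDiff, hP⟩

/-- A set is a submanifold if it is diffeomorphic to a linear subspace. -/
theorem isSubmanifold_of_submodule [FiniteDimensional ℝ W'] (p : Submodule ℝ W') {f : W → W'}
    {f' : W' → W} {S : Set W} (hf : ContDiff ℝ ω f) (hf' : ContDiff ℝ ω f')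
    (h : Set.MapsTo f S p) (h' : Set.MapsTo f' p S) (hl : Set.LeftInvOn f' f S)
    (hr : Set.RightInvOn f' f p) : IsSubmanifold S := by
  obtain ⟨P, hPs, hP⟩ := exists_contDiff_projection p
  let e : p ≃L[ℝ] EuclideanSpace ℝ (Fin (Module.finrank ℝ p)) :=
    ContinuousLinearEquiv.ofFinrankEq (by simp)
  refine ⟨Module.finrank ℝ p, fun x _ => ⟨Set.univ, isOpen_univ, Set.mem_univ x,
    fun w => e (P (f w)), Set.univ, isOpen_univ, ?_⟩⟩
  rw [Set.inter_univ]
  refine isDiffeoOn_of_contDiff (f' := fun y => f' (e.symm y : p)) ?_ ?_ (fun _ _ => Set.mem_univ _)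
    (fun y _ => h' (e.symm y).2) (fun w hw => ?_) fun y _ => ?_
  · exact e.contDiff.comp (hPs.comp hf)
  · exact hf'.comp (p.subtypeL.contDiff.comp e.symm.contDiff)
  · have h1 := hP ⟨f w, h hw⟩
    change P (f w) = ⟨f w, h hw⟩ at h1
    change f' (e.symm (e (P (f w))) : p) = w
    rw [h1, e.symm_apply_apply]
    exact hl hw
  · have h1 : f (f' (e.symm y : p)) = _ := hr (e.symm y).2
    rw [h1, hP, e.apply_symm_apply]

end Smooth

variable {W W₀ F : Type*} [NormedAddCommGroup W] [NormedSpace ℝ W]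
  [NormedAddCommGroup W₀] [NormedSpace ℝ W₀] [NormedAddCommGroup F] [NormedSpace ℝ F]

/-- A bundle of affine spaces with a smooth global section is an affine vector bundle. -/
theorem BundleData.isAffineBundle_of_section (B : BundleData W W₀ F)
    (hbase : IsSubmanifold B.base) (htotal : IsSubmanifold B.total) (hproj : ContDiff ℝ ω B.proj)
    (hmaps : Set.MapsTo B.proj B.total B.base) {G : W₀ → W} (hG : ContDiff ℝ ω G)
    (hGt : ∀ b ∈ B.base, G b ∈ B.total ∧ B.proj (G b) = b) {P : W → F}
    (hPs : ContDiff ℝ ω P) (hP : ∀ v, P (B.dir v) = v)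
    (hfib : ∀ e ∈ B.total, {e' | e' ∈ B.total ∧ B.proj e' = B.proj e}
      = Set.range fun v : F => e + B.dir v) : B.IsAffineBundle := by
  have hfib' : ∀ b ∈ B.base, ∀ v, G b + B.dir v ∈ B.total ∧ B.proj (G b + B.dir v) = b :=
    fun b hb v => by
      have h : G b + B.dir v ∈ {e' | e' ∈ B.total ∧ B.proj e' = B.proj (G b)} := by
        rw [hfib _ (hGt b hb).1]
        exact ⟨v, rfl⟩
      exact ⟨h.1, h.2.trans (hGt b hb).2⟩
  refine ⟨hbase, htotal, hmaps, smoothOnSet_of_contDiff hproj _, fun b hb => ⟨G b, hGt b hb⟩,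
    fun v w h => by rw [← hP v, ← hP w, h], hfib, fun b₀ hb₀ => ⟨Set.univ, isOpen_univ,
    Set.mem_univ _, fun q => G q.1 + B.dir q.2, ?_, fun b hb => ⟨fun v => (hfib' b hb.1 v).2,
      LinearEquiv.refl ℝ F, fun v => by simp⟩⟩⟩
  -- The section trivializes the bundle globally: the fibre coordinate of `e` is its difference from
  -- the section.
  refine isDiffeoOn_of_contDiff (f' := fun e => (B.proj e, P (e - G (B.proj e)))) ?_ ?_
    (fun q hq => ⟨(hfib' q.1 hq.1.1 q.2).1, Set.mem_univ _⟩)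
    (fun e he => ⟨⟨hmaps he.1, Set.mem_univ _⟩, Set.mem_univ _⟩) (fun q hq => ?_) fun e he => ?_
  · exact (hG.comp contDiff_fst).add (B.dir.contDiff.comp contDiff_snd)
  · exact hproj.prodMk (hPs.comp (contDiff_id.sub (hG.comp hproj)))
  · have h := (hfib' q.1 hq.1.1 q.2).2
    simp only
    rw [h, add_sub_cancel_left, hP]
  · have hb := hGt _ (hmaps he.1)
    have h : e ∈ {e' | e' ∈ B.total ∧ B.proj e' = B.proj (G (B.proj e))} := ⟨he.1, hb.2.symm⟩
    rw [hfib _ hb.1] at h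
    obtain ⟨v, hv⟩ := h
    have hv : G (B.proj e) + B.dir v = e := hv
    have h2 : e - G (B.proj e) = B.dir v := sub_eq_of_eq_add' hv.symm
    simp only
    rw [h2, hP]
    exact hv

end Bundles

section FiniteDim

variable {V : Type*} [NormedAddCommGroup V] [NormedSpace ℝ V] [FiniteDimensional ℝ V]

instance finiteDimensional_multilinear {G : Type*} [NormedAddCommGroup G] [NormedSpace ℝ G]
    [FiniteDimensional ℝ G] (n : ℕ) : FiniteDimensional ℝ (V [×n]→L[ℝ] G) :=
  Module.Finite.of_injective
    (ContinuousMultilinearMap.toMultilinearMapLinear (R' := ℝ) (A := ℝ) :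
      (V [×n]→L[ℝ] G) →ₗ[ℝ] MultilinearMap ℝ (fun _ : Fin n => V) G)
    ContinuousMultilinearMap.toMultilinearMap_injective

instance finiteDimensional_bform : FiniteDimensional ℝ (BForm V) :=
  Module.Finite.equiv (LinearMap.toContinuousLinearMap : (V →ₗ[ℝ] (V →L[ℝ] ℝ)) ≃ₗ[ℝ] _)

end FiniteDim

/-! ### The two affine bundles and the three isomorphisms -/

section JetBundles

variable {V : Type*} [NormedAddCommGroup V] [NormedSpace ℝ V] {gg : BForm V} {N k : ℕ}

/-- Extension of a sequence by zero in the highest degree. -/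
noncomputable def extSym (V : Type*) [NormedAddCommGroup V] [NormedSpace ℝ V] (k : ℕ) :
    SymAmb V k → SymAmb V (k + 1) :=
  fun h => Fin.snoc (α := fun i : Fin (k + 1) => V [×(i + 2)]→L[ℝ] BForm V) h 0

theorem contDiff_extSym : ContDiff ℝ ω (extSym V k) := by
  refine contDiff_pi.mpr fun i => ?_
  refine Fin.lastCases ?_ (fun i => ?_) i
  · simp only [extSym, Fin.snoc_last]
    exact contDiff_const
  · simp only [extSym, Fin.snoc_castSucc]
    exact contDiff_pi.mp contDiff_id i

theorem extSym_mem {h : SymAmb V k} (hh : h ∈ normalSum V k) :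
    extSym V k h ∈ normalSum V (k + 1) := by
  intro i
  refine Fin.lastCases ?_ (fun i => ?_) i
  · rw [extSym, Fin.snoc_last]
    exact Submodule.zero_mem _
  · rw [extSym, Fin.snoc_castSucc]
    exact hh i

theorem truncSym_extSym (h : SymAmb V k) : truncSym V k (extSym V k h) = h := by
  funext i
  exact Fin.snoc_castSucc (α := fun i : Fin (k + 1) => V [×(i + 2)]→L[ℝ] BForm V) 0 h i

theorem contDiff_truncSym : ContDiff ℝ ω (truncSym V k) :=
  contDiff_pi.mpr fun i => contDiff_pi.mp contDiff_id i.castSucc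

theorem contDiff_truncJet : ContDiff ℝ ω (truncJet V k) :=
  contDiff_pi.mpr fun i => contDiff_pi.mp contDiff_id i.castSucc

theorem contDiff_last_sym (k : ℕ) :
    ContDiff ℝ ω fun h : SymAmb V (k + 1) => (h (Fin.last k) : V [×(k + 2)]→L[ℝ] BForm V) :=
  contDiff_pi.mp contDiff_id (Fin.last k)

/-- `𝒩₂ ⊕ … ⊕ 𝒩_{N+1}` as a linear subspace. -/
noncomputable def normalSubmodule (V : Type*) [NormedAddCommGroup V] [NormedSpace ℝ V] (N : ℕ) :
    Submodule ℝ (SymAmb V N) :=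
  Submodule.pi Set.univ fun i => normalSpace V (i + 2)

theorem coe_normalSubmodule : (normalSubmodule V N : Set (SymAmb V N)) = normalSum V N := by
  ext h
  simp [normalSubmodule, normalSum]

theorem truncJet_add_topJet (J : JetAmb V (k + 1)) (T : Tensor V (k + 4)) :
    truncJet V k (J + topJet V k T) = truncJet V k J := by
  funext i
  change J i.castSucc + topJet V k T i.castSucc = J i.castSucc
  rw [topJet, ContinuousLinearMap.single_apply, Pi.single_eq_of_ne (Fin.castSucc_lt_last i).ne,
    add_zero]

variable [FiniteDimensional ℝ V]

theorem isSubmanifold_normalSum : IsSubmanifold (normalSum V N) := by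
  refine isSubmanifold_of_submodule (normalSubmodule V N) contDiff_id contDiff_id ?_ ?_
    (fun _ _ => rfl) fun _ _ => rfl
  · rw [coe_normalSubmodule]; exact Set.mapsTo_id _
  · rw [coe_normalSubmodule]; exact Set.mapsTo_id _

theorem isAffineBundle_normalBundle : (normalBundle V k).IsAffineBundle := by
  obtain ⟨P, hPs, hP⟩ := exists_contDiff_projection (normalSpace V (k + 2))
  refine BundleData.isAffineBundle_of_section _ isSubmanifold_normalSum isSubmanifold_normalSum
    contDiff_truncSym (fun _ => truncSym_mem) contDiff_extSym
    (fun b hb => ⟨extSym_mem hb, truncSym_extSym b⟩)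
    (P := fun e => P (e (Fin.last k)))
    (hPs.comp (contDiff_last_sym k)) (fun v => ?_) fun e he => ?_
  · refine Eq.trans ?_ (hP v)
    exact congrArg P (topSym_last k v.1)
  · ext e'
    constructor
    · rintro ⟨h1, h2⟩
      exact ⟨⟨_, Submodule.sub_mem _ (h1 (Fin.last k)) (he (Fin.last k))⟩,
        (eq_add_topSym h2.symm).symm⟩
    · rintro ⟨v, rfl⟩
      exact ⟨normalSum_add he (topSym_mem v.2), truncSym_add_topSym e v.1⟩

variable (hsymm : ∀ x y, gg x y = gg y x) (hnd : ∀ x, (∀ y, gg x y = 0) → x = 0)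
include hsymm hnd

theorem isDiffeoOn_mapSym : IsDiffeoOn (mapSym N) (curvJets gg N) (normalSum V N) :=
  isDiffeoOn_of_contDiff (f' := fun H => mapR gg N (mapQ gg N H)) contDiff_mapSym
    ((contDiff_mapR hnd).comp contDiff_mapQ) (fun _ => mapSym_mem)
    (fun _ h => mapR_mem hsymm hnd (mapQ_mem hsymm hnd h))
    (fun _ => mapR_mapQ_mapSym hsymm hnd) fun _ => mapSym_mapR_mapQ hsymm hnd

theorem isDiffeoOn_mapR : IsDiffeoOn (mapR gg N) (normalSum V N) (curvJets gg N) :=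
  isDiffeoOn_of_contDiff (f' := fun J => mapQ gg N (mapSym N J)) (contDiff_mapR hnd)
    (contDiff_mapQ.comp contDiff_mapSym) (fun _ => mapR_mem hsymm hnd)
    (fun _ h => mapQ_mem hsymm hnd (mapSym_mem h))
    (fun _ => mapQ_mapSym_mapR hsymm hnd) fun _ => mapR_mapQ_mapSym hsymm hnd

theorem isDiffeoOn_mapQ : IsDiffeoOn (mapQ gg N) (normalSum V N) (normalSum V N) :=
  isDiffeoOn_of_contDiff (f' := fun h => mapSym N (mapR gg N h)) contDiff_mapQ
    (contDiff_mapSym.comp (contDiff_mapR hnd)) (fun _ => mapQ_mem hsymm hnd)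
    (fun _ h => mapSym_mem (mapR_mem hsymm hnd h))
    (fun _ => mapSym_mapR_mapQ hsymm hnd) fun _ => mapQ_mapSym_mapR hsymm hnd

theorem isSubmanifold_curvJets : IsSubmanifold (curvJets gg N) := by
  refine isSubmanifold_of_submodule (normalSubmodule V N) (f := mapSym N)
    (f' := fun H => mapR gg N (mapQ gg N H)) contDiff_mapSym
    ((contDiff_mapR hnd).comp contDiff_mapQ) ?_ ?_ (fun _ => mapR_mapQ_mapSym hsymm hnd) ?_ <;>
    rw [coe_normalSubmodule]
  · exact fun _ => mapSym_mem
  · exact fun _ h => mapR_mem hsymm hnd (mapQ_mem hsymm hnd h)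
  · exact fun _ => mapSym_mapR_mapQ hsymm hnd

/-- Every curvature jet extends, in a way that depends smoothly on the jet. -/
theorem exists_section_truncJet : ∃ G : JetAmb V k → JetAmb V (k + 1), ContDiff ℝ ω G ∧
    ∀ J ∈ curvJets gg k, G J ∈ curvJets gg (k + 1) ∧ truncJet V k (G J) = J := by
  refine ⟨fun J => mapR gg (k + 1) (mapQ gg (k + 1) (extSym V k (mapSym k J))),
    (contDiff_mapR hnd).comp (contDiff_mapQ.comp (contDiff_extSym.comp contDiff_mapSym)),
    fun J hJ => ?_⟩
  have h1 := extSym_mem (mapSym_mem hJ)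
  have h2 := mapR_mem hsymm hnd (mapQ_mem hsymm hnd h1)
  refine ⟨h2, mapSym_injOn (truncJet_mem h2) hJ ?_⟩
  change truncSym V k (mapSym (k + 1) _) = _
  rw [mapSym_mapR_mapQ hsymm hnd h1, truncSym_extSym]

theorem isAffineBundle_jetBundle : (jetBundle gg k).IsAffineBundle := by
  obtain ⟨P, hPs, hP⟩ := exists_contDiff_projection (linJet gg k)
  obtain ⟨G, hG, hGt⟩ := exists_section_truncJet (k := k) hsymm hnd
  refine BundleData.isAffineBundle_of_section _ (isSubmanifold_curvJets hsymm hnd)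
    (isSubmanifold_curvJets hsymm hnd) contDiff_truncJet (fun _ => truncJet_mem) hG hGt
    (P := fun e => P (e (Fin.last k)))
    (hPs.comp (contDiff_pi.mp contDiff_id (Fin.last k))) (fun v => ?_) fun e he => ?_
  · refine Eq.trans ?_ (hP v)
    exact congrArg P (Pi.single_eq_same (M := fun i : Fin (k + 1) => Tensor V (i + 4))
      (Fin.last k) v.1)
  · ext e'
    constructor
    · rintro ⟨h1, h2⟩
      exact ⟨⟨_, sub_mem_linJet he h1 h2.symm⟩, (eq_add_topJet h2.symm).symm⟩
    · rintro ⟨v, rfl⟩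
      exact ⟨add_topJet_mem he v.2, truncJet_add_topJet e v.1⟩

theorem isAffineBundleIso_mapSym :
    IsAffineBundleIso (jetBundle gg k) (normalBundle V k) (mapSym (k + 1)) (mapSym k) := by
  obtain ⟨L, hL⟩ := exists_linJet_equiv (k := k) hsymm hnd
  refine ⟨isDiffeoOn_mapSym hsymm hnd, isDiffeoOn_mapSym hsymm hnd, fun _ _ => rfl,
    fun b _ => ⟨L, fun e he _ v => ?_⟩⟩
  refine (mapSym_add_topJet he v.2).trans ?_
  rw [← hL]
  rfl

theorem isAffineBundleIso_mapQ :
    IsAffineBundleIso (normalBundle V k) (normalBundle V k) (mapQ gg (k + 1)) (mapQ gg k) :=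
  ⟨isDiffeoOn_mapQ hsymm hnd, isDiffeoOn_mapQ hsymm hnd, fun _ h => truncSym_mapQ hsymm hnd h,
    fun _ _ => ⟨LinearEquiv.smulOfNeZero ℝ _ (qFactor k) (qFactor_ne_zero k), fun _ he _ v =>
      mapQ_add_topSym hsymm hnd he v.2⟩⟩

/-- As inverse of `Q ∘ 𝓡`, the map `R` is affine on fibres. Its linear part is the inverse of
`qFactor k` times the symmetrization `𝒞_k ≅ 𝒩_{k+2}`. -/
theorem isAffineBundleIso_mapR :
    IsAffineBundleIso (normalBundle V k) (jetBundle gg k) (mapR gg (k + 1)) (mapR gg k) := by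
  obtain ⟨L, hL⟩ := exists_linJet_equiv (k := k) hsymm hnd
  let c := LinearEquiv.smulOfNeZero ℝ (normalSpace V (k + 2)) (qFactor k) (qFactor_ne_zero k)
  let L' := c.symm.trans L.symm
  refine ⟨isDiffeoOn_mapR hsymm hnd, isDiffeoOn_mapR hsymm hnd,
    fun _ h => truncJet_mapR hsymm hnd h, fun b _ => ⟨L', fun e he _ v => ?_⟩⟩
  have hJ := mapR_mem hsymm hnd he
  have h1 := add_topJet_mem hJ (L' v).2
  have h2 : qFactor k • polarize (k + 2) (jacobiForm ((L' v : linJet gg k) : Tensor V (k + 4)))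
      = v.1 := by
    rw [← hL]
    have h3 : qFactor k • L (L' v) = v := by
      change c (L (L.symm (c.symm v))) = v
      rw [L.apply_symm_apply, c.apply_symm_apply]
    exact congrArg Subtype.val h3
  have h4 := mapQ_add_topSym hsymm hnd (mapSym_mem hJ)
    (polarize_jacobiForm_mem (isAlgCurv_of_mem_linJet (L' v).2))
  rw [h2, ← mapSym_add_topJet hJ (L' v).2, mapQ_mapSym_mapR hsymm hnd he] at h4
  have h5 := mapR_mapQ_mapSym hsymm hnd h1
  rw [h4] at h5
  exact h5

end JetBundles

/-! ## Equivariance -/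

section Equivariance

variable {V : Type*} [NormedAddCommGroup V] [NormedSpace ℝ V]
  {gg : BForm V} {N : ℕ} {A : V ≃L[ℝ] V}

theorem comp_append {X Y : Type*} (f : X → Y) {m n : ℕ} (a : Fin m → X) (b : Fin n → X) :
    (fun j => f (Fin.append a b j)) = Fin.append (fun j => f (a j)) fun j => f (b j) := by
  funext j
  refine Fin.addCases (fun j => ?_) (fun j => ?_) j
  · simp only [Fin.append_left]
  · simp only [Fin.append_right]

theorem comp_actJet (J : JetAmb V N) (i : ℕ) :
    comp (actJet A J) i = (comp J i).compContinuousLinearMap fun _ => (A.symm : V →L[ℝ] V) := by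
  unfold comp actJet
  split_ifs
  · rfl
  · rfl

theorem comp_actJet_append (J : JetAmb V N) {i : ℕ} (x : Fin i → V) (r : Fin 4 → V) :
    comp (actJet A J) i (Fin.append x r)
      = comp J i (Fin.append (fun j => A.symm (x j)) fun j => A.symm (r j)) := by
  rw [comp_actJet, ← comp_append]
  rfl

theorem symm_vecCons₄ (A : V ≃L[ℝ] V) (a b c d : V) :
    (fun j => A.symm ((![a, b, c, d] : Fin 4 → V) j)) = ![A.symm a, A.symm b, A.symm c, A.symm d] := by
  funext j
  fin_cases j <;> rfl

theorem symm_update {n : ℕ} (w : Fin n → V) (j : Fin n) (v : V) :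
    (fun i => A.symm (Function.update w j v i))
      = Function.update (fun i => A.symm (w i)) j (A.symm v) :=
  Function.comp_update A.symm w j v

theorem actSym_mem {h : SymAmb V N} (hh : h ∈ normalSum V N) : actSym A h ∈ normalSum V N := by
  refine fun i => ⟨fun σ v => ?_, fun v x y => ?_, fun ξ y => ?_⟩
  · ext x y
    rw [actSym_apply, actSym_apply]
    exact congrArg (fun β : BForm V => β (A.symm x) (A.symm y))
      ((hh i).1 σ fun j => A.symm (v j))
  · rw [actSym_apply, actSym_apply, (hh i).2.1]
  · rw [actSym_apply, (hh i).2.2]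

section FinDim

variable [FiniteDimensional ℝ V] (hnd : ∀ x, (∀ y, gg x y = 0) → x = 0)
  (hA : IsOrthogonal gg A)
include hnd hA

/-- Raising the index uses the inner product, so orthogonality of `A` is essential here; through
this lemma it enters the Ricci identities. -/
theorem curvOp_actJet (J : JetAmb V N) {s : ℕ} (x : Fin s → V) (y z u : V) :
    A.symm (curvOp gg (comp (actJet A J) s) x y z u)
      = curvOp gg (comp J s) (fun j => A.symm (x j)) (A.symm y) (A.symm z) (A.symm u) := by
  rw [← sub_eq_zero]
  refine hnd _ fun v => ?_
  have h1 := hA (A.symm (curvOp gg (comp (actJet A J) s) x y z u)) v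
  rw [A.apply_symm_apply, curvOp_spec gg hnd, comp_actJet_append, symm_vecCons₄,
    A.symm_apply_apply] at h1
  rw [map_sub, sub_apply, ← h1, curvOp_spec gg hnd, sub_self]

theorem ricciRHS_actJet (J : JetAmb V N) {s m : ℕ} (x : Fin s → V) (y z : V) (w : Fin m → V)
    (r : Fin 4 → V) : ricciRHS gg (actJet A J) x y z w r
      = ricciRHS gg J (fun j => A.symm (x j)) (A.symm y) (A.symm z) (fun j => A.symm (w j))
        fun j => A.symm (r j) := by
  refine Finset.sum_congr rfl fun S _ => ?_
  simp only [comp_actJet_append, comp_append A.symm, symm_update, curvOp_actJet hnd hA]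
  rfl

theorem actJet_mem {J : JetAmb V N} (hJ : J ∈ curvJets gg N) : actJet A J ∈ curvJets gg N := by
  refine ⟨fun i hi x => ⟨fun x₁ x₂ y₁ y₂ => ?_, fun x₁ x₂ y₁ y₂ => ?_, fun x₁ x₂ x₃ y => ?_⟩,
    fun i hi x x₁ x₂ x₃ y₁ y₂ => ?_, fun s m h x y z w r => ?_⟩
  · simp only [comp_actJet_append, symm_vecCons₄]
    exact (hJ.algCurv i hi _).skew _ _ _ _
  · simp only [comp_actJet_append, symm_vecCons₄]
    exact (hJ.algCurv i hi _).pair _ _ _ _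
  · simp only [comp_actJet_append, symm_vecCons₄]
    exact (hJ.algCurv i hi _).bianchi _ _ _ _
  · have h1 : ∀ v, (fun j => A.symm ((Fin.snoc x v : Fin (i + 1) → V) j))
        = (Fin.snoc (fun j => A.symm (x j)) (A.symm v) : Fin (i + 1) → V) := fun v =>
      Fin.comp_snoc A.symm x v
    simp only [comp_actJet_append, symm_vecCons₄, h1]
    exact hJ.bianchi₂ i hi _ _ _ _ _ _
  · have h1 : ∀ a b : V, (fun j => A.symm ((![a, b] : Fin 2 → V) j)) = ![A.symm a, A.symm b] :=
      fun a b => by funext j; fin_cases j <;> rfl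
    simp only [comp_actJet_append, comp_append A.symm, h1]
    rw [ricciRHS_actJet hnd hA]
    exact hJ.ricci s m h _ _ _ _ _

theorem mapSym_actJet {J : JetAmb V N} (hJ : J ∈ curvJets gg N) :
    mapSym N (actJet A J) = actSym A (mapSym N J) := by
  refine normalSum_ext (mapSym_mem (actJet_mem hnd hA hJ)) (actSym_mem (mapSym_mem hJ))
    fun i ξ x y => ?_
  rw [actSym_apply, mapSym_diag, mapSym_diag, jacobiForm_apply, jacobiForm_apply,
    ← comp_val (actJet A J) i, ← comp_val J i, comp_actJet_append, symm_vecCons₄]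

theorem endOf_actSym (H : SymAmb V N) (ξ : V) (j : ℕ) (x : V) :
    endOf gg (actSym A H) ξ j x = A (endOf gg H (A.symm ξ) j (A.symm x)) := by
  rw [← sub_eq_zero]
  refine hnd _ fun y => ?_
  have h1 := hA (endOf gg H (A.symm ξ) j (A.symm x)) (A.symm y)
  rw [A.apply_symm_apply, endOf_apply hnd] at h1
  rw [map_sub, sub_apply, endOf_apply hnd, h1]
  split_ifs
  · rw [actSym_apply, sub_self]
  · rw [sub_self]

theorem lift_endOf_actSym (H : SymAmb V N) (ξ : V) (w : FreeAlgebra ℝ ℕ) (x : V) :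
    FreeAlgebra.lift ℝ (endOf gg (actSym A H) ξ) w x
      = A (FreeAlgebra.lift ℝ (endOf gg H (A.symm ξ)) w (A.symm x)) := by
  induction w using FreeAlgebra.induction generalizing x with
  | grade0 r => simp [Algebra.algebraMap_eq_smul_one]
  | grade1 j => rw [FreeAlgebra.lift_ι_apply, FreeAlgebra.lift_ι_apply, endOf_actSym hnd hA]
  | mul a b ha hb =>
    rw [map_mul, map_mul, mul_apply_eq_comp, mul_apply_eq_comp, ha, hb, A.symm_apply_apply]
  | add a b ha hb => rw [map_add, map_add, add_apply, add_apply, ha, hb, map_add]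

variable (hsymm : ∀ x y, gg x y = gg y x)
include hsymm

theorem mapQ_actSym {H : SymAmb V N} (hH : H ∈ normalSum V N) :
    mapQ gg N (actSym A H) = actSym A (mapQ gg N H) := by
  have hH' := actSym_mem (A := A) hH
  refine normalSum_ext (mapQ_mem hsymm hnd hH') (actSym_mem (mapQ_mem hsymm hnd hH))
    fun i ξ x y => ?_
  rw [actSym_apply, mapQ_diag hsymm hnd hH', mapQ_diag hsymm hnd hH]
  simp only [smul_apply]
  rw [evalQ_apply hsymm hnd hH', evalQ_apply hsymm hnd hH]
  simp only [lift_endOf_actSym hnd hA, hA _ _]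

/-- The inverse of the equivariant map `Q ∘ 𝓡` is equivariant, so naturality of the Levi-Civita
connection need not be established. -/
theorem mapR_actSym {h : SymAmb V N} (hh : h ∈ normalSum V N) :
    mapR gg N (actSym A h) = actJet A (mapR gg N h) := by
  have hJ := mapR_mem hsymm hnd hh
  rw [← mapR_mapQ_mapSym hsymm hnd (actJet_mem hnd hA hJ), mapSym_actJet hnd hA hJ,
    mapQ_actSym hnd hA hsymm (mapSym_mem hJ), mapQ_mapSym_mapR hsymm hnd hh]

end FinDim

end Equivariance

end JetIso

theorem mainTheorem1 {V : Type*} [NormedAddCommGroup V] [NormedSpace ℝ V] [FiniteDimensional ℝ V]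
    (gg : V →L[ℝ] V →L[ℝ] ℝ) (hsymm : ∀ x y, gg x y = gg y x)
    (hnd : ∀ x, (∀ y, gg x y = 0) → x = 0) (k : ℕ) :
    -- `Jet^k 𝒞 → Jet^{k-1} 𝒞` is an affine vector bundle modelled on `𝒞_k`,
    (jetBundle gg k).IsAffineBundle ∧
    -- every algebraic `(k-1)`-jet extends to an algebraic `k`-jet,
    (∀ J ∈ curvJets gg k, ∃ J' ∈ curvJets gg (k + 1), truncJet V k J' = J) ∧
    -- the direct sum of the `𝒩_ℓ` is an affine vector bundle modelled on `𝒩_{k+2}`,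
    (normalBundle V k).IsAffineBundle ∧
    -- the three maps are isomorphisms of affine vector bundles,
    IsAffineBundleIso (normalBundle V k) (jetBundle gg k) (mapR gg (k + 1)) (mapR gg k) ∧
    IsAffineBundleIso (jetBundle gg k) (normalBundle V k) (mapSym (k + 1)) (mapSym k) ∧
    IsAffineBundleIso (normalBundle V k) (normalBundle V k) (mapQ gg (k + 1)) (mapQ gg k) ∧
    -- their composition is the identity,
    (∀ h ∈ normalSum V (k + 1), mapQ gg (k + 1) (mapSym (k + 1) (mapR gg (k + 1) h)) = h) ∧
    -- and they commute with the natural actions of the orthogonal group on the total spaces.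
    ∀ A : V ≃L[ℝ] V, IsOrthogonal gg A →
      Set.MapsTo (actJet A) (curvJets gg (k + 1)) (curvJets gg (k + 1)) ∧
      Set.MapsTo (actSym A) (normalSum V (k + 1)) (normalSum V (k + 1)) ∧
      (∀ h ∈ normalSum V (k + 1),
        mapR gg (k + 1) (actSym A h) = actJet A (mapR gg (k + 1) h)) ∧
      (∀ J ∈ curvJets gg (k + 1),
        mapSym (k + 1) (actJet A J) = actSym A (mapSym (k + 1) J)) ∧
      (∀ h ∈ normalSum V (k + 1),
        mapQ gg (k + 1) (actSym A h) = actSym A (mapQ gg (k + 1) h)) := by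
  refine ⟨isAffineBundle_jetBundle hsymm hnd, fun J hJ => ?_, isAffineBundle_normalBundle,
    isAffineBundleIso_mapR hsymm hnd, isAffineBundleIso_mapSym hsymm hnd,
    isAffineBundleIso_mapQ hsymm hnd, fun _ => mapQ_mapSym_mapR hsymm hnd,
    fun A hA => ⟨fun _ => actJet_mem hnd hA, fun _ => actSym_mem,
      fun _ => mapR_actSym hnd hA hsymm, fun _ => mapSym_actJet hnd hA,
      fun _ => mapQ_actSym hnd hA hsymm⟩⟩
  obtain ⟨G, _, hG⟩ := exists_section_truncJet (k := k) hsymm hnd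
  exact ⟨G J, hG J hJ⟩
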